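/- Let $L$ be the free complex Lie algebra on $x,y$, with bracket $[\,,]$. For $f\in L$ let $D_f$ be the derivation of $L$ with $D_f(x)=0$, $D_f(y)=[y,f]$, and set $\langle f,g\rangle=[f,g]+D_f(g)-D_g(f)$. Let $\overline{L}^0=[L,L]$ and $\overline{L}^{i+1}=[\overline{L}^0,\overline{L}^i]$ for $i\ge 0$; set $L_0=\overline L^0/\overline L^1$ and $L_1=\overline L^1/\overline L^2$. One has $\langle \overline L^i,\overline L^j\rangle\subset\overline L^{i+j}$ and $\langle\overline L^0,\overline L^0\rangle\subset\overline L^1$. So $\langle\,,\rangle$ induces commuting actions on $L_1$ of the elements of $L_0$, that is, an $S(L_0)$-module structure on $L_1$. Let $\mathfrak{grt}_1\subset [L,L]$ be the Grothendieck–Teichmüller Lie algebra, i.e. the set of $\psi=\psi(x,y)\in[L,L]$ such that, with $z=-x-y$, $$\psi(y,x)=-\psi(x,y),\qquad \psi(x,y)+\psi(y,z)+\psi(z,x)=0,\qquad [y,\psi(x,y)]+[z,\psi(x,z)]=0,$$ $$\psi(t_{12},t_{23}+t_{24})+\psi(t_{13}+t_{23},t_{34})=\psi(t_{23},t_{34})+\psi(t_{12}+t_{13},t_{24}+t_{34})+\psi(t_{12},t_{23}),$$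 the last identity being in the Lie algebra with generators $t_{ij}=t_{ji}$ ($1\le i\neq j\le 4$) and relations $[t_{ij},t_{kl}]=0$ and $[t_{ij},t_{ik}+t_{jk}]=0$ for distinct indices. Let $\Sigma\subset L_0$ be the image of $\mathfrak{grt}_1$ in $L_0$. For $k\ge0$ set $\mathrm{gr}^k_\Sigma(L_1)=S^k(\Sigma)\cdot L_1/S^{k+1}(\Sigma)\cdot L_1$. Let $\{\,,\}:\Lambda^2(\Sigma)\to \mathrm{gr}^0_\Sigma(L_1)$ be the map taking $\sigma\wedge\sigma'$ to the class of $\langle f,f'\rangle$, where $f,f'\in\overline L^0$ are any lifts of $\sigma,\sigma'$. Let $\mathbb M^{min}_0(\Sigma)\subset\mathrm{gr}^0_\Sigma(L_1)$ be its image, and let $\mathbb M^{min}_k(\Sigma)=S^k(\Sigma)\cdot\mathbb M^{min}_0(\Sigma)\subset\mathrm{gr}^k_\Sigma(L_1)$. The depth filtration of $[L,L]$ is the decreasing filtration $F^i_{dpth}$, $i\ge0$, where $F^i_{dpth}$ is the sum of the components of degree $\ge i$ in $y$. It induces decreasing filtrations on the subspace $\overline L^1$, the quotient $L_1$, the subspaces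 $S^k(\Sigma)\cdot L_1$, their quotients $\mathrm{gr}^k_\Sigma(L_1)$, and the subspaces $\mathbb M^{min}_k(\Sigma)$. Proposition. For each $k\ge 0$, $\mathbb M^{min}_k(\Sigma)$ is pure of depth $k+2$ for the depth filtration: $F^i_{dpth}(\mathbb M^{min}_k(\Sigma))=\mathbb M^{min}_k(\Sigma)$ for $i\le k+2$ and $F^i_{dpth}(\mathbb M^{min}_k(\Sigma))=0$ for $i> k+2$. -/

import Mathlib

noncomputable section

namespace GrtDepth

/-! ### The free Lie algebra on `x`, `y` and the bracket `⟨ , ⟩` -/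

/-- The free complex Lie algebra on two generators. -/
abbrev FreeL : Type := FreeLieAlgebra ℂ (Fin 2)

def x : FreeL := FreeLieAlgebra.of ℂ 0

def y : FreeL := FreeLieAlgebra.of ℂ 1

/-- The Lie algebra `L ⊕ εL` with `ε² = 0` (an auxiliary object, used to construct derivations of
a free Lie algebra from their values on generators). -/
def SqZero : Type := FreeL × FreeL

namespace SqZero

instance : AddCommGroup SqZero := inferInstanceAs (AddCommGroup (FreeL × FreeL))

instance : Module ℂ SqZero := inferInstanceAs (Module ℂ (FreeL × FreeL))

instance : Bracket SqZero SqZero :=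
  ⟨fun a b => (⁅a.1, b.1⁆, ⁅a.1, b.2⁆ - ⁅b.1, a.2⁆)⟩

@[simp] theorem fst_add (a b : SqZero) : (a + b).1 = a.1 + b.1 := rfl
@[simp] theorem snd_add (a b : SqZero) : (a + b).2 = a.2 + b.2 := rfl
@[simp] theorem fst_smul (t : ℂ) (a : SqZero) : (t • a).1 = t • a.1 := rfl
@[simp] theorem snd_smul (t : ℂ) (a : SqZero) : (t • a).2 = t • a.2 := rfl
@[simp] theorem fst_lie (a b : SqZero) : ⁅a, b⁆.1 = ⁅a.1, b.1⁆ := rfl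
@[simp] theorem snd_lie (a b : SqZero) : ⁅a, b⁆.2 = ⁅a.1, b.2⁆ - ⁅b.1, a.2⁆ := rfl
@[simp] theorem fst_zero : (0 : SqZero).1 = 0 := rfl
@[simp] theorem snd_zero : (0 : SqZero).2 = 0 := rfl

theorem ext' {a b : SqZero} (h₁ : a.1 = b.1) (h₂ : a.2 = b.2) : a = b := Prod.ext h₁ h₂

instance : LieRing SqZero where
  add_lie a b c := by
    apply ext'
    · simp
    · simp only [snd_lie, fst_add, snd_add, add_lie, lie_add]; abel
  lie_add a b c := by
    apply ext'
    · simp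
    · simp only [snd_lie, fst_add, snd_add, add_lie, lie_add]; abel
  lie_self a := by
    apply ext'
    · simp
    · simp
  leibniz_lie a b c := by
    apply ext'
    · simp
    · simp only [snd_lie, fst_lie, snd_add, lie_sub, lie_lie]; abel

instance : LieAlgebra ℂ SqZero where
  lie_smul t a b := by
    apply ext'
    · simp
    · simp [smul_sub]

end SqZero

/-- The Lie algebra morphism `id + ε D : L → L ⊕ εL`, where `D` is the derivation with given values
on the generators. -/
def derHom (v : Fin 2 → FreeL) : FreeL →ₗ⁅ℂ⁆ SqZero :=
  FreeLieAlgebra.lift ℂ (L := SqZero) (fun i => (FreeLieAlgebra.of ℂ i, v i))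

theorem derHom_of (v : Fin 2 → FreeL) (i : Fin 2) :
    derHom v (FreeLieAlgebra.of ℂ i) = (FreeLieAlgebra.of ℂ i, v i) :=
  FreeLieAlgebra.lift_of_apply (L := SqZero) _ i

def fstHom : SqZero →ₗ⁅ℂ⁆ FreeL where
  toFun a := a.1
  map_add' _ _ := rfl
  map_smul' _ _ := rfl
  map_lie' := rfl

theorem derHom_fst (v : Fin 2 → FreeL) (a : FreeL) : (derHom v a).1 = a := by
  have h : fstHom.comp (derHom v) = LieHom.id := by
    apply FreeLieAlgebra.hom_ext
    intro i
    change (derHom v (FreeLieAlgebra.of ℂ i)).1 = _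
    rw [derHom_of]; rfl
  exact congrArg (fun F : FreeL →ₗ⁅ℂ⁆ FreeL => F a) h

/-- The derivation of the free Lie algebra with prescribed values on the generators. -/
def derOf (v : Fin 2 → FreeL) : LieDerivation ℂ FreeL FreeL where
  toFun a := (derHom v a).2
  map_add' a b := by simp
  map_smul' t a := by simp
  leibniz' a b := by
    change (derHom v ⁅a, b⁆).2 = ⁅a, (derHom v b).2⁆ - ⁅b, (derHom v a).2⁆
    rw [LieHom.map_lie, SqZero.snd_lie, derHom_fst, derHom_fst]

/-- `D_f` is the derivation with `D_f x = 0` and `D_f y = [y, f]`. -/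
def D (f : FreeL) : LieDerivation ℂ FreeL FreeL := derOf ![0, ⁅y, f⁆]

theorem D_x (f : FreeL) : D f x = 0 := by
  change (derHom _ (FreeLieAlgebra.of ℂ 0)).2 = _
  rw [derHom_of]; rfl

theorem D_y (f : FreeL) : D f y = ⁅y, f⁆ := by
  change (derHom _ (FreeLieAlgebra.of ℂ 1)).2 = _
  rw [derHom_of]; rfl

/-- A subspace containing `x`, `y` and stable under the bracket is everything. -/
theorem eq_top_of_gen (S : LieSubalgebra ℂ FreeL) (hx : x ∈ S) (hy : y ∈ S) (a : FreeL) :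
    a ∈ S := by
  let F : FreeL →ₗ⁅ℂ⁆ S := FreeLieAlgebra.lift ℂ ![⟨x, hx⟩, ⟨y, hy⟩]
  have h : S.incl.comp F = LieHom.id := by
    apply FreeLieAlgebra.hom_ext
    intro i
    change ((F (FreeLieAlgebra.of ℂ i) : S) : FreeL) = _
    fin_cases i <;> simp [F, x, y]
  have h' : ((F a : S) : FreeL) = a := congrArg (fun G : FreeL →ₗ⁅ℂ⁆ FreeL => G a) h
  rw [← h']
  exact (F a).2

theorem der_ext {D₁ D₂ : LieDerivation ℂ FreeL FreeL} (hx : D₁ x = D₂ x) (hy : D₁ y = D₂ y) :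
    D₁ = D₂ := by
  let S : LieSubalgebra ℂ FreeL :=
    { carrier := {a | D₁ a = D₂ a}
      zero_mem' := by simp
      add_mem' := fun {a b} ha hb => by
        change D₁ a = D₂ a at ha; change D₁ b = D₂ b at hb; change D₁ (a + b) = D₂ (a + b)
        rw [map_add, map_add, ha, hb]
      smul_mem' := fun t a ha => by
        change D₁ a = D₂ a at ha; change D₁ (t • a) = D₂ (t • a)
        rw [map_smul, map_smul, ha]
      lie_mem' := fun {a b} ha hb => by
        change D₁ a = D₂ a at ha
        change D₁ b = D₂ b at hb
        change D₁ ⁅a, b⁆ = D₂ ⁅a, b⁆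
        rw [LieDerivation.apply_lie_eq_sub, LieDerivation.apply_lie_eq_sub, ha, hb] }
  ext a
  exact eq_top_of_gen S hx hy a

theorem D_add (f g : FreeL) : D (f + g) = D f + D g :=
  der_ext (by simp [D_x]) (by simp [D_y])

theorem D_smul (t : ℂ) (f : FreeL) : D (t • f) = t • D f :=
  der_ext (by simp [D_x]) (by simp [D_y])

/-- The bracket `⟨f, g⟩ = [f, g] + D_f g - D_g f`. -/
def ihara : FreeL →ₗ[ℂ] FreeL →ₗ[ℂ] FreeL :=
  LinearMap.mk₂ ℂ (fun f g => ⁅f, g⁆ + D f g - D g f)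
    (fun f f' g => by simp only [add_lie, D_add, LieDerivation.add_apply, map_add]; abel)
    (fun t f g => by
      simp only [smul_lie, D_smul, LieDerivation.smul_apply, map_smul, smul_add, smul_sub])
    (fun f g g' => by simp only [lie_add, D_add, LieDerivation.add_apply, map_add]; abel)
    (fun t f g => by
      simp only [lie_smul, D_smul, LieDerivation.smul_apply, map_smul, smul_add, smul_sub])

theorem ihara_apply (f g : FreeL) : ihara f g = ⁅f, g⁆ + D f g - D g f := rfl

/-! ### The filtration coming from the lower central series of `[L, L]` -/

/-- The derived ideal `[L, L]` of the free Lie algebra. -/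
def LBar : LieIdeal ℂ FreeL := ⁅(⊤ : LieIdeal ℂ FreeL), (⊤ : LieIdeal ℂ FreeL)⁆

/-- `lcs 0 = [L, L]` and `lcs (i + 1) = [[L, L], lcs i]`. -/
def lcs : ℕ → LieIdeal ℂ FreeL
  | 0 => LBar
  | i + 1 => ⁅LBar, lcs i⁆

theorem lcs_zero : lcs 0 = ⁅(⊤ : LieIdeal ℂ FreeL), (⊤ : LieIdeal ℂ FreeL)⁆ := rfl

theorem lcs_succ (i : ℕ) : lcs (i + 1) = ⁅lcs 0, lcs i⁆ := rfl

attribute [irreducible] lcs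

theorem lcs_succ_le (i : ℕ) : lcs (i + 1) ≤ lcs i := by
  rw [lcs_succ]; exact LieSubmodule.lie_le_right _ _

theorem lcs_le_zero (i : ℕ) : lcs i ≤ lcs 0 := by
  induction i with
  | zero => exact le_rfl
  | succ i ih => exact (lcs_succ_le i).trans ih

theorem lcs_succ_induction {i : ℕ} (P : Submodule ℂ FreeL)
    (h : ∀ u ∈ lcs 0, ∀ v ∈ lcs i, ⁅u, v⁆ ∈ P) {a : FreeL} (ha : a ∈ lcs (i + 1)) : a ∈ P := by
  have ha' : a ∈ (⁅lcs 0, lcs i⁆ : LieIdeal ℂ FreeL).toSubmodule := by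
    rw [← lcs_succ]; exact ha
  rw [LieSubmodule.lieIdeal_oper_eq_linear_span'] at ha'
  refine Submodule.span_le.2 ?_ ha'
  rintro _ ⟨u, hu, v, hv, rfl⟩
  exact h u hu v hv

theorem lie_mem_lcs {i j : ℕ} {a b : FreeL} (ha : a ∈ lcs i) (hb : b ∈ lcs j) :
    ⁅a, b⁆ ∈ lcs (i + j + 1) := by
  induction i generalizing j a b with
  | zero =>
    rw [Nat.zero_add, lcs_succ]
    exact LieSubmodule.lie_mem_lie ha hb
  | succ i ih =>
    let P : Submodule ℂ FreeL :=
      (lcs (i + 1 + j + 1)).toSubmodule.comap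
        ((LieModule.toEnd ℂ FreeL FreeL : FreeL →ₗ[ℂ] Module.End ℂ FreeL).flip b)
    have hP : ∀ c, c ∈ P ↔ ⁅c, b⁆ ∈ lcs (i + 1 + j + 1) := fun c => Iff.rfl
    rw [← hP]
    refine lcs_succ_induction P (fun u hu v hv => ?_) ha
    rw [hP, lie_lie]
    refine sub_mem ?_ ?_
    · have h := ih hv hb
      have e : i + 1 + j + 1 = (i + j + 1) + 1 := by omega
      rw [e, lcs_succ]
      exact LieSubmodule.lie_mem_lie hu h
    · have h : ⁅u, b⁆ ∈ lcs (j + 1) := by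
        rw [lcs_succ]; exact LieSubmodule.lie_mem_lie hu hb
      have e : i + 1 + j + 1 = i + (j + 1) + 1 := by omega
      rw [e]
      exact ih hv h

theorem D_mem {i : ℕ} {f : FreeL} (hf : f ∈ lcs i) (a : FreeL) : D f a ∈ lcs i := by
  let S : LieSubalgebra ℂ FreeL :=
    { (lcs i).toSubmodule.comap (D f : FreeL →ₗ[ℂ] FreeL) with
      lie_mem' := fun {a b} ha hb => by
        change D f a ∈ lcs i at ha
        change D f b ∈ lcs i at hb
        change D f ⁅a, b⁆ ∈ lcs i
        rw [LieDerivation.apply_lie_eq_sub]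
        exact sub_mem ((lcs i).lie_mem hb) ((lcs i).lie_mem ha) }
  refine eq_top_of_gen S ?_ ?_ a
  · change D f x ∈ lcs i
    rw [D_x]; exact zero_mem _
  · change D f y ∈ lcs i
    rw [D_y]; exact (lcs i).lie_mem hf

theorem D_mem_add {i j : ℕ} {f a : FreeL} (hf : f ∈ lcs i) (ha : a ∈ lcs j) :
    D f a ∈ lcs (i + j) := by
  induction j generalizing a with
  | zero => exact D_mem hf a
  | succ j ih =>
    refine lcs_succ_induction
      ((lcs (i + (j + 1))).toSubmodule.comap (D f : FreeL →ₗ[ℂ] FreeL)) (fun u hu v hv => ?_) ha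
    change D f ⁅u, v⁆ ∈ lcs (i + (j + 1))
    rw [LieDerivation.apply_lie_eq_sub]
    refine sub_mem ?_ ?_
    · have h := lie_mem_lcs hu (ih hv)
      rwa [Nat.zero_add] at h
    · have h := lie_mem_lcs hv (D_mem hf u)
      rwa [show j + i + 1 = i + (j + 1) by omega] at h

theorem ihara_mem {i j : ℕ} {f g : FreeL} (hf : f ∈ lcs i) (hg : g ∈ lcs j) :
    ihara f g ∈ lcs (i + j) := by
  rw [ihara_apply]
  refine sub_mem (add_mem (lcs_succ_le _ (lie_mem_lcs hf hg)) (D_mem_add hf hg)) ?_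
  rw [Nat.add_comm]
  exact D_mem_add hg hf

/-- Induction for `[L, L]`, which is the ideal generated by `[x, y]`. -/
theorem lcs_zero_induction (P : Submodule ℂ FreeL) (h0 : ⁅x, y⁆ ∈ P)
    (hx : ∀ a ∈ lcs 0, a ∈ P → ⁅x, a⁆ ∈ P) (hy : ∀ a ∈ lcs 0, a ∈ P → ⁅y, a⁆ ∈ P)
    {a : FreeL} (ha : a ∈ lcs 0) : a ∈ P := by
  have mem0 : ∀ u v : FreeL, ⁅u, v⁆ ∈ lcs 0 := fun u v => by
    rw [lcs_zero]; exact LieSubmodule.lie_mem_lie trivial trivial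
  let S : LieSubalgebra ℂ FreeL :=
    { carrier := {u | ∀ b ∈ lcs 0, b ∈ P → ⁅u, b⁆ ∈ P}
      zero_mem' := fun b _ _ => by rw [zero_lie]; exact zero_mem _
      add_mem' := fun {u v} hu hv b hb hbP => by
        rw [add_lie]; exact add_mem (hu b hb hbP) (hv b hb hbP)
      smul_mem' := fun t u hu b hb hbP => by
        rw [smul_lie]; exact P.smul_mem _ (hu b hb hbP)
      lie_mem' := fun {u v} hu hv b hb hbP => by
        rw [lie_lie]
        exact sub_mem (hu _ (mem0 _ _) (hv b hb hbP)) (hv _ (mem0 _ _) (hu b hb hbP)) }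
  have hS : ∀ u, ∀ b ∈ lcs 0, b ∈ P → ⁅u, b⁆ ∈ P := fun u => eq_top_of_gen S hx hy u
  let I : LieIdeal ℂ FreeL :=
    { P ⊓ (lcs 0).toSubmodule with
      lie_mem := fun {u b} hb => ⟨hS u b hb.2 hb.1, (lcs 0).lie_mem hb.2⟩ }
  have hI : ∀ b, b ∈ I ↔ b ∈ P ∧ b ∈ lcs 0 := fun b => Iff.rfl
  have hxy : ⁅x, y⁆ ∈ I := (hI _).2 ⟨h0, mem0 _ _⟩
  have hxI : ∀ v, ⁅x, v⁆ ∈ I := fun v => by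
    let S' : LieSubalgebra ℂ FreeL :=
      { I.toSubmodule.comap (LieModule.toEnd ℂ FreeL FreeL x) with
        lie_mem' := fun {a b} ha hb => by
          change ⁅x, a⁆ ∈ I at ha
          change ⁅x, b⁆ ∈ I at hb
          change ⁅x, ⁅a, b⁆⁆ ∈ I
          rw [leibniz_lie]
          refine add_mem ?_ (I.lie_mem hb)
          rw [← lie_skew]; exact neg_mem (I.lie_mem ha) }
    refine eq_top_of_gen S' ?_ hxy v
    change ⁅x, x⁆ ∈ I
    rw [lie_self]; exact zero_mem _
  have hyI : ∀ v, ⁅y, v⁆ ∈ I := fun v => by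
    let S' : LieSubalgebra ℂ FreeL :=
      { I.toSubmodule.comap (LieModule.toEnd ℂ FreeL FreeL y) with
        lie_mem' := fun {a b} ha hb => by
          change ⁅y, a⁆ ∈ I at ha
          change ⁅y, b⁆ ∈ I at hb
          change ⁅y, ⁅a, b⁆⁆ ∈ I
          rw [leibniz_lie]
          refine add_mem ?_ (I.lie_mem hb)
          rw [← lie_skew]; exact neg_mem (I.lie_mem ha) }
    refine eq_top_of_gen S' ?_ ?_ v
    · change ⁅y, x⁆ ∈ I
      rw [← lie_skew]; exact neg_mem hxy
    · change ⁅y, y⁆ ∈ I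
      rw [lie_self]; exact zero_mem _
  have hall : ∀ u v : FreeL, ⁅u, v⁆ ∈ I := fun u v => by
    let S' : LieSubalgebra ℂ FreeL :=
      { carrier := {u | ⁅u, v⁆ ∈ I}
        zero_mem' := by simp
        add_mem' := fun {a b} ha hb => by
          change ⁅a + b, v⁆ ∈ I
          rw [add_lie]; exact add_mem ha hb
        smul_mem' := fun t a ha => by
          change ⁅t • a, v⁆ ∈ I
          rw [smul_lie]; exact I.smul_mem _ ha
        lie_mem' := fun {a b} ha hb => by
          change ⁅⁅a, b⁆, v⁆ ∈ I
          rw [lie_lie]; exact sub_mem (I.lie_mem hb) (I.lie_mem ha) }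
    exact eq_top_of_gen S' (hxI v) (hyI v) u
  have hle : lcs 0 ≤ I := by
    rw [lcs_zero, LieSubmodule.lie_le_iff]
    exact fun u _ v _ => hall u v
  exact ((hI a).1 (hle ha)).1

theorem lie_mem_zero (u v : FreeL) : ⁅u, v⁆ ∈ lcs 0 := by
  rw [lcs_zero]; exact LieSubmodule.lie_mem_lie trivial trivial

/-- Modulo `lcs 1`, the element `D_{[u, g]} f` is `[u, D_g f]`. -/
theorem D_lie_aux (u : FreeL) {g f : FreeL} (hg : g ∈ lcs 0)
    (hf : f ∈ lcs 0) : D ⁅u, g⁆ f - ⁅u, D g f⁆ ∈ lcs 1 := by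
  let E : FreeL →ₗ[ℂ] FreeL :=
    (D ⁅u, g⁆ : FreeL →ₗ[ℂ] FreeL) - (LieModule.toEnd ℂ FreeL FreeL u) ∘ₗ (D g : FreeL →ₗ[ℂ] FreeL)
  have hE : ∀ b, E b = D ⁅u, g⁆ b - ⁅u, D g b⁆ := fun b => rfl
  let P : Submodule ℂ FreeL := (lcs 1).toSubmodule.comap E
  have hP : ∀ b, b ∈ P ↔ D ⁅u, g⁆ b - ⁅u, D g b⁆ ∈ lcs 1 := fun b => Iff.rfl
  have m1 : ∀ {a b : FreeL}, a ∈ lcs 0 → b ∈ lcs 0 → ⁅a, b⁆ ∈ lcs 1 := fun ha hb =>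
    lie_mem_lcs ha hb
  rw [← hP]
  refine lcs_zero_induction P ?_ ?_ ?_ hf
  · rw [hP]
    simp only [LieDerivation.apply_lie_eq_sub, D_x, D_y, lie_zero, sub_zero]
    have e : ⁅x, ⁅y, ⁅u, g⁆⁆⁆ - ⁅u, ⁅x, ⁅y, g⁆⁆⁆ =
        ⁅x, ⁅⁅y, u⁆, g⁆⁆ + ⁅⁅x, u⁆, ⁅y, g⁆⁆ := by
      rw [lie_lie x u, lie_lie y u g, lie_sub]; abel
    rw [e]
    exact add_mem ((lcs 1).lie_mem (m1 (lie_mem_zero _ _) hg))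
      (m1 (lie_mem_zero _ _) (lie_mem_zero _ _))
  · intro a ha haP
    rw [hP] at haP ⊢
    simp only [LieDerivation.apply_lie_eq_sub, D_x, lie_zero, sub_zero]
    have e : ⁅x, D ⁅u, g⁆ a⁆ - ⁅u, ⁅x, D g a⁆⁆ =
        ⁅x, D ⁅u, g⁆ a - ⁅u, D g a⁆⁆ + ⁅⁅x, u⁆, D g a⁆ := by
      rw [lie_lie x u, lie_sub]; abel
    rw [e]
    exact add_mem ((lcs 1).lie_mem haP) (m1 (lie_mem_zero _ _) (D_mem hg a))
  · intro a ha haP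
    rw [hP] at haP ⊢
    simp only [LieDerivation.apply_lie_eq_sub, D_y]
    have e : ⁅y, D ⁅u, g⁆ a⁆ - ⁅a, ⁅y, ⁅u, g⁆⁆⁆ - ⁅u, ⁅y, D g a⁆ - ⁅a, ⁅y, g⁆⁆⁆ =
        ⁅y, D ⁅u, g⁆ a - ⁅u, D g a⁆⁆ + ⁅⁅y, u⁆, D g a⁆ - ⁅a, ⁅y, ⁅u, g⁆⁆⁆
          + ⁅u, ⁅a, ⁅y, g⁆⁆⁆ := by
      rw [lie_lie y u, lie_sub, lie_sub]; abel
    rw [e]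
    exact add_mem (sub_mem
      (add_mem ((lcs 1).lie_mem haP) (m1 (lie_mem_zero _ _) (D_mem hg a)))
      (m1 ha (lie_mem_zero _ _))) ((lcs 1).lie_mem (m1 ha (lie_mem_zero _ _)))

theorem D_xy (f : FreeL) : D f ⁅x, y⁆ = ⁅x, ⁅y, f⁆⁆ := by
  simp [LieDerivation.apply_lie_eq_sub, D_x, D_y]

/-- `D_f g` is symmetric in `f` and `g` modulo `lcs 1`. -/
theorem D_symm_mem {f g : FreeL} (hf : f ∈ lcs 0) (hg : g ∈ lcs 0) :
    D f g - D g f ∈ lcs 1 := by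
  have m1 : ∀ {a b : FreeL}, a ∈ lcs 0 → b ∈ lcs 0 → ⁅a, b⁆ ∈ lcs 1 := fun ha hb =>
    lie_mem_lcs ha hb
  have key : ∀ {f : FreeL}, f ∈ lcs 0 → D f ⁅x, y⁆ - D ⁅x, y⁆ f ∈ lcs 1 := by
    intro f hf
    let E : FreeL →ₗ[ℂ] FreeL :=
      (LieModule.toEnd ℂ FreeL FreeL x) ∘ₗ (LieModule.toEnd ℂ FreeL FreeL y)
        - (D ⁅x, y⁆ : FreeL →ₗ[ℂ] FreeL)
    let P : Submodule ℂ FreeL := (lcs 1).toSubmodule.comap E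
    have hP : ∀ b, b ∈ P ↔ ⁅x, ⁅y, b⁆⁆ - D ⁅x, y⁆ b ∈ lcs 1 := fun b => Iff.rfl
    rw [D_xy, ← hP]
    refine lcs_zero_induction P ?_ ?_ ?_ hf
    · rw [hP, D_xy, sub_self]; exact zero_mem _
    · intro a ha haP
      rw [hP] at haP ⊢
      simp only [LieDerivation.apply_lie_eq_sub, D_x, lie_zero, sub_zero]
      have e : ⁅x, ⁅y, ⁅x, a⁆⁆⁆ - ⁅x, D ⁅x, y⁆ a⁆ =
          ⁅x, ⁅x, ⁅y, a⁆⁆ - D ⁅x, y⁆ a⁆ + ⁅x, ⁅⁅y, x⁆, a⁆⁆ := by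
        rw [lie_lie y x, lie_sub, lie_sub]; abel
      rw [e]
      exact add_mem ((lcs 1).lie_mem haP) ((lcs 1).lie_mem (m1 (lie_mem_zero _ _) ha))
    · intro a ha haP
      rw [hP] at haP ⊢
      simp only [LieDerivation.apply_lie_eq_sub, D_y]
      have e : ⁅x, ⁅y, ⁅y, a⁆⁆⁆ - (⁅y, D ⁅x, y⁆ a⁆ - ⁅a, ⁅y, ⁅x, y⁆⁆⁆) =
          ⁅y, ⁅x, ⁅y, a⁆⁆ - D ⁅x, y⁆ a⁆ + ⁅⁅x, y⁆, ⁅y, a⁆⁆ + ⁅a, ⁅y, ⁅x, y⁆⁆⁆ := by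
        rw [lie_lie x y ⁅y, a⁆, lie_sub]; abel
      rw [e]
      exact add_mem (add_mem ((lcs 1).lie_mem haP) (m1 (lie_mem_zero _ _) (lie_mem_zero _ _)))
        (m1 ha (lie_mem_zero _ _))
  let P : Submodule ℂ FreeL :=
    { carrier := {g | ∀ f ∈ lcs 0, D f g - D g f ∈ lcs 1}
      zero_mem' := fun f _ => by
        have h : D (0 : FreeL) = 0 := der_ext (by simp [D_x]) (by simp [D_y])
        simp [h]
      add_mem' := fun {a b} ha hb f hf => by
        have e : D f (a + b) - D (a + b) f = (D f a - D a f) + (D f b - D b f) := by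
          rw [D_add, map_add, LieDerivation.add_apply]; abel
        rw [e]; exact add_mem (ha f hf) (hb f hf)
      smul_mem' := fun t a ha f hf => by
        have e : D f (t • a) - D (t • a) f = t • (D f a - D a f) := by
          rw [D_smul, map_smul, LieDerivation.smul_apply, smul_sub]
        rw [e]; exact (lcs 1).smul_mem _ (ha f hf) }
  have hgP : g ∈ P := by
    refine lcs_zero_induction P (fun f hf => key hf) ?_ ?_ hg
    · intro a ha haP f hf
      have e : D f ⁅x, a⁆ - D ⁅x, a⁆ f = ⁅x, D f a - D a f⁆ - (D ⁅x, a⁆ f - ⁅x, D a f⁆) := by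
        simp only [LieDerivation.apply_lie_eq_sub, D_x, lie_zero, sub_zero, lie_sub]; abel
      rw [e]
      exact sub_mem ((lcs 1).lie_mem (haP f hf)) (D_lie_aux x ha hf)
    · intro a ha haP f hf
      have e : D f ⁅y, a⁆ - D ⁅y, a⁆ f =
          ⁅y, D f a - D a f⁆ - (D ⁅y, a⁆ f - ⁅y, D a f⁆) - ⁅a, ⁅y, f⁆⁆ := by
        simp only [LieDerivation.apply_lie_eq_sub, D_y, lie_sub]; abel
      rw [e]
      exact sub_mem (sub_mem ((lcs 1).lie_mem (haP f hf)) (D_lie_aux y ha hf))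
        (m1 ha (lie_mem_zero _ _))
  exact hgP f hf

theorem ihara_mem_one {f g : FreeL} (hf : f ∈ lcs 0) (hg : g ∈ lcs 0) : ihara f g ∈ lcs 1 := by
  rw [ihara_apply, add_sub_assoc]
  exact add_mem (lie_mem_lcs hf hg) (D_symm_mem hf hg)

/-! ### The spaces `L_0 = lcs 0 / lcs 1`, `L_1 = lcs 1 / lcs 2` and the extension `L_quot` -/

/-- `GrL i = lcs i / lcs (i + 1)`. -/
abbrev GrL (i : ℕ) : Type :=
  ↥(lcs i).toSubmodule ⧸ (lcs (i + 1)).toSubmodule.comap (lcs i).toSubmodule.subtype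

/-- The projection `lcs i → GrL i`. -/
abbrev cls (i : ℕ) : ↥(lcs i).toSubmodule →ₗ[ℂ] GrL i := Submodule.mkQ _

/-- `m ↦ ⟨f, m⟩` on `lcs 1`, for `f` in `lcs 0`. -/
def iharaRestrict : ↥(lcs 0).toSubmodule →ₗ[ℂ]
    ↥(lcs 1).toSubmodule →ₗ[ℂ] ↥(lcs 1).toSubmodule :=
  LinearMap.mk₂ ℂ (fun f m => ⟨ihara f.1 m.1, ihara_mem f.2 m.2⟩)
    (fun f f' m => Subtype.ext (by simp)) (fun t f m => Subtype.ext (by simp))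
    (fun f m m' => Subtype.ext (by simp)) (fun t f m => Subtype.ext (by simp))

/-- The action of `lcs 0` on `GrL 1` induced by `⟨ , ⟩`. -/
def actAux : ↥(lcs 0).toSubmodule →ₗ[ℂ] GrL 1 →ₗ[ℂ] GrL 1 where
  toFun f := Submodule.mapQ _ _ (iharaRestrict f) (fun m hm => by
    change ihara f.1 m.1 ∈ lcs 2
    have h := ihara_mem f.2 (show m.1 ∈ lcs 2 from hm)
    rwa [Nat.zero_add] at h)
  map_add' f f' := by
    ext m; simp
  map_smul' t f := by
    ext m; simp

/-- The action of `GrL 0` on `GrL 1`: the class of `f` sends the class of `m` to the class of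
`⟨f, m⟩`. -/
def act : GrL 0 →ₗ[ℂ] GrL 1 →ₗ[ℂ] GrL 1 :=
  Submodule.liftQ _ actAux (fun f hf => by
    rw [LinearMap.mem_ker]
    ext m
    change cls 1 (iharaRestrict f m) = 0
    rw [Submodule.mkQ_apply, Submodule.Quotient.mk_eq_zero]
    exact ihara_mem (show f.1 ∈ lcs 1 from hf) m.2)

theorem act_cls (f : ↥(lcs 0).toSubmodule) (m : ↥(lcs 1).toSubmodule) :
    act (cls 0 f) (cls 1 m) = cls 1 ⟨ihara f.1 m.1, ihara_mem f.2 m.2⟩ := rfl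

/-- For `f, g` in `lcs 0`, the class in `GrL 1` of `⟨f, g⟩`, which lies in `lcs 1`. -/
def brk (f g : ↥(lcs 0).toSubmodule) : GrL 1 :=
  cls 1 ⟨ihara f.1 g.1, ihara_mem_one f.2 g.2⟩

/-! ### The structure attached to a subspace of `L_0` -/

section Structure

variable (X : Submodule ℂ (GrL 0))

/-- `powAct X k` is the subspace `S^k(X) · L_1` of `L_1`, spanned by the `σ_1 · (σ_2 · (⋯ σ_k · m))`
with `σ_i` in `X` and `m` in `L_1`. -/
def powAct : ℕ → Submodule ℂ (GrL 1)
  | 0 => ⊤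
  | k + 1 => Submodule.map₂ act X (powAct k)

/-- `S^k(X) · L_1 / S^{k+1}(X) · L_1`. -/
abbrev GrX (k : ℕ) : Type :=
  ↥(powAct X k) ⧸ (powAct X (k + 1)).comap (powAct X k).subtype

/-- The map `S^k(X) · L_1 → S^{k+1}(X) · L_1` given by an element of `X`. -/
def mulX (k : ℕ) (s : X) : ↥(powAct X k) →ₗ[ℂ] ↥(powAct X (k + 1)) :=
  (act s.1).restrict (fun _ hm => Submodule.apply_mem_map₂ act s.2 hm)

/-- The action of an element of `X` on the associated graded, raising the degree by one. -/
def grMulX (k : ℕ) (s : X) : GrX X k →ₗ[ℂ] GrX X (k + 1) :=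
  Submodule.mapQ _ _ (mulX X k s)
    (fun _ hm => Submodule.apply_mem_map₂ act s.2 hm)

/-- `Mmin X 0` is the image of `Λ²(X) → gr^0`, `σ ∧ σ' ↦` class of `⟨f, f'⟩` for any lifts `f, f'`
of `σ, σ'` to `lcs 0` (another choice of lifts changes `⟨f, f'⟩` by an element of `X · L_1`),
and `Mmin X k = S^k(X) · Mmin X 0`. -/
def Mmin : (k : ℕ) → Submodule ℂ (GrX X k)
  | 0 => Submodule.span ℂ
      {c | ∃ f f' : ↥(lcs 0).toSubmodule, cls 0 f ∈ X ∧ cls 0 f' ∈ X ∧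
        c = Submodule.Quotient.mk ⟨brk f f', Submodule.mem_top⟩}
  | k + 1 => ⨆ s : X, (Mmin k).map (grMulX X k s)

end Structure

/-! ### The depth filtrations -/

/-- `IsMonomial a d`: `a` is an iterated bracket of letters `x, y` in which `y` occurs `d` times. -/
inductive IsMonomial : FreeL → ℕ → Prop
  | x : IsMonomial x 0
  | y : IsMonomial y 1
  | lie {a b : FreeL} {d e : ℕ} : IsMonomial a d → IsMonomial b e → IsMonomial ⁅a, b⁆ (d + e)

/-- The part of `y`-degree `d` of the free Lie algebra. -/
def yPart (d : ℕ) : Submodule ℂ FreeL := Submodule.span ℂ {a | IsMonomial a d}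

/-- The depth filtration of `[L, L]`: the sum of its parts of `y`-degree `≥ i`. -/
def depth (i : ℕ) : Submodule ℂ FreeL := ⨆ j ≥ i, yPart j ⊓ (lcs 0).toSubmodule

/-- The depth filtration of `L_1`, image of that of `[L, L]`. -/
def depthL1 (i : ℕ) : Submodule ℂ (GrL 1) :=
  ((depth i).comap (lcs 1).toSubmodule.subtype).map (cls 1)

/-- The filtration induced on the subquotients `S^k(X) · L_1 / S^{k+1}(X) · L_1` of `L_1`. -/
def depthGrX (X : Submodule ℂ (GrL 0)) (k i : ℕ) : Submodule ℂ (GrX X k) :=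
  ((depthL1 i).comap (powAct X k).subtype).map (Submodule.mkQ _)

/-- The filtration induced on `Mmin X k`. -/
def depthMmin (X : Submodule ℂ (GrL 0)) (k i : ℕ) : Submodule ℂ ↥(Mmin X k) :=
  (depthGrX X k i).comap (Mmin X k).subtype

/-- A decreasing filtration `F` of `W` is pure of degree `d` if it is concentrated in degree `d`:
`F i` is all of `W` for `i ≤ d` and zero for `i > d`. -/
def IsPure {W : Type*} [AddCommGroup W] [Module ℂ W] (F : ℕ → Submodule ℂ W) (d : ℕ) : Prop :=
  ∀ i, (i ≤ d → F i = ⊤) ∧ (d < i → F i = ⊥)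

/-! ### The Grothendieck-Teichmüller Lie algebra -/

/-- Generators of the free Lie algebra on `t_{ij}`, `i, j ∈ {0, 1, 2, 3}`. -/
def tGen (i j : Fin 4) : FreeLieAlgebra ℂ (Fin 4 × Fin 4) := FreeLieAlgebra.of ℂ (i, j)

/-- The infinitesimal pure braid relations. -/
inductive IsBraidRel : FreeLieAlgebra ℂ (Fin 4 × Fin 4) → Prop
  | diag (i : Fin 4) : IsBraidRel (tGen i i)
  | symm (i j : Fin 4) : IsBraidRel (tGen i j - tGen j i)
  | comm (i j k l : Fin 4) : i ≠ j → i ≠ k → i ≠ l → j ≠ k → j ≠ l → k ≠ l →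
      IsBraidRel ⁅tGen i j, tGen k l⁆
  | triple (i j k : Fin 4) : i ≠ j → i ≠ k → j ≠ k →
      IsBraidRel ⁅tGen i j, tGen i k + tGen j k⁆

/-- The ideal generated by the infinitesimal pure braid relations. -/
def braidIdeal : LieIdeal ℂ (FreeLieAlgebra ℂ (Fin 4 × Fin 4)) :=
  LieSubmodule.lieSpan ℂ _ {a | IsBraidRel a}

/-- The Lie algebra of infinitesimal pure braids on four strands. -/
abbrev Braid4 : Type := FreeLieAlgebra ℂ (Fin 4 × Fin 4) ⧸ braidIdeal

/-- The class of `t_{ij}`; the strands are numbered `0, 1, 2, 3`. -/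
def t (i j : Fin 4) : Braid4 := LieSubmodule.Quotient.mk' braidIdeal (tGen i j)

/-- `subst a b ψ = ψ(a, b)`, the image of `ψ` under the morphism `x ↦ a`, `y ↦ b`. -/
def subst {K : Type*} [LieRing K] [LieAlgebra ℂ K] (a b : K) : FreeL →ₗ⁅ℂ⁆ K :=
  FreeLieAlgebra.lift ℂ ![a, b]

/-- The defining equations of `grt_1`: antisymmetry, the two hexagon relations and the pentagon
relation. In the hexagon relations, `z = -x-y`. -/
structure IsGrt (ψ : FreeL) : Prop where
  antisymm : subst y x ψ = -subst x y ψ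
  cyclic : subst x y ψ + subst y (-x - y) ψ + subst (-x - y) x ψ = 0
  special : ⁅y, subst x y ψ⁆ + ⁅-x - y, subst x (-x - y) ψ⁆ = 0
  pentagon :
    subst (t 0 1) (t 1 2 + t 1 3) ψ + subst (t 0 2 + t 1 2) (t 2 3) ψ =
      subst (t 1 2) (t 2 3) ψ + subst (t 0 1 + t 0 2) (t 1 3 + t 2 3) ψ + subst (t 0 1) (t 1 2) ψ

/-- The Grothendieck-Teichmüller Lie algebra `grt_1`, as a subspace of the free Lie algebra. -/
def grt1 : Submodule ℂ FreeL where
  carrier := {ψ | IsGrt ψ}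
  zero_mem' := ⟨by simp, by simp, by simp, by simp⟩
  add_mem' := fun {a b} ha hb => by
    refine ⟨?_, ?_, ?_, ?_⟩
    · simp only [map_add, ha.antisymm, hb.antisymm]; abel
    · have h := congrArg₂ (· + ·) ha.cyclic hb.cyclic
      simp only [add_zero] at h
      simp only [map_add]; rw [← h]; abel
    · have h := congrArg₂ (· + ·) ha.special hb.special
      simp only [add_zero] at h
      simp only [map_add, lie_add]; rw [← h]; abel
    · have h := congrArg₂ (· + ·) ha.pentagon hb.pentagon
      simp only [map_add]
      calc _ = _ := by abel
        _ = _ := h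
        _ = _ := by abel
  smul_mem' := fun c a ha => by
    refine ⟨?_, ?_, ?_, ?_⟩
    · simp only [map_smul, ha.antisymm, smul_neg]
    · simp only [map_smul, ← smul_add, ha.cyclic, smul_zero]
    · simp only [map_smul, lie_smul, ← smul_add, ha.special, smul_zero]
    · simp only [map_smul, ← smul_add, ha.pentagon]

/-- `Σ = gr^0_lcs(grt_1)`: the image of `grt_1 ∩ [L, L]` in `L_0`. -/
def Sig : Submodule ℂ (GrL 0) := (grt1.comap (lcs 0).toSubmodule.subtype).map (cls 0)

end GrtDepth

end

/-! The lower bound is formal: `[L, L]` has depth at least 1 and `⟨ , ⟩` adds depths, so `Mmin` lies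
in depth at least `k + 2` (`Mmin_le_depthGrX`). The content is that a class of depth greater than `k
+ 2` vanishes.

Polynomial model. `L_0` is spanned by the classes `nu p` with `p(X, Y)` a polynomial, and a
triangular representation embeds `L_1` into `ℂ[X₁, Y₁, X₂, Y₂]` (`cbar_injective`). There a class of
`L_0` acts as multiplication by a symmetric weight (`cbar_act`). The depth of an element of `L_1` is
bounded by the order in `Y` of its polynomial, shifted by 2.

The space `Σ`. Antisymmetry, the hexagons and the pentagon, read in matrix representations, make `X
Y p(X, Y)` a symmetric 2-cocycle of the additive group. Hence `Σ` is contained in the span of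
classes `s_n`, with `n ≥ 3` odd and `X Y p = (X + Y)^n - X^n - Y^n` (`Sig_le_sSpan`). In the other
direction, only the explicit elements of degrees 3 and 5 of `grt_1` are needed.

The ideal. The weight `P_n` of `s_n` is minus the `n`-th power sum of the entries of a 3 × 3 matrix
`w` with zero row and column sums. The locus `P_3 = P_5 = 0` is a union of 15 planes, as many as the
product of the degrees. A polynomial vanishing on all of them lies in `J = (P_3, P_5)` (`mem_fJ`),
and every `P_n` with `n` odd vanishes on them. So `J` governs the whole action of `Σ`: the image of
`J^k` in `L_1` lies in `S^k(Σ) · L_1` (`Lam_mem_powAct`).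

The bracket. The polynomial of `⟨s_a, s_b⟩` is `X₁ X₂ c` with `(X₁ + X₂) Y₁ Y₂ c = P_a N_b - P_b
N_a`. It turns out that `c` vanishes on 11 of the planes, and on the other four equals the same
function up to sign. One of these four is `Y₁ = Y₂ = 0`, where restriction computes the leading term
in `Y`, that is, the part of lowest depth. If that part vanishes then `c` vanishes on all 15 planes
and lies in `J`: this is the case `k = 0`.

General `k`. Elements of `Mmin` are represented by binary forms of degree `k` in `P_3`, `P_5`, with
coefficients of the same kind (`IsGood`). On the four planes the normal derivatives of `P_n`
coincide and give the leading term `ell n` of `P_n` in `Y`. Since `ell 3` and `ell 5` have nonzero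
determinant, a vanishing leading term forces every coefficient of the form into `J`, so the element
lies in `S^{k+1}(Σ) · L_1` (`IsGood.mem_powAct`). -/

set_option linter.unusedSimpArgs false

noncomputable section

namespace GrtDepth

/-! ### Substitution morphisms -/

section Subst

variable {K : Type*} [LieRing K] [LieAlgebra ℂ K]

@[simp] theorem subst_x (a b : K) : subst a b x = a := by
  simp [subst, x]

@[simp] theorem subst_y (a b : K) : subst a b y = b := by
  simp [subst, y]

theorem lie_subst_eq_zero {a b c : K} (ha : ⁅c, a⁆ = 0) (hb : ⁅c, b⁆ = 0) (u : FreeL) :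
    ⁅c, subst a b u⁆ = 0 := by
  let S : LieSubalgebra ℂ FreeL :=
    { carrier := {u | ⁅c, subst a b u⁆ = 0}
      zero_mem' := by simp
      add_mem' := fun {u v} hu hv => by
        change ⁅c, subst a b (u + v)⁆ = 0
        rw [map_add, lie_add, show ⁅c, subst a b u⁆ = 0 from hu,
          show ⁅c, subst a b v⁆ = 0 from hv, add_zero]
      smul_mem' := fun r u hu => by
        change ⁅c, subst a b (r • u)⁆ = 0
        rw [map_smul, lie_smul, show ⁅c, subst a b u⁆ = 0 from hu, smul_zero]
      lie_mem' := fun {u v} hu hv => by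
        change ⁅c, subst a b ⁅u, v⁆⁆ = 0
        rw [LieHom.map_lie, leibniz_lie, show ⁅c, subst a b u⁆ = 0 from hu,
          show ⁅c, subst a b v⁆ = 0 from hv, zero_lie, lie_zero, add_zero] }
  exact eq_top_of_gen S (by change _ = _; simpa using ha) (by change _ = _; simpa using hb) u

/-- On `[L, L]`, substitution does not change when an element commuting with both arguments is
subtracted from the first one. -/
theorem subst_sub_central {a b c : K} (ha : ⁅c, a⁆ = 0) (hb : ⁅c, b⁆ = 0) {u : FreeL}
    (hu : u ∈ lcs 0) : subst (a - c) b u = subst a b u := by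
  let P : Submodule ℂ FreeL :=
    LinearMap.eqLocus (subst (a - c) b : FreeL →ₗ[ℂ] K) (subst a b : FreeL →ₗ[ℂ] K)
  have hP : ∀ v, v ∈ P ↔ subst (a - c) b v = subst a b v := fun v => Iff.rfl
  rw [← hP]
  refine lcs_zero_induction P ?_ ?_ ?_ hu
  · rw [hP]; simp [sub_lie, hb]
  · intro v _ hv
    rw [hP] at hv ⊢
    rw [LieHom.map_lie, LieHom.map_lie, hv, subst_x, subst_x, sub_lie, lie_subst_eq_zero ha hb,
      sub_zero]
  · intro v _ hv
    rw [hP] at hv ⊢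
    rw [LieHom.map_lie, LieHom.map_lie, hv, subst_y, subst_y]

theorem subst_comp {K' : Type*} [LieRing K'] [LieAlgebra ℂ K'] (φ : K →ₗ⁅ℂ⁆ K') (a b : K)
    (u : FreeL) : φ (subst a b u) = subst (φ a) (φ b) u := by
  have h : φ.comp (subst a b) = subst (φ a) (φ b) := by
    apply FreeLieAlgebra.hom_ext
    intro i
    fin_cases i
    · change φ (subst a b x) = subst (φ a) (φ b) x; simp
    · change φ (subst a b y) = subst (φ a) (φ b) y; simp
  exact congrArg (fun F : FreeL →ₗ⁅ℂ⁆ K' => F u) h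

end Subst

/-! ### Relations in the braid Lie algebra -/

theorem mk_eq_zero_of_isBraidRel {u : FreeLieAlgebra ℂ (Fin 4 × Fin 4)} (h : IsBraidRel u) :
    LieSubmodule.Quotient.mk' braidIdeal u = 0 := by
  rw [← LieModuleHom.mem_ker, LieSubmodule.Quotient.mk'_ker]
  exact LieSubmodule.subset_lieSpan h

theorem t_symm (i j : Fin 4) : t i j = t j i := by
  have h := mk_eq_zero_of_isBraidRel (IsBraidRel.symm i j)
  rw [map_sub] at h
  exact sub_eq_zero.1 h

theorem t_comm {i j k l : Fin 4} (h₁ : i ≠ j) (h₂ : i ≠ k) (h₃ : i ≠ l) (h₄ : j ≠ k) (h₅ : j ≠ l)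
    (h₆ : k ≠ l) : ⁅t i j, t k l⁆ = 0 :=
  mk_eq_zero_of_isBraidRel (IsBraidRel.comm i j k l h₁ h₂ h₃ h₄ h₅ h₆)

theorem t_triple {i j k : Fin 4} (h₁ : i ≠ j) (h₂ : i ≠ k) (h₃ : j ≠ k) :
    ⁅t i j, t i k⁆ = -⁅t i j, t j k⁆ := by
  have h := mk_eq_zero_of_isBraidRel (IsBraidRel.triple i j k h₁ h₂ h₃)
  have h' : ⁅t i j, t i k + t j k⁆ = 0 := h
  rw [lie_add] at h'
  exact eq_neg_of_add_eq_zero_left h'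

/-! ### Elements of degree three and five of `grt_1` -/

/-- The element of degree three of `grt_1`. -/
def sigma3 : FreeL := ⁅x, ⁅x, y⁆⁆ + ⁅y, ⁅x, y⁆⁆

/-- The element of degree five of `grt_1`. -/
def sigma5 : FreeL :=
  (2:ℂ) • ⁅x, ⁅x, ⁅x, ⁅x, y⁆⁆⁆⁆ + ⁅x, ⁅x, ⁅y, ⁅x, y⁆⁆⁆⁆ + (3:ℂ) • ⁅y, ⁅x, ⁅x, ⁅x, y⁆⁆⁆⁆
    + (2:ℂ) • ⁅y, ⁅y, ⁅y, ⁅x, y⁆⁆⁆⁆ + ⁅y, ⁅y, ⁅x, ⁅x, y⁆⁆⁆⁆ + (3:ℂ) • ⁅x, ⁅y, ⁅y, ⁅x, y⁆⁆⁆⁆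

theorem sigma3_mem_lcs : sigma3 ∈ lcs 0 :=
  add_mem (lie_mem_zero _ _) (lie_mem_zero _ _)

theorem sigma5_mem_lcs : sigma5 ∈ lcs 0 := by
  refine add_mem (add_mem (add_mem (add_mem (add_mem ?_ ?_) ?_) ?_) ?_) ?_
  all_goals first | exact lie_mem_zero _ _ | exact (lcs 0).smul_mem _ (lie_mem_zero _ _)

/-! ### The pentagon for the two explicit elements -/

section Subst

variable {K : Type*} [LieRing K] [LieAlgebra ℂ K]

theorem subst_sigma3 (a b : K) : subst a b sigma3 = ⁅a, ⁅a, b⁆⁆ + ⁅b, ⁅a, b⁆⁆ := by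
  simp [sigma3]

theorem subst_sigma5 (a b : K) : subst a b sigma5 =
    (2:ℂ) • ⁅a, ⁅a, ⁅a, ⁅a, b⁆⁆⁆⁆ + ⁅a, ⁅a, ⁅b, ⁅a, b⁆⁆⁆⁆ + (3:ℂ) • ⁅b, ⁅a, ⁅a, ⁅a, b⁆⁆⁆⁆
    + (2:ℂ) • ⁅b, ⁅b, ⁅b, ⁅a, b⁆⁆⁆⁆ + ⁅b, ⁅b, ⁅a, ⁅a, b⁆⁆⁆⁆ + (3:ℂ) • ⁅a, ⁅b, ⁅b, ⁅a, b⁆⁆⁆⁆ := by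
  simp [sigma5]

/-- Models the pentagon with `p, q = t₁₂, t₂₃` and `a, b, c = t₁₄, t₂₄, t₃₄`: the hypotheses say how
`p` and `q` act as derivations on the subalgebra generated by `a, b, c`. The arguments `-a-b-c` and
`-b-c` replace those involving `t₁₃`, from which they differ by a commuting element. -/
theorem pentagon_sigma3 {p q a b c : K}
    (pa : ⁅p, a⁆ = ⁅a, b⁆) (pb : ⁅p, b⁆ = -⁅a, b⁆) (pc : ⁅p, c⁆ = 0)
    (qa : ⁅q, a⁆ = 0) (qb : ⁅q, b⁆ = ⁅b, c⁆) (_ : ⁅q, c⁆ = -⁅b, c⁆) :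
    subst p (q + b) sigma3 + subst (-a-b-c) c sigma3 =
      subst (-b-c) c sigma3 + subst (-a-b-c) (b + c) sigma3 + subst p q sigma3 := by
  have ba : ⁅b, a⁆ = - ⁅a, b⁆ := (lie_skew _ _).symm
  have ca : ⁅c, a⁆ = - ⁅a, c⁆ := (lie_skew _ _).symm
  have cb : ⁅c, b⁆ = - ⁅b, c⁆ := (lie_skew _ _).symm
  have Lpb : ⁅p, ⁅b, c⁆⁆ = -⁅⁅a, b⁆, c⁆ := by rw [leibniz_lie, pb, pc, neg_lie, lie_zero, add_zero]
  have Lqb : ⁅q, ⁅a, b⁆⁆ = ⁅a, ⁅b, c⁆⁆ := by rw [leibniz_lie, qa, qb, zero_lie, zero_add]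
  have Lpa : ⁅p, ⁅a, b⁆⁆ = ⁅⁅a, b⁆, b⁆ - ⁅a, ⁅a, b⁆⁆ := by
    rw [leibniz_lie, pa, pb, lie_neg, sub_eq_add_neg]
  have Bpq : ⁅b, ⁅p, q⁆⁆ = -⁅p, ⁅q, b⁆⁆ + ⁅q, ⁅p, b⁆⁆ := by rw [← lie_skew, lie_lie]; abel
  have J : ⁅c, ⁅a, b⁆⁆ = ⁅b, ⁅a, c⁆⁆ - ⁅a, ⁅b, c⁆⁆ := by
    rw [← lie_skew c, lie_lie]; abel
  simp only [subst_sigma3, lie_add, add_lie, lie_sub, sub_lie, lie_neg, neg_lie, lie_zero, lie_self,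
    lie_lie, pa, pb, pc, qa, qb, ba, ca, cb, Lpa, Lpb, Lqb, Bpq, J]
  abel

set_option maxHeartbeats 2000000 in
theorem pentagon_sigma5 {p q a b c : K}
    (pa : ⁅p, a⁆ = ⁅a, b⁆) (pb : ⁅p, b⁆ = -⁅a, b⁆) (pc : ⁅p, c⁆ = 0)
    (qa : ⁅q, a⁆ = 0) (qb : ⁅q, b⁆ = ⁅b, c⁆) (qc : ⁅q, c⁆ = -⁅b, c⁆) :
    subst p (q + b) sigma5 + subst (-a-b-c) c sigma5 =
      subst (-b-c) c sigma5 + subst (-a-b-c) (b + c) sigma5 + subst p q sigma5 := by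
  have ba : ⁅b, a⁆ = - ⁅a, b⁆ := (lie_skew _ _).symm
  have ca : ⁅c, a⁆ = - ⁅a, c⁆ := (lie_skew _ _).symm
  have cb : ⁅c, b⁆ = - ⁅b, c⁆ := (lie_skew _ _).symm
  have bp : ⁅b, p⁆ = ⁅a, b⁆ := by rw [← lie_skew, pb, neg_neg]
  have Lpa : ∀ u : K, ⁅p, ⁅a, u⁆⁆ = ⁅a, ⁅b, u⁆⁆ - ⁅b, ⁅a, u⁆⁆ + ⁅a, ⁅p, u⁆⁆ := fun u => by
    rw [leibniz_lie, pa, lie_lie]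
  have Lpb : ∀ u : K, ⁅p, ⁅b, u⁆⁆ = -(⁅a, ⁅b, u⁆⁆ - ⁅b, ⁅a, u⁆⁆) + ⁅b, ⁅p, u⁆⁆ := fun u => by
    rw [leibniz_lie, pb, neg_lie, lie_lie]
  have Lpc : ∀ u : K, ⁅p, ⁅c, u⁆⁆ = ⁅c, ⁅p, u⁆⁆ := fun u => by
    rw [leibniz_lie, pc, zero_lie, zero_add]
  have Lqa : ∀ u : K, ⁅q, ⁅a, u⁆⁆ = ⁅a, ⁅q, u⁆⁆ := fun u => by
    rw [leibniz_lie, qa, zero_lie, zero_add]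
  have Lqb : ∀ u : K, ⁅q, ⁅b, u⁆⁆ = (⁅b, ⁅c, u⁆⁆ - ⁅c, ⁅b, u⁆⁆) + ⁅b, ⁅q, u⁆⁆ := fun u => by
    rw [leibniz_lie, qb, lie_lie]
  have Lqc : ∀ u : K, ⁅q, ⁅c, u⁆⁆ = -(⁅b, ⁅c, u⁆⁆ - ⁅c, ⁅b, u⁆⁆) + ⁅c, ⁅q, u⁆⁆ := fun u => by
    rw [leibniz_lie, qc, neg_lie, lie_lie]
  have Bpq : ⁅b, ⁅p, q⁆⁆ = -⁅p, ⁅q, b⁆⁆ + ⁅q, ⁅p, b⁆⁆ := by rw [← lie_skew, lie_lie]; abel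
  have Bppq : ⁅b, ⁅p, ⁅p, q⁆⁆⁆ = -(⁅p, ⁅⁅p, q⁆, b⁆⁆ - ⁅⁅p, q⁆, ⁅p, b⁆⁆) := by
    rw [← lie_skew, lie_lie]
  have Bpppq : ⁅b, ⁅p, ⁅p, ⁅p, q⁆⁆⁆⁆ = -(⁅p, ⁅⁅p, ⁅p, q⁆⁆, b⁆⁆ - ⁅⁅p, ⁅p, q⁆⁆, ⁅p, b⁆⁆) := by
    rw [← lie_skew, lie_lie]
  have Bqpq : ⁅b, ⁅q, ⁅p, q⁆⁆⁆ = -(⁅q, ⁅⁅p, q⁆, b⁆⁆ - ⁅⁅p, q⁆, ⁅q, b⁆⁆) := by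
    rw [← lie_skew, lie_lie]
  have Bqqpq : ⁅b, ⁅q, ⁅q, ⁅p, q⁆⁆⁆⁆ = -(⁅q, ⁅⁅q, ⁅p, q⁆⁆, b⁆⁆ - ⁅⁅q, ⁅p, q⁆⁆, ⁅q, b⁆⁆) := by
    rw [← lie_skew, lie_lie]
  have Bqppq : ⁅b, ⁅q, ⁅p, ⁅p, q⁆⁆⁆⁆ = -(⁅q, ⁅⁅p, ⁅p, q⁆⁆, b⁆⁆ - ⁅⁅p, ⁅p, q⁆⁆, ⁅q, b⁆⁆) := by
    rw [← lie_skew, lie_lie]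
  have J : ⁅c, ⁅a, b⁆⁆ = ⁅b, ⁅a, c⁆⁆ - ⁅a, ⁅b, c⁆⁆ := by
    rw [← lie_skew c, lie_lie]; abel
  have r1 : ⁅b, ⁅a, ⁅a, b⁆⁆⁆ = ⁅a, ⁅b, ⁅a, b⁆⁆⁆ := by
    have h := lie_self ⁅a, b⁆
    rw [lie_lie] at h; exact (sub_eq_zero.1 h).symm
  have r2 : ⁅c, ⁅a, ⁅a, c⁆⁆⁆ = ⁅a, ⁅c, ⁅a, c⁆⁆⁆ := by
    have h := lie_self ⁅a, c⁆
    rw [lie_lie] at h; exact (sub_eq_zero.1 h).symm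
  have r3 : ⁅c, ⁅b, ⁅b, c⁆⁆⁆ = ⁅b, ⁅c, ⁅b, c⁆⁆⁆ := by
    have h := lie_self ⁅b, c⁆
    rw [lie_lie] at h; exact (sub_eq_zero.1 h).symm
  -- Both `rr` and `s` expand the antisymmetry of a bracket of two brackets into right-nested
  -- brackets.
  have rr : ∀ u v w z : K, ⁅u, ⁅v, ⁅w, z⁆⁆⁆ - ⁅v, ⁅u, ⁅w, z⁆⁆⁆ + ⁅w, ⁅z, ⁅u, v⁆⁆⁆
      - ⁅z, ⁅w, ⁅u, v⁆⁆⁆ = 0 := by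
    intro u v w z
    have h := lie_skew ⁅u,v⁆ ⁅w,z⁆
    rw [lie_lie, lie_lie] at h
    linear_combination (norm := module) (-1 : ℂ) • h
  have s : ∀ u v w y z : K, ⁅u, ⁅v, ⁅w, ⁅y, z⁆⁆⁆⁆ - ⁅v, ⁅u, ⁅w, ⁅y, z⁆⁆⁆⁆ +
    ⁅w, ⁅y, ⁅z, ⁅u,v⁆⁆⁆⁆ - ⁅w, ⁅z, ⁅y, ⁅u,v⁆⁆⁆⁆ - ⁅y, ⁅z, ⁅w, ⁅u,v⁆⁆⁆⁆
      + ⁅z, ⁅y, ⁅w, ⁅u,v⁆⁆⁆⁆ = 0 := by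
    intro u v w y z
    have h := lie_skew ⁅u,v⁆ ⁅w,⁅y,z⁆⁆
    rw [lie_lie, lie_lie, lie_lie, lie_lie, lie_sub] at h
    linear_combination (norm := module) (-1 : ℂ) • h
  -- The rules `f1`–`f3` and `g1`–`g6` provide one straightening relation in each multidegree of
  -- total degree four or five where all of `a, b, c` occur; with `J` and `r1`–`r3` they reduce the
  -- pentagon to linear algebra.
  have f1 : ⁅c, ⁅a, ⁅a, b⁆⁆⁆ = (2:ℂ) • ⁅a, ⁅b, ⁅a, c⁆⁆⁆ - ⁅b, ⁅a, ⁅a, c⁆⁆⁆ - ⁅a, ⁅a, ⁅b, c⁆⁆⁆ := by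
    have h := rr a b a c
    simp only [J, lie_sub] at h
    linear_combination (norm := module) (-1 : ℂ) • h
  have f2 : ⁅c, ⁅b, ⁅a, b⁆⁆⁆ = ⁅a, ⁅b, ⁅b, c⁆⁆⁆ - (2:ℂ) • ⁅b, ⁅a, ⁅b, c⁆⁆⁆ + ⁅b, ⁅b, ⁅a, c⁆⁆⁆ := by
    have h := rr a b b c
    simp only [J, lie_sub] at h
    linear_combination (norm := module) (-1 : ℂ) • h
  have f3 : ⁅c, ⁅b, ⁅a, c⁆⁆⁆ = ⁅a, ⁅c, ⁅b, c⁆⁆⁆ - ⁅c, ⁅a, ⁅b, c⁆⁆⁆ + ⁅b, ⁅c, ⁅a, c⁆⁆⁆ := by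
    have h := rr a c b c
    linear_combination (norm := module) (-1 : ℂ) • h
  have g1 : ⁅c, ⁅a, ⁅a, ⁅a, b⁆⁆⁆⁆ =
      (-3 : ℂ) • ⁅a, ⁅b, ⁅a, ⁅a, c⁆⁆⁆⁆ + (1 : ℂ) • ⁅b, ⁅a, ⁅a, ⁅a, c⁆⁆⁆⁆ +
        (3 : ℂ) • ⁅a, ⁅a, ⁅b, ⁅a, c⁆⁆⁆⁆ + (-1 : ℂ) • ⁅a, ⁅a, ⁅a, ⁅b, c⁆⁆⁆⁆ := by
    have h0 := s a b a a c
    simp only [ba, ca, cb, lie_neg, lie_self, lie_zero, lie_sub, lie_add, lie_smul, J, r1, r2, r3,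
      f1, f2, f3] at h0
    linear_combination (norm := module) (1 : ℂ) • h0
  have g2 : ⁅c, ⁅a, ⁅b, ⁅a, b⁆⁆⁆⁆ =
      (1 : ℂ) • ⁅a, ⁅a, ⁅b, ⁅b, c⁆⁆⁆⁆ + (-2 : ℂ) • ⁅a, ⁅b, ⁅a, ⁅b, c⁆⁆⁆⁆ +
        (2 : ℂ) • ⁅b, ⁅a, ⁅b, ⁅a, c⁆⁆⁆⁆ + (-1 : ℂ) • ⁅b, ⁅b, ⁅a, ⁅a, c⁆⁆⁆⁆ := by
    have h0 := s a b a b c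
    simp only [ba, ca, cb, lie_neg, lie_self, lie_zero, lie_sub, lie_add, lie_smul, J, r1, r2, r3,
      f1, f2, f3] at h0
    linear_combination (norm := module) (1 : ℂ) • h0
  have g3 : ⁅c, ⁅b, ⁅b, ⁅a, b⁆⁆⁆⁆ =
      (-1 : ℂ) • ⁅a, ⁅b, ⁅b, ⁅b, c⁆⁆⁆⁆ + (3 : ℂ) • ⁅b, ⁅a, ⁅b, ⁅b, c⁆⁆⁆⁆ +
        (-3 : ℂ) • ⁅b, ⁅b, ⁅a, ⁅b, c⁆⁆⁆⁆ + (1 : ℂ) • ⁅b, ⁅b, ⁅b, ⁅a, c⁆⁆⁆⁆ := by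
    have h0 := s a b b b c
    simp only [ba, ca, cb, lie_neg, lie_self, lie_zero, lie_sub, lie_add, lie_smul, J, r1, r2, r3,
      f1, f2, f3] at h0
    linear_combination (norm := module) (1 : ℂ) • h0
  have g4 : ⁅c, ⁅b, ⁅a, ⁅a, c⁆⁆⁆⁆ =
      (1 : ℂ) • ⁅b, ⁅a, ⁅c, ⁅a, c⁆⁆⁆⁆ + (1 : ℂ) • ⁅a, ⁅a, ⁅c, ⁅b, c⁆⁆⁆⁆ +
        (-2 : ℂ) • ⁅a, ⁅c, ⁅a, ⁅b, c⁆⁆⁆⁆ + (1 : ℂ) • ⁅c, ⁅a, ⁅a, ⁅b, c⁆⁆⁆⁆ := by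
    have h0 := s a b c a c
    simp only [ba, ca, cb, lie_neg, lie_self, lie_zero, lie_sub, lie_add, lie_smul, J, r1, r2, r3,
      f1, f2, f3] at h0
    linear_combination (norm := module) (1 : ℂ) • h0
  have g5 : ⁅c, ⁅b, ⁅b, ⁅a, c⁆⁆⁆⁆ =
      (-1 : ℂ) • ⁅a, ⁅b, ⁅c, ⁅b, c⁆⁆⁆⁆ + (2 : ℂ) • ⁅b, ⁅a, ⁅c, ⁅b, c⁆⁆⁆⁆ +
        (1 : ℂ) • ⁅c, ⁅a, ⁅b, ⁅b, c⁆⁆⁆⁆ + (-2 : ℂ) • ⁅b, ⁅c, ⁅a, ⁅b, c⁆⁆⁆⁆ +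
        (1 : ℂ) • ⁅b, ⁅b, ⁅c, ⁅a, c⁆⁆⁆⁆ := by
    have h0 := s a b c b c
    simp only [ba, ca, cb, lie_neg, lie_self, lie_zero, lie_sub, lie_add, lie_smul, J, r1, r2, r3,
      f1, f2, f3] at h0
    linear_combination (norm := module) (1 : ℂ) • h0
  have g6 : ⁅c, ⁅c, ⁅a, ⁅b, c⁆⁆⁆⁆ =
      (-1 : ℂ) • ⁅a, ⁅c, ⁅c, ⁅b, c⁆⁆⁆⁆ + (2 : ℂ) • ⁅c, ⁅a, ⁅c, ⁅b, c⁆⁆⁆⁆ +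
        (1 : ℂ) • ⁅b, ⁅c, ⁅c, ⁅a, c⁆⁆⁆⁆ + (-1 : ℂ) • ⁅c, ⁅b, ⁅c, ⁅a, c⁆⁆⁆⁆ := by
    have h0 := s a c c b c
    simp only [ba, ca, cb, lie_neg, lie_self, lie_zero, lie_sub, lie_add, lie_smul, J, r1, r2, r3,
      f1, f2, f3] at h0
    linear_combination (norm := module) (1 : ℂ) • h0
  simp only [subst_sigma5, lie_add, add_lie, lie_sub, sub_lie, lie_neg, neg_lie, lie_zero, lie_self,
    pa, pb, pc, qa, qb, qc, ba, ca, cb, bp, Lpa, Lpb, Lpc, Lqa, Lqb, Lqc, Bpq, Bppq, Bpppq, Bqpq,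
    Bqqpq, Bqppq, lie_lie, J, r1, r2, r3, f1, f2, f3, lie_smul, smul_add, g1, g2, g3, g4, g5, g6]
  module

end Subst

/-- On `[L, L]` an argument may be shifted by an element commuting with both arguments, so `t 0 2`
can be removed from the pentagon. What remains uses only the action of `t 0 1`, `t 1 2` on `t 0 3`,
`t 1 3`, `t 2 3`. -/
theorem isGrt_of_pentagon {ψ : FreeL} (h0 : ψ ∈ lcs 0) (h₁ : subst y x ψ = -subst x y ψ)
    (h₂ : subst x y ψ + subst y (-x - y) ψ + subst (-x - y) x ψ = 0)
    (h₃ : ⁅y, subst x y ψ⁆ + ⁅-x - y, subst x (-x - y) ψ⁆ = 0)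
    (h₄ : ∀ p q a b c : Braid4, ⁅p, a⁆ = ⁅a, b⁆ → ⁅p, b⁆ = -⁅a, b⁆ → ⁅p, c⁆ = 0 → ⁅q, a⁆ = 0 →
      ⁅q, b⁆ = ⁅b, c⁆ → ⁅q, c⁆ = -⁅b, c⁆ →
      subst p (q + b) ψ + subst (-a-b-c) c ψ =
        subst (-b-c) c ψ + subst (-a-b-c) (b + c) ψ + subst p q ψ) : IsGrt ψ := by
  refine ⟨h₁, h₂, h₃, ?_⟩
  have comm : ∀ {i j k l : Fin 4}, i ≠ j → i ≠ k → i ≠ l → j ≠ k → j ≠ l → k ≠ l →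
      ⁅t i j, t k l⁆ = 0 := t_comm
  have pa : ⁅t 0 1, t 0 3⁆ = ⁅t 0 3, t 1 3⁆ := by
    have h := t_triple (i := 0) (j := 3) (k := 1) (by decide) (by decide) (by decide)
    rw [← lie_skew, h, t_symm 3 1, neg_neg]
  have pb : ⁅t 0 1, t 1 3⁆ = -⁅t 0 3, t 1 3⁆ := by
    have h := t_triple (i := 1) (j := 3) (k := 0) (by decide) (by decide) (by decide)
    rw [← lie_skew, t_symm 0 1, h, t_symm 3 0, neg_neg, lie_skew]
  have qb : ⁅t 1 2, t 1 3⁆ = ⁅t 1 3, t 2 3⁆ := by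
    have h := t_triple (i := 1) (j := 3) (k := 2) (by decide) (by decide) (by decide)
    rw [← lie_skew, h, t_symm 3 2, neg_neg]
  have qc : ⁅t 1 2, t 2 3⁆ = -⁅t 1 3, t 2 3⁆ := by
    have h := t_triple (i := 2) (j := 3) (k := 1) (by decide) (by decide) (by decide)
    rw [← lie_skew, t_symm 1 2, h, t_symm 3 1, neg_neg, lie_skew]
  have ra : ⁅t 0 2, t 0 3⁆ = ⁅t 0 3, t 2 3⁆ := by
    have h := t_triple (i := 0) (j := 3) (k := 2) (by decide) (by decide) (by decide)
    rw [← lie_skew, h, t_symm 3 2, neg_neg]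
  have rc : ⁅t 0 2, t 2 3⁆ = -⁅t 0 3, t 2 3⁆ := by
    have h := t_triple (i := 2) (j := 3) (k := 0) (by decide) (by decide) (by decide)
    rw [← lie_skew, t_symm 0 2, h, t_symm 3 0, neg_neg, lie_skew]
  have pc : ⁅t 0 1, t 2 3⁆ = 0 := by apply comm <;> decide
  have qa : ⁅t 1 2, t 0 3⁆ = 0 := by apply comm <;> decide
  have rb : ⁅t 0 2, t 1 3⁆ = 0 := by apply comm <;> decide
  have key := h₄ (t 0 1) (t 1 2) (t 0 3) (t 1 3) (t 2 3) pa pb pc qa qb qc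
  have sk : ∀ u v : Braid4, ⁅v, u⁆ = -⁅u, v⁆ := fun u v => (lie_skew _ _).symm
  -- The commuting elements in `e₁`, `e₂`, `e₃` are the sum of all `t i j` minus `t 0 1`, the
  -- central element of the strands 1, 2, 3, and the sum of all `t i j` minus `t 1 2`.
  have e₁ : subst (t 0 2 + t 1 2) (t 2 3) ψ = subst (-t 0 3 - t 1 3 - t 2 3) (t 2 3) ψ := by
    rw [← subst_sub_central (a := t 0 2 + t 1 2)
      (c := t 0 2 + t 1 2 + t 0 3 + t 1 3 + t 2 3) ?_ ?_ h0]
    · congr 2; abel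
    · simp only [add_lie, lie_add, lie_self, sk (t 0 2) (t 1 2), sk (t 0 2) (t 0 3),
        sk (t 0 2) (t 1 3), sk (t 0 2) (t 2 3), sk (t 1 2) (t 0 3), sk (t 1 2) (t 1 3),
        sk (t 1 2) (t 2 3), pa, pb, pc, qa, qb, qc, ra, rb, rc]
      abel
    · simp only [add_lie, lie_add, lie_self, pa, pb, pc, qa, qb, qc, ra, rb, rc]
      abel
  have e₂ : subst (t 1 2) (t 2 3) ψ = subst (-t 1 3 - t 2 3) (t 2 3) ψ := by
    rw [← subst_sub_central (a := t 1 2) (c := t 1 2 + t 1 3 + t 2 3) ?_ ?_ h0]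
    · congr 2; abel
    · simp only [add_lie, lie_add, lie_self, sk (t 1 2) (t 1 3), sk (t 1 2) (t 2 3), qb, qc]
      abel
    · simp only [add_lie, lie_add, lie_self, qb, qc]
      abel
  have e₃ : subst (t 0 1 + t 0 2) (t 1 3 + t 2 3) ψ =
      subst (-t 0 3 - t 1 3 - t 2 3) (t 1 3 + t 2 3) ψ := by
    rw [← subst_sub_central (a := t 0 1 + t 0 2)
      (c := t 0 1 + t 0 2 + t 0 3 + t 1 3 + t 2 3) ?_ ?_ h0]
    · congr 2; abel
    · simp only [add_lie, lie_add, lie_self, sk (t 0 1) (t 0 2), sk (t 0 1) (t 0 3),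
        sk (t 0 1) (t 1 3), sk (t 0 1) (t 2 3), sk (t 0 2) (t 0 3), sk (t 0 2) (t 1 3),
        sk (t 0 2) (t 2 3), pa, pb, pc, qa, qb, qc, ra, rb, rc]
      abel
    · simp only [add_lie, lie_add, lie_self, sk (t 1 3) (t 2 3), pa, pb, pc, qa, qb, qc, ra, rb, rc]
      abel
  rw [e₁, e₂, e₃]
  exact key

theorem isGrt_sigma3 : IsGrt sigma3 := by
  have hyx : ⁅y, x⁆ = -⁅x, y⁆ := (lie_skew _ _).symm
  have r : ⁅y, ⁅x, ⁅x, y⁆⁆⁆ = ⁅x, ⁅y, ⁅x, y⁆⁆⁆ := by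
    have h := lie_self ⁅x, y⁆
    rw [lie_lie] at h; exact (sub_eq_zero.1 h).symm
  refine isGrt_of_pentagon sigma3_mem_lcs ?_ ?_ ?_ fun p q a b c => pentagon_sigma3
  all_goals
    simp only [subst_sigma3, lie_add, add_lie, lie_sub, sub_lie, lie_neg, neg_lie, lie_self,
      lie_zero, hyx, r]
    abel

set_option maxHeartbeats 1000000 in
theorem isGrt_sigma5 : IsGrt sigma5 := by
  have hyx : ⁅y, x⁆ = -⁅x, y⁆ := (lie_skew _ _).symm
  have r : ⁅y, ⁅x, ⁅x, y⁆⁆⁆ = ⁅x, ⁅y, ⁅x, y⁆⁆⁆ := by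
    have h := lie_self ⁅x, y⁆
    rw [lie_lie] at h; exact (sub_eq_zero.1 h).symm
  -- The hexagon involving `⁅y, ψ⁆` has degree six; the relations needed there come from the
  -- antisymmetry of brackets of `⁅x, ⁅x, y⁆⁆` and `⁅y, ⁅x, y⁆⁆`.
  have r₁ : ⁅y, ⁅x, ⁅x, ⁅x, ⁅x, y⁆⁆⁆⁆⁆ =
    (2:ℂ) • ⁅x, ⁅y, ⁅x, ⁅x, ⁅x, y⁆⁆⁆⁆⁆ - ⁅x, ⁅x, ⁅x, ⁅y, ⁅x, y⁆⁆⁆⁆⁆ := by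
    have h := lie_self ⁅x, ⁅x, y⁆⁆
    simp only [lie_lie, r, lie_sub] at h
    linear_combination (norm := module) h
  have r₂ : ⁅y, ⁅y, ⁅x, ⁅x, ⁅x, y⁆⁆⁆⁆⁆ = (3:ℂ) • ⁅y, ⁅x, ⁅x, ⁅y, ⁅x, y⁆⁆⁆⁆⁆
      - (3:ℂ) • ⁅x, ⁅y, ⁅x, ⁅y, ⁅x, y⁆⁆⁆⁆⁆ + ⁅x, ⁅x, ⁅y, ⁅y, ⁅x, y⁆⁆⁆⁆⁆ := by
    have h := lie_skew ⁅x, ⁅x, y⁆⁆ ⁅y, ⁅x, y⁆⁆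
    simp only [lie_lie, r, lie_sub] at h
    linear_combination (norm := module) h
  have r₃ : ⁅y, ⁅y, ⁅x, ⁅y, ⁅x, y⁆⁆⁆⁆⁆ =
    (2:ℂ) • ⁅y, ⁅x, ⁅y, ⁅y, ⁅x, y⁆⁆⁆⁆⁆ - ⁅x, ⁅y, ⁅y, ⁅y, ⁅x, y⁆⁆⁆⁆⁆ := by
    have h := lie_self ⁅y, ⁅x, y⁆⁆
    simp only [lie_lie, r, lie_sub] at h
    linear_combination (norm := module) (-1 : ℂ) • h
  refine isGrt_of_pentagon sigma5_mem_lcs ?_ ?_ ?_ fun p q a b c => pentagon_sigma5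
  all_goals
    simp only [subst_sigma5, lie_add, add_lie, lie_sub, sub_lie, lie_neg, neg_lie, lie_self,
      lie_zero, hyx, r,
      lie_smul, r₁, r₂, r₃]
    module

open MvPolynomial

attribute [local instance] LieRing.ofAssociativeRing

/-! ### Normally ordered elements of `[L, L]` -/

/-- Polynomials in two variables. -/
abbrev PB : Type := MvPolynomial (Fin 2) ℂ

/-- Polynomials in four variables `X₁, Y₁, X₂, Y₂`. -/
abbrev PA : Type := MvPolynomial (Fin 4) ℂ

local notation "X₁" => (MvPolynomial.X 0 : PA)
local notation "Y₁" => (MvPolynomial.X 1 : PA)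
local notation "X₂" => (MvPolynomial.X 2 : PA)
local notation "Y₂" => (MvPolynomial.X 3 : PA)

/-- Evaluation of a polynomial in two variables. -/
abbrev ev {R : Type*} [CommRing R] [Algebra ℂ R] (u v : R) : PB →ₐ[ℂ] R := aeval ![u, v]

/-- The linear map `X^i Y^j ↦ ad(x)^i ad(y)^j [x, y]`. -/
def nu : PB →ₗ[ℂ] FreeL :=
  (basisMonomials (Fin 2) ℂ).constr ℂ
    (fun s => ((LieAlgebra.ad ℂ FreeL x) ^ (s 0) * (LieAlgebra.ad ℂ FreeL y) ^ (s 1)) ⁅x, y⁆)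

theorem nu_monomial (s : Fin 2 →₀ ℕ) (c : ℂ) : nu (monomial s c) =
    c • ((LieAlgebra.ad ℂ FreeL x) ^ (s 0) * (LieAlgebra.ad ℂ FreeL y) ^ (s 1)) ⁅x, y⁆ := by
  have h : monomial s c = c • basisMonomials (Fin 2) ℂ s := by
    simp [smul_monomial]
  rw [h, map_smul, nu, Module.Basis.constr_basis]

theorem nu_one : nu 1 = ⁅x, y⁆ := by
  have h := nu_monomial 0 1
  simpa using h

theorem nu_X_zero_mul (p : PB) : nu (X 0 * p) = ⁅x, nu p⁆ := by
  induction p using MvPolynomial.induction_on' with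
  | monomial s c =>
    rw [X, monomial_mul, one_mul, nu_monomial, nu_monomial, lie_smul]
    congr 1
    simp only [Finsupp.add_apply, Finsupp.single_eq_same, Module.End.mul_apply]
    rw [add_comm, pow_succ', Module.End.mul_apply, Finsupp.single_apply, if_neg (by decide),
      zero_add]
    rfl
  | add p q hp hq => rw [mul_add, map_add, map_add, lie_add, hp, hq]

theorem nu_mem (p : PB) : nu p ∈ lcs 0 := by
  induction p using MvPolynomial.induction_on' with
  | monomial s c =>
    rw [nu_monomial]
    refine (lcs 0).smul_mem _ ?_
    have hstab : ∀ (n : ℕ) (u v : FreeL), v ∈ lcs 0 →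
        ((LieAlgebra.ad ℂ FreeL u) ^ n) v ∈ lcs 0 := by
      intro n u v hv
      induction n with
      | zero => simpa using hv
      | succ n ih => rw [pow_succ', Module.End.mul_apply]; exact lie_mem_zero u _
    rw [Module.End.mul_apply]
    exact hstab _ _ _ (hstab _ _ _ (lie_mem_zero _ _))
  | add p q hp hq => rw [map_add]; exact add_mem hp hq

/-- Moving `ad y` past `ad x` costs `ad ⁅x, y⁆`, which sends `lcs 0` into `lcs 1`. -/
theorem nu_X_one_mul (p : PB) : nu (X 1 * p) - ⁅y, nu p⁆ ∈ lcs 1 := by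
  induction p using MvPolynomial.induction_on' with
  | monomial s c =>
    rw [X, monomial_mul, one_mul, nu_monomial, nu_monomial, lie_smul, ← smul_sub]
    refine (lcs 1).smul_mem _ ?_
    simp only [Finsupp.add_apply, Finsupp.single_eq_same, Module.End.mul_apply]
    rw [add_comm 1, pow_succ', Module.End.mul_apply, Finsupp.single_apply, if_neg (by decide),
      zero_add]
    have key : ∀ (n : ℕ) (v : FreeL), v ∈ lcs 0 →
        ((LieAlgebra.ad ℂ FreeL x) ^ n) ⁅y, v⁆ - ⁅y, ((LieAlgebra.ad ℂ FreeL x) ^ n) v⁆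
          ∈ lcs 1 := by
      intro n v hv
      induction n with
      | zero => simp
      | succ n ih =>
        have hv' : ((LieAlgebra.ad ℂ FreeL x) ^ n) v ∈ lcs 0 := by
          cases n with
          | zero => simpa using hv
          | succ n => rw [pow_succ', Module.End.mul_apply]; exact lie_mem_zero x _
        rw [pow_succ', Module.End.mul_apply, Module.End.mul_apply, LieAlgebra.ad_apply,
          LieAlgebra.ad_apply]
        have e : ∀ w : FreeL, ⁅y, ⁅x, w⁆⁆ = ⁅x, ⁅y, w⁆⁆ - ⁅⁅x, y⁆, w⁆ := fun w => by
          rw [lie_lie]; abel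
        rw [e, ← sub_add, ← lie_sub]
        exact add_mem ((lcs 1).lie_mem ih) (lie_mem_lcs (lie_mem_zero _ _) hv')
    refine key _ _ ?_
    generalize s 1 = m
    cases m with
    | zero => simpa using lie_mem_zero _ _
    | succ n => rw [pow_succ', Module.End.mul_apply]; exact lie_mem_zero y _
  | add p q hp hq =>
    rw [mul_add, map_add, map_add, lie_add, add_sub_add_comm]
    exact add_mem hp hq

/-- `[L, L]` is spanned by normally ordered elements modulo `lcs 1`. -/
theorem exists_sub_nu_mem {f : FreeL} (hf : f ∈ lcs 0) : ∃ p, f - nu p ∈ lcs 1 := by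
  have hmem : ∀ g, g ∈ LinearMap.range nu ⊔ (lcs 1).toSubmodule ↔ ∃ p, g - nu p ∈ lcs 1 := by
    intro g
    rw [Submodule.mem_sup]
    constructor
    · rintro ⟨_, ⟨p, rfl⟩, m, hm, rfl⟩
      exact ⟨p, by rw [add_sub_cancel_left]; exact hm⟩
    · rintro ⟨p, hp⟩
      exact ⟨nu p, ⟨p, rfl⟩, g - nu p, hp, by abel⟩
  rw [← hmem]
  refine lcs_zero_induction _ ?_ ?_ ?_ hf
  · exact (hmem _).2 ⟨1, by rw [nu_one, sub_self]; exact zero_mem _⟩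
  · intro a _ ha
    obtain ⟨p, hp⟩ := (hmem _).1 ha
    refine (hmem _).2 ⟨X 0 * p, ?_⟩
    rw [nu_X_zero_mul, ← lie_sub]
    exact (lcs 1).lie_mem hp
  · intro a _ ha
    obtain ⟨p, hp⟩ := (hmem _).1 ha
    refine (hmem _).2 ⟨X 1 * p, ?_⟩
    have e : ⁅y, a⁆ - nu (X 1 * p) = ⁅y, a - nu p⁆ - (nu (X 1 * p) - ⁅y, nu p⁆) := by
      rw [lie_sub]; abel
    rw [e]
    exact sub_mem ((lcs 1).lie_mem hp) (nu_X_one_mul p)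

/-- A linear map on which `ad x` and `ad y` act by scalars `s` and `t` is an evaluation on normally
ordered elements. -/
theorem map_nu_of_scalar {R M : Type*} [CommRing R] [Algebra ℂ R] [AddCommGroup M] [Module ℂ M]
    [Module R M] [IsScalarTower ℂ R M] (φ : FreeL →ₗ[ℂ] M) (s t : R)
    (hx : ∀ u ∈ lcs 0, φ ⁅x, u⁆ = s • φ u) (hy : ∀ u ∈ lcs 0, φ ⁅y, u⁆ = t • φ u) (p : PB) :
    φ (nu p) = ev s t p • φ ⁅x, y⁆ := by
  induction p using MvPolynomial.induction_on' with
  | monomial d c =>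
    have hX : ∀ (n : ℕ) (v : FreeL), v ∈ lcs 0 → ((LieAlgebra.ad ℂ FreeL x) ^ n) v ∈ lcs 0 ∧
        φ (((LieAlgebra.ad ℂ FreeL x) ^ n) v) = s ^ n • φ v := by
      intro n v hv
      induction n with
      | zero => exact ⟨by simpa using hv, by simp⟩
      | succ n ih =>
        rw [pow_succ', Module.End.mul_apply, LieAlgebra.ad_apply]
        exact ⟨lie_mem_zero _ _, by rw [hx _ ih.1, ih.2, smul_smul, pow_succ']⟩
    have hY : ∀ (n : ℕ) (v : FreeL), v ∈ lcs 0 → ((LieAlgebra.ad ℂ FreeL y) ^ n) v ∈ lcs 0 ∧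
        φ (((LieAlgebra.ad ℂ FreeL y) ^ n) v) = t ^ n • φ v := by
      intro n v hv
      induction n with
      | zero => exact ⟨by simpa using hv, by simp⟩
      | succ n ih =>
        rw [pow_succ', Module.End.mul_apply, LieAlgebra.ad_apply]
        exact ⟨lie_mem_zero _ _, by rw [hy _ ih.1, ih.2, smul_smul, pow_succ']⟩
    rw [nu_monomial, map_smul, Module.End.mul_apply, (hX _ _ (hY _ _ (lie_mem_zero _ _)).1).2,
      (hY _ _ (lie_mem_zero _ _)).2, aeval_monomial, mul_smul, algebraMap_smul,
      Finsupp.prod_fintype _ _ (by simp)]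
    simp [mul_smul]
  | add p q hp hq => rw [map_add, map_add, map_add, hp, hq, add_smul]

/-! ### A triangular representation -/

/-- The representation of `L` by triangular matrices detecting `L_1`. -/
def rho : FreeL →ₗ⁅ℂ⁆ Matrix (Fin 3) (Fin 3) PA :=
  subst !![X₁ + X₂, 0, 0; 0, X₂, 0; 0, 0, 0] !![Y₁ + Y₂, 1, 0; 0, Y₂, 1; 0, 0, 0]

/-- Strictly upper triangular matrices. -/
def upper (a b c : PA) : Matrix (Fin 3) (Fin 3) PA := !![0, a, c; 0, 0, b; 0, 0, 0]

theorem rho_x : rho x = !![X₁ + X₂, 0, 0; 0, X₂, 0; 0, 0, 0] := subst_x _ _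

theorem rho_y : rho y = !![Y₁ + Y₂, 1, 0; 0, Y₂, 1; 0, 0, 0] := subst_y _ _

theorem rho_x_lie_upper (a b c : PA) :
    ⁅rho x, upper a b c⁆ = upper (X₁ * a) (X₂ * b) ((X₁ + X₂) * c) := by
  rw [rho_x, Ring.lie_def]
  ext1 i j
  fin_cases i <;> fin_cases j <;> simp [upper, Matrix.mul_apply, Fin.sum_univ_three]
  ring

theorem rho_y_lie_upper (a b c : PA) :
    ⁅rho y, upper a b c⁆ = upper (Y₁ * a) (Y₂ * b) ((Y₁ + Y₂) * c + b - a) := by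
  rw [rho_y, Ring.lie_def]
  ext1 i j
  fin_cases i <;> fin_cases j <;> simp [upper, Matrix.mul_apply, Fin.sum_univ_three]
  ring

theorem upper_lie_upper (a b c a' b' c' : PA) :
    ⁅upper a b c, upper a' b' c'⁆ = upper 0 0 (a * b' - a' * b) := by
  rw [Ring.lie_def]
  ext1 i j
  fin_cases i <;> fin_cases j <;> simp [upper, Matrix.mul_apply, Fin.sum_univ_three]

theorem rho_xy : rho ⁅x, y⁆ = upper X₁ X₂ 0 := by
  rw [LieHom.map_lie, rho_x, rho_y, Ring.lie_def]
  ext1 i j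
  fin_cases i <;> fin_cases j <;> simp [upper, Matrix.mul_apply, Fin.sum_univ_three] <;> ring

theorem upper_add (a b c a' b' c' : PA) :
    upper a b c + upper a' b' c' = upper (a + a') (b + b') (c + c') := by
  ext1 i j
  fin_cases i <;> fin_cases j <;> simp [upper]

theorem upper_smul (r : ℂ) (a b c : PA) : r • upper a b c = upper (r • a) (r • b) (r • c) := by
  ext1 i j
  fin_cases i <;> fin_cases j <;> simp [upper]

/-- The matrix coefficients of `rho` above the diagonal. -/
def r12 : FreeL →ₗ[ℂ] PA :=
  Matrix.entryLinearMap ℂ PA (0 : Fin 3) (1 : Fin 3) ∘ₗ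
    (rho : FreeL →ₗ[ℂ] Matrix (Fin 3) (Fin 3) PA)
def r23 : FreeL →ₗ[ℂ] PA :=
  Matrix.entryLinearMap ℂ PA (1 : Fin 3) (2 : Fin 3) ∘ₗ
    (rho : FreeL →ₗ[ℂ] Matrix (Fin 3) (Fin 3) PA)
def r13 : FreeL →ₗ[ℂ] PA :=
  Matrix.entryLinearMap ℂ PA (0 : Fin 3) (2 : Fin 3) ∘ₗ
    (rho : FreeL →ₗ[ℂ] Matrix (Fin 3) (Fin 3) PA)

theorem r_of_eq_upper {f : FreeL} {a b c : PA} (h : rho f = upper a b c) :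
    r12 f = a ∧ r23 f = b ∧ r13 f = c := by
  refine ⟨?_, ?_, ?_⟩
  · change rho f 0 1 = a; rw [h]; rfl
  · change rho f 1 2 = b; rw [h]; rfl
  · change rho f 0 2 = c; rw [h]; rfl

theorem rho_eq_upper {f : FreeL} (hf : f ∈ lcs 0) : rho f = upper (r12 f) (r23 f) (r13 f) := by
  have key : ∃ a b c, rho f = upper a b c := by
    let P : Submodule ℂ FreeL :=
      { carrier := {f | ∃ a b c, rho f = upper a b c}
        zero_mem' := ⟨0, 0, 0, by
          rw [map_zero]; ext1 i j; fin_cases i <;> fin_cases j <;> simp [upper]⟩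
        add_mem' := by
          rintro f g ⟨a, b, c, h⟩ ⟨a', b', c', h'⟩
          exact ⟨_, _, _, by rw [map_add, h, h', upper_add]⟩
        smul_mem' := by
          rintro r f ⟨a, b, c, h⟩
          exact ⟨_, _, _, by rw [map_smul, h, upper_smul]⟩ }
    refine lcs_zero_induction P ⟨_, _, _, rho_xy⟩ ?_ ?_ hf
    · rintro u _ ⟨a, b, c, h⟩
      exact ⟨_, _, _, by rw [LieHom.map_lie, h, rho_x_lie_upper]⟩
    · rintro u _ ⟨a, b, c, h⟩
      exact ⟨_, _, _, by rw [LieHom.map_lie, h, rho_y_lie_upper]⟩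
  obtain ⟨a, b, c, h⟩ := key
  obtain ⟨h₁, h₂, h₃⟩ := r_of_eq_upper h
  rw [h₁, h₂, h₃, h]

theorem r_xy : r12 ⁅x, y⁆ = X₁ ∧ r23 ⁅x, y⁆ = X₂ ∧ r13 ⁅x, y⁆ = 0 := r_of_eq_upper rho_xy

theorem r_x_lie {u : FreeL} (hu : u ∈ lcs 0) :
    r12 ⁅x, u⁆ = X₁ * r12 u ∧ r23 ⁅x, u⁆ = X₂ * r23 u ∧ r13 ⁅x, u⁆ = (X₁ + X₂) * r13 u := by
  apply r_of_eq_upper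
  rw [LieHom.map_lie, rho_eq_upper hu, rho_x_lie_upper]

theorem r_y_lie {u : FreeL} (hu : u ∈ lcs 0) :
    r12 ⁅y, u⁆ = Y₁ * r12 u ∧ r23 ⁅y, u⁆ = Y₂ * r23 u ∧
      r13 ⁅y, u⁆ = (Y₁ + Y₂) * r13 u + r23 u - r12 u := by
  apply r_of_eq_upper
  rw [LieHom.map_lie, rho_eq_upper hu, rho_y_lie_upper]

theorem r_lie {u v : FreeL} (hu : u ∈ lcs 0) (hv : v ∈ lcs 0) :
    r12 ⁅u, v⁆ = 0 ∧ r23 ⁅u, v⁆ = 0 ∧ r13 ⁅u, v⁆ = r12 u * r23 v - r12 v * r23 u := by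
  apply r_of_eq_upper
  rw [LieHom.map_lie, rho_eq_upper hu, rho_eq_upper hv, upper_lie_upper]

theorem r_of_mem_one {m : FreeL} (hm : m ∈ lcs 1) : r12 m = 0 ∧ r23 m = 0 := by
  have h : m ∈ LinearMap.ker r12 ⊓ LinearMap.ker r23 :=
    lcs_succ_induction (LinearMap.ker r12 ⊓ LinearMap.ker r23)
      (fun u hu v hv => ⟨(r_lie hu hv).1, (r_lie hu hv).2.1⟩) hm
  exact h

theorem r13_of_mem_two {m : FreeL} (hm : m ∈ lcs 2) : r13 m = 0 := by
  refine lcs_succ_induction (LinearMap.ker r13) (fun u hu v hv => ?_) hm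
  change r13 ⁅u, v⁆ = 0
  rw [(r_lie hu (lcs_le_zero 1 hv)).2.2, (r_of_mem_one hv).1, (r_of_mem_one hv).2]
  ring

/-- The representation of `L` by two by two triangular matrices detecting `L_0`, with weight
`(X₁ + X₂, Y₁ + Y₂)`. -/
def rhoSum : FreeL →ₗ⁅ℂ⁆ Matrix (Fin 2) (Fin 2) PA :=
  subst !![X₁ + X₂, 0; 0, 0] !![Y₁ + Y₂, 1; 0, 0]

def rSum : FreeL →ₗ[ℂ] PA :=
  Matrix.entryLinearMap ℂ PA (0 : Fin 2) (1 : Fin 2) ∘ₗ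
    (rhoSum : FreeL →ₗ[ℂ] Matrix (Fin 2) (Fin 2) PA)

theorem rhoSum_eq {f : FreeL} (hf : f ∈ lcs 0) : rhoSum f = !![0, rSum f; 0, 0] := by
  have key : ∃ a, rhoSum f = !![0, a; 0, 0] := by
    let P : Submodule ℂ FreeL :=
      { carrier := {f | ∃ a, rhoSum f = !![0, a; 0, 0]}
        zero_mem' := ⟨0, by
          rw [map_zero]; ext1 i j; fin_cases i <;> fin_cases j <;> simp⟩
        add_mem' := by
          rintro f g ⟨a, h⟩ ⟨a', h'⟩
          refine ⟨a + a', ?_⟩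
          rw [map_add, h, h']
          ext1 i j; fin_cases i <;> fin_cases j <;> simp
        smul_mem' := by
          rintro r f ⟨a, h⟩
          refine ⟨r • a, ?_⟩
          rw [map_smul, h]
          ext1 i j; fin_cases i <;> fin_cases j <;> simp }
    refine lcs_zero_induction P ⟨X₁ + X₂, ?_⟩ ?_ ?_ hf
    · rw [LieHom.map_lie, rhoSum, subst_x, subst_y, Ring.lie_def]
      ext1 i j
      fin_cases i <;> fin_cases j <;> simp [Matrix.mul_apply]
      ring
    · rintro u _ ⟨a, h⟩
      refine ⟨(X₁ + X₂) * a, ?_⟩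
      rw [LieHom.map_lie, h, rhoSum, subst_x, Ring.lie_def]
      ext1 i j; fin_cases i <;> fin_cases j <;> simp [Matrix.mul_apply]
    · rintro u _ ⟨a, h⟩
      refine ⟨(Y₁ + Y₂) * a, ?_⟩
      rw [LieHom.map_lie, h, rhoSum, subst_y, Ring.lie_def]
      ext1 i j; fin_cases i <;> fin_cases j <;> simp [Matrix.mul_apply]
  obtain ⟨a, h⟩ := key
  have e : rSum f = a := by change rhoSum f 0 1 = a; rw [h]; rfl
  rw [e, h]

theorem rSum_xy : rSum ⁅x, y⁆ = X₁ + X₂ := by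
  change rhoSum ⁅x, y⁆ 0 1 = _
  rw [LieHom.map_lie, rhoSum, subst_x, subst_y, Ring.lie_def]
  simp [Matrix.mul_apply]

theorem rSum_x_lie {u : FreeL} (hu : u ∈ lcs 0) : rSum ⁅x, u⁆ = (X₁ + X₂) * rSum u := by
  change rhoSum ⁅x, u⁆ 0 1 = _
  rw [LieHom.map_lie, rhoSum_eq hu, rhoSum, subst_x, Ring.lie_def]
  simp [Matrix.mul_apply]

theorem rSum_y_lie {u : FreeL} (hu : u ∈ lcs 0) : rSum ⁅y, u⁆ = (Y₁ + Y₂) * rSum u := by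
  change rhoSum ⁅y, u⁆ 0 1 = _
  rw [LieHom.map_lie, rhoSum_eq hu, rhoSum, subst_y, Ring.lie_def]
  simp [Matrix.mul_apply]

theorem rSum_lie {u v : FreeL} (hu : u ∈ lcs 0) (hv : v ∈ lcs 0) : rSum ⁅u, v⁆ = 0 := by
  change rhoSum ⁅u, v⁆ 0 1 = _
  rw [LieHom.map_lie, rhoSum_eq hu, rhoSum_eq hv, Ring.lie_def]
  simp [Matrix.mul_apply]

theorem rSum_of_mem_one {m : FreeL} (hm : m ∈ lcs 1) : rSum m = 0 :=
  lcs_succ_induction (LinearMap.ker rSum) (fun _ hu _ hv => rSum_lie hu hv) hm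

/-! ### Matrix coefficients of derivations and of the bracket `⟨ , ⟩` -/

/-- Both sides obey the same rules under `ad x` and `ad y`, so the identity propagates from `g = ⁅x,
y⁆`, where `D f g = ⁅x, ⁅y, f⁆⁆`. The factor `rSum g` enters because `ad x` and `ad y` act on the
corner entry with weights `X₁ + X₂` and `Y₁ + Y₂`. -/
theorem r_D {f g : FreeL} (hf : f ∈ lcs 0) (hg : g ∈ lcs 0) :
    r12 (D f g) = Y₁ * r12 f * r12 g ∧ r23 (D f g) = Y₂ * r23 f * r23 g ∧
      r13 (D f g) = (Y₁ * r12 f + Y₂ * r23 f) * r13 g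
        + ((Y₁ + Y₂) * r13 f + r23 f - r12 f) * rSum g := by
  let P : Submodule ℂ FreeL :=
    { carrier := {g | g ∈ lcs 0 ∧ r12 (D f g) = Y₁ * r12 f * r12 g ∧
        r23 (D f g) = Y₂ * r23 f * r23 g ∧
        r13 (D f g) = (Y₁ * r12 f + Y₂ * r23 f) * r13 g
          + ((Y₁ + Y₂) * r13 f + r23 f - r12 f) * rSum g}
      zero_mem' := by refine ⟨zero_mem _, ?_, ?_, ?_⟩ <;> simp
      add_mem' := by
        rintro u v ⟨h0, h₁, h₂, h₃⟩ ⟨k0, k₁, k₂, k₃⟩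
        refine ⟨add_mem h0 k0, ?_, ?_, ?_⟩ <;> simp only [map_add, h₁, h₂, h₃, k₁, k₂, k₃] <;> ring
      smul_mem' := by
        rintro c u ⟨h0, h₁, h₂, h₃⟩
        refine ⟨(lcs 0).smul_mem _ h0, ?_, ?_, ?_⟩ <;>
          simp only [map_smul, h₁, h₂, h₃, smul_add, mul_smul_comm] }
  refine (lcs_zero_induction P ?_ ?_ ?_ hg).2
  · refine ⟨lie_mem_zero _ _, ?_⟩
    rw [D_xy]
    obtain ⟨a₁, a₂, a₃⟩ := r_x_lie (lie_mem_zero y f)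
    obtain ⟨b₁, b₂, b₃⟩ := r_y_lie hf
    rw [a₁, a₂, a₃, b₁, b₂, b₃, r_xy.1, r_xy.2.1, r_xy.2.2, rSum_xy]
    refine ⟨?_, ?_, ?_⟩ <;> ring
  · rintro u hu ⟨_, h₁, h₂, h₃⟩
    refine ⟨lie_mem_zero _ _, ?_⟩
    rw [LieDerivation.apply_lie_eq_sub, D_x, lie_zero, sub_zero]
    obtain ⟨a₁, a₂, a₃⟩ := r_x_lie (D_mem hf u)
    obtain ⟨b₁, b₂, b₃⟩ := r_x_lie hu
    have b₄ := rSum_x_lie hu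
    rw [a₁, a₂, a₃, b₁, b₂, b₃, b₄, h₁, h₂, h₃]
    refine ⟨?_, ?_, ?_⟩ <;> ring
  · rintro u hu ⟨_, h₁, h₂, h₃⟩
    refine ⟨lie_mem_zero _ _, ?_⟩
    rw [LieDerivation.apply_lie_eq_sub, D_y, map_sub, map_sub, map_sub]
    obtain ⟨a₁, a₂, a₃⟩ := r_y_lie (D_mem hf u)
    obtain ⟨b₁, b₂, b₃⟩ := r_y_lie hu
    obtain ⟨c₁, c₂, c₃⟩ := r_lie hu (lie_mem_zero y f)
    obtain ⟨d₁, d₂, _⟩ := r_y_lie hf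
    rw [a₁, a₂, a₃, b₁, b₂, b₃, c₁, c₂, c₃, d₁, d₂, rSum_y_lie hu, h₁, h₂, h₃]
    refine ⟨?_, ?_, ?_⟩ <;> ring

/-- The element by which the class of `f` acts on `L_1`. -/
def wt : FreeL →ₗ[ℂ] PA :=
  LinearMap.mulLeft ℂ Y₁ ∘ₗ r12 + LinearMap.mulLeft ℂ Y₂ ∘ₗ r23 -
    LinearMap.mulLeft ℂ (Y₁ + Y₂) ∘ₗ rSum

theorem wt_apply (f : FreeL) : wt f = Y₁ * r12 f + Y₂ * r23 f - (Y₁ + Y₂) * rSum f := rfl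

theorem r13_ihara {f g : FreeL} (hf : f ∈ lcs 0) (hg : g ∈ lcs 0) :
    r13 (ihara f g) = wt f * r13 g - wt g * r13 f + (r12 f * r23 g - r12 g * r23 f)
      + rSum g * (r23 f - r12 f) - rSum f * (r23 g - r12 g) := by
  rw [ihara_apply, map_sub, map_add, (r_lie hf hg).2.2, (r_D hf hg).2.2, (r_D hg hf).2.2, wt_apply,
    wt_apply]
  ring

/-- All coefficients of `m` other than the corner vanish, so only the term `wt f * r13 m` survives:
the action becomes a multiplication. -/
theorem r13_ihara_of_mem_one {f m : FreeL} (hf : f ∈ lcs 0) (hm : m ∈ lcs 1) :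
    r13 (ihara f m) = wt f * r13 m := by
  rw [r13_ihara hf (lcs_le_zero 1 hm), (r_of_mem_one hm).1, (r_of_mem_one hm).2,
    rSum_of_mem_one hm, wt_apply m, (r_of_mem_one hm).1, (r_of_mem_one hm).2, rSum_of_mem_one hm]
  ring

/-! ### Matrix coefficients of normally ordered elements -/

theorem r12_nu (p : PB) : r12 (nu p) = ev X₁ Y₁ p * X₁ := by
  rw [map_nu_of_scalar r12 X₁ Y₁ (fun u hu => (r_x_lie hu).1) (fun u hu => (r_y_lie hu).1), r_xy.1,
    smul_eq_mul]

theorem r23_nu (p : PB) : r23 (nu p) = ev X₂ Y₂ p * X₂ := by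
  rw [map_nu_of_scalar r23 X₂ Y₂ (fun u hu => (r_x_lie hu).2.1) (fun u hu => (r_y_lie hu).2.1),
    r_xy.2.1, smul_eq_mul]

theorem rSum_nu (p : PB) : rSum (nu p) = ev (X₁ + X₂) (Y₁ + Y₂) p * (X₁ + X₂) := by
  rw [map_nu_of_scalar rSum (X₁ + X₂) (Y₁ + Y₂) (fun u hu => rSum_x_lie hu)
    (fun u hu => rSum_y_lie hu), rSum_xy, smul_eq_mul]

/-- For `p = Y^n` the corner satisfies `c_{n+1} = (Y₁ + Y₂) c_n + X₂ Y₂^n - X₁ Y₁^n`, whose solution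
is a combination of divided differences; the factor `Y₁ Y₂` clears their denominators. Powers of `ad
x` only multiply by `X₁ + X₂`. -/
theorem r13_nu (p : PB) : Y₁ * Y₂ * r13 (nu p) =
    X₂ * Y₂ * (ev (X₁ + X₂) (Y₁ + Y₂) p - ev (X₁ + X₂) Y₂ p)
      - X₁ * Y₁ * (ev (X₁ + X₂) (Y₁ + Y₂) p - ev (X₁ + X₂) Y₁ p) := by
  induction p using MvPolynomial.induction_on' with
  | monomial d c =>
    have hY : ∀ n : ℕ, ((LieAlgebra.ad ℂ FreeL y) ^ n) ⁅x, y⁆ ∈ lcs 0 ∧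
        r12 (((LieAlgebra.ad ℂ FreeL y) ^ n) ⁅x, y⁆) = Y₁ ^ n * X₁ ∧
        r23 (((LieAlgebra.ad ℂ FreeL y) ^ n) ⁅x, y⁆) = Y₂ ^ n * X₂ ∧
        Y₁ * Y₂ * r13 (((LieAlgebra.ad ℂ FreeL y) ^ n) ⁅x, y⁆) =
          X₂ * Y₂ * ((Y₁ + Y₂) ^ n - Y₂ ^ n) - X₁ * Y₁ * ((Y₁ + Y₂) ^ n - Y₁ ^ n) := by
      intro n
      induction n with
      | zero => exact ⟨by simpa using lie_mem_zero x y, by simp [r_xy.1], by simp [r_xy.2.1],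
          by simp [r_xy.2.2]⟩
      | succ n ih =>
        obtain ⟨h0, h₁, h₂, h₃⟩ := ih
        rw [pow_succ', Module.End.mul_apply, LieAlgebra.ad_apply]
        obtain ⟨a₁, a₂, a₃⟩ := r_y_lie h0
        refine ⟨lie_mem_zero _ _, by rw [a₁, h₁]; ring, by rw [a₂, h₂]; ring, ?_⟩
        rw [a₃, h₁, h₂]
        linear_combination (Y₁ + Y₂) * h₃
    have hX : ∀ (n : ℕ) (v : FreeL), v ∈ lcs 0 →
        r13 (((LieAlgebra.ad ℂ FreeL x) ^ n) v) = (X₁ + X₂) ^ n * r13 v ∧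
        ((LieAlgebra.ad ℂ FreeL x) ^ n) v ∈ lcs 0 := by
      intro n v hv
      induction n with
      | zero => exact ⟨by simp, by simpa using hv⟩
      | succ n ih =>
        rw [pow_succ', Module.End.mul_apply, LieAlgebra.ad_apply]
        exact ⟨by rw [(r_x_lie ih.2).2.2, ih.1]; ring, lie_mem_zero _ _⟩
    rw [nu_monomial, map_smul, Module.End.mul_apply, (hX _ _ (hY _).1).1]
    simp only [aeval_monomial, Finsupp.prod_fintype _ _ (fun _ => pow_zero _), Fin.prod_univ_two,
      Matrix.cons_val_zero, Matrix.cons_val_one]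
    rw [Algebra.smul_def]
    linear_combination (algebraMap ℂ PA c) * (X₁ + X₂) ^ (d 0) * (hY (d 1)).2.2.2
  | add p q hp hq =>
    simp only [map_add]
    linear_combination hp + hq

/-! ### The polynomial model of `L_1` -/

/-- The map `L_1 → ℂ[X₁, Y₁, X₂, Y₂]` induced by `r13`. -/
def cbar : GrL 1 →ₗ[ℂ] PA :=
  Submodule.liftQ _ (r13 ∘ₗ (lcs 1).toSubmodule.subtype) (fun _ hm => r13_of_mem_two hm)

theorem cbar_cls (m : ↥(lcs 1).toSubmodule) : cbar (cls 1 m) = r13 m.1 := rfl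

/-- The map `L_0 → ℂ[X₁, Y₁, X₂, Y₂]` through which `L_0` acts on `L_1`. -/
def wtbar : GrL 0 →ₗ[ℂ] PA :=
  Submodule.liftQ _ (wt ∘ₗ (lcs 0).toSubmodule.subtype) (fun m hm => by
    have hm' : m.1 ∈ lcs 1 := hm
    change wt m.1 = 0
    rw [wt_apply, (r_of_mem_one hm').1, (r_of_mem_one hm').2, rSum_of_mem_one hm']; ring)

theorem wtbar_cls (f : ↥(lcs 0).toSubmodule) : wtbar (cls 0 f) = wt f.1 := rfl

theorem cbar_act (σ : GrL 0) (m : GrL 1) : cbar (act σ m) = wtbar σ * cbar m := by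
  obtain ⟨f, rfl⟩ := Submodule.mkQ_surjective _ σ
  obtain ⟨m, rfl⟩ := Submodule.mkQ_surjective _ m
  exact r13_ihara_of_mem_one f.2 m.2

theorem wt_nu (p : PB) : wt (nu p) = X₁ * Y₁ * ev X₁ Y₁ p + X₂ * Y₂ * ev X₂ Y₂ p
    - (X₁ + X₂) * (Y₁ + Y₂) * ev (X₁ + X₂) (Y₁ + Y₂) p := by
  rw [wt_apply, r12_nu, r23_nu, rSum_nu]; ring

/-- The class of `[ν p, ν q]` in `L_1`. -/
def nuLie : PB →ₗ[ℂ] PB →ₗ[ℂ] GrL 1 :=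
  LinearMap.mk₂ ℂ (fun p q => cls 1 ⟨⁅nu p, nu q⁆, lie_mem_lcs (nu_mem p) (nu_mem q)⟩)
    (fun p p' q => by rw [← map_add]; congr 1; apply Subtype.ext; simp)
    (fun c p q => by rw [← map_smul]; congr 1; apply Subtype.ext; simp)
    (fun p q q' => by rw [← map_add]; congr 1; apply Subtype.ext; simp)
    (fun c p q => by rw [← map_smul]; congr 1; apply Subtype.ext; simp)

theorem nuLie_apply (p q : PB) :
    nuLie p q = cls 1 ⟨⁅nu p, nu q⁆, lie_mem_lcs (nu_mem p) (nu_mem q)⟩ := rfl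

theorem nuLie_swap (p q : PB) : nuLie q p = -nuLie p q := by
  rw [nuLie_apply, nuLie_apply, ← map_neg]
  congr 1
  apply Subtype.ext
  exact (lie_skew _ _).symm

theorem cbar_nuLie (p q : PB) : cbar (nuLie p q) =
    X₁ * X₂ * (ev X₁ Y₁ p * ev X₂ Y₂ q - ev X₁ Y₁ q * ev X₂ Y₂ p) := by
  rw [nuLie_apply, cbar_cls, (r_lie (nu_mem p) (nu_mem q)).2.2, r12_nu, r12_nu, r23_nu, r23_nu]
  ring

/-- The map sending `p(X₁, Y₁) q(X₂, Y₂)` to the class of `[ν p, ν q]`. -/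
def Lam : PA →ₗ[ℂ] GrL 1 :=
  (basisMonomials (Fin 4) ℂ).constr ℂ
    (fun s => nuLie (X 0 ^ s 0 * X 1 ^ s 1) (X 0 ^ s 2 * X 1 ^ s 3))

theorem monomial_PA (s : Fin 4 →₀ ℕ) (c : ℂ) :
    (monomial s c : PA) = c • (X₁ ^ s 0 * Y₁ ^ s 1 * X₂ ^ s 2 * Y₂ ^ s 3) := by
  rw [monomial_eq, Finsupp.prod_fintype _ _ (fun _ => pow_zero _), Fin.prod_univ_four,
    smul_eq_C_mul]

theorem monomial_PB (s : Fin 2 →₀ ℕ) (c : ℂ) :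
    (monomial s c : PB) = c • (X 0 ^ s 0 * X 1 ^ s 1) := by
  rw [monomial_eq, Finsupp.prod_fintype _ _ (fun _ => pow_zero _), Fin.prod_univ_two,
    smul_eq_C_mul]

theorem Lam_X_pow (i j k l : ℕ) : Lam (X₁ ^ i * Y₁ ^ j * X₂ ^ k * Y₂ ^ l) =
    nuLie (X 0 ^ i * X 1 ^ j) (X 0 ^ k * X 1 ^ l) := by
  let s : Fin 4 →₀ ℕ := Finsupp.equivFunOnFinite.symm ![i, j, k, l]
  have h : X₁ ^ i * Y₁ ^ j * X₂ ^ k * Y₂ ^ l = basisMonomials (Fin 4) ℂ s := by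
    rw [coe_basisMonomials]
    change _ = (monomial s 1 : PA)
    rw [monomial_PA, one_smul]
    simp [s]
  rw [h, Lam, Module.Basis.constr_basis]
  simp [s]

theorem Lam_mul (p q : PB) : Lam (ev X₁ Y₁ p * ev X₂ Y₂ q) = nuLie p q := by
  induction p using MvPolynomial.induction_on' with
  | monomial s c =>
    induction q using MvPolynomial.induction_on' with
    | monomial t d =>
      rw [monomial_PB, monomial_PB]
      simp only [map_smul, map_mul, map_pow, aeval_X, Matrix.cons_val_zero, Matrix.cons_val_one,
        LinearMap.smul_apply, smul_mul_assoc, mul_smul_comm]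
      rw [← mul_assoc, Lam_X_pow]
    | add q q' hq hq' => rw [map_add, mul_add, map_add, hq, hq', map_add]
  | add p p' hp hp' => rw [map_add, add_mul, map_add, hp, hp', map_add, LinearMap.add_apply]

/-- The exchange of `(X₁, Y₁)` and `(X₂, Y₂)`. -/
def swapA : PA →ₐ[ℂ] PA := aeval ![X₂, Y₂, X₁, Y₁]

theorem swapA_ev (u v : PA) (p : PB) : swapA (ev u v p) = ev (swapA u) (swapA v) p := by
  have h : swapA.comp (ev u v) = ev (swapA u) (swapA v) := by
    apply MvPolynomial.algHom_ext
    intro i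
    fin_cases i <;> simp
  exact congrArg (fun F : PB →ₐ[ℂ] PA => F p) h

@[simp] theorem swapA_X₁ : swapA X₁ = X₂ := by simp [swapA]
@[simp] theorem swapA_Y₁ : swapA Y₁ = Y₂ := by simp [swapA]
@[simp] theorem swapA_X₂ : swapA X₂ = X₁ := by simp [swapA]
@[simp] theorem swapA_Y₂ : swapA Y₂ = Y₁ := by simp [swapA]

theorem Lam_swapA (a : PA) : Lam (swapA a) = -Lam a := by
  induction a using MvPolynomial.induction_on' with
  | monomial s c =>
    rw [monomial_PA, map_smul, map_smul, map_smul, ← smul_neg]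
    congr 1
    simp only [map_mul, map_pow, swapA_X₁, swapA_Y₁, swapA_X₂, swapA_Y₂]
    rw [Lam_X_pow, ← nuLie_swap, ← Lam_X_pow]
    congr 1
    ring
  | add p q hp hq => rw [map_add, map_add, map_add, hp, hq, neg_add]

theorem cbar_Lam (a : PA) : cbar (Lam a) = X₁ * X₂ * (a - swapA a) := by
  have key : ∀ i j k l : ℕ, cbar (Lam (X₁ ^ i * Y₁ ^ j * X₂ ^ k * Y₂ ^ l)) =
      X₁ * X₂ * (X₁ ^ i * Y₁ ^ j * X₂ ^ k * Y₂ ^ l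
        - swapA (X₁ ^ i * Y₁ ^ j * X₂ ^ k * Y₂ ^ l)) := by
    intro i j k l
    rw [Lam_X_pow, cbar_nuLie]
    simp only [map_mul, map_pow, swapA_X₁, swapA_Y₁, swapA_X₂, swapA_Y₂, aeval_X,
      Matrix.cons_val_zero, Matrix.cons_val_one]
    ring
  induction a using MvPolynomial.induction_on' with
  | monomial s c =>
    rw [monomial_PA, Lam.map_smul, cbar.map_smul, key, map_smul swapA, ← smul_sub, mul_smul_comm]
  | add p q hp hq => rw [map_add, map_add, hp, hq, map_add]; ring

/-- A bracket in `⁅lcs 0, lcs 0⁆` changes only by `lcs 2` when its arguments are replaced by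
normally ordered elements modulo `lcs 1`. -/
theorem Lam_surjective : Function.Surjective Lam := by
  intro m
  obtain ⟨⟨m, hm⟩, rfl⟩ := Submodule.mkQ_surjective _ m
  have key : m ∈ ((LinearMap.range Lam).comap (cls 1)).map (lcs 1).toSubmodule.subtype := by
    refine lcs_succ_induction _ (fun u hu v hv => ?_) hm
    obtain ⟨p, hp⟩ := exists_sub_nu_mem hu
    obtain ⟨q, hq⟩ := exists_sub_nu_mem hv
    refine ⟨⟨⁅u, v⁆, lie_mem_lcs hu hv⟩, ⟨ev X₁ Y₁ p * ev X₂ Y₂ q, ?_⟩, rfl⟩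
    rw [Lam_mul, nuLie_apply, ← sub_eq_zero, ← map_sub]
    change Submodule.Quotient.mk _ = 0
    rw [Submodule.Quotient.mk_eq_zero]
    change ⁅nu p, nu q⁆ - ⁅u, v⁆ ∈ lcs 2
    have e : ⁅nu p, nu q⁆ - ⁅u, v⁆ = -(⁅nu p, v - nu q⁆ + ⁅u - nu p, v⁆) := by
      rw [lie_sub, sub_lie]; abel
    rw [e]
    exact neg_mem (add_mem (lie_mem_lcs (nu_mem p) hq) (lie_mem_lcs hp hv))
  obtain ⟨m', h, rfl⟩ := key
  exact h

/-- If `X₁ X₂ (a - swapA a) = 0` then `a` is symmetric, while `Lam` is antisymmetric under `swapA`;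
hence `2 Lam a = 0`. Both the kernel and the surjectivity of `Lam` are thus controlled without a
basis of `L_1`. -/
theorem cbar_injective : Function.Injective cbar := by
  rw [injective_iff_map_eq_zero]
  intro m hm
  obtain ⟨a, rfl⟩ := Lam_surjective m
  rw [cbar_Lam] at hm
  have h : a - swapA a = 0 :=
    (mul_eq_zero.1 hm).resolve_left (mul_ne_zero (X_ne_zero _) (X_ne_zero _))
  have h2 : Lam a = -Lam a := by
    rw [← Lam_swapA, ← sub_eq_zero.1 h]
  have h3 : (2 : ℂ) • Lam a = 0 := by
    rw [two_smul]
    nth_rewrite 2 [h2]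
    exact add_neg_cancel _
  exact (smul_eq_zero.1 h3).resolve_left two_ne_zero

theorem swapA_wtbar (σ : GrL 0) : swapA (wtbar σ) = wtbar σ := by
  obtain ⟨⟨f, hf⟩, rfl⟩ := Submodule.mkQ_surjective _ σ
  obtain ⟨p, hp⟩ := exists_sub_nu_mem hf
  have e : cls 0 ⟨f, hf⟩ = cls 0 ⟨nu p, nu_mem p⟩ := by
    rw [← sub_eq_zero, ← map_sub]
    exact (Submodule.Quotient.mk_eq_zero _).2 hp
  change swapA (wtbar (cls 0 _)) = wtbar (cls 0 _)
  rw [e, wtbar_cls, wt_nu]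
  simp only [map_add, map_sub, map_mul, swapA_ev, swapA_X₁, swapA_Y₁, swapA_X₂, swapA_Y₂]
  rw [add_comm X₂, add_comm Y₂]
  ring

theorem act_Lam (σ : GrL 0) (a : PA) : act σ (Lam a) = Lam (wtbar σ * a) := by
  apply cbar_injective
  rw [cbar_act, cbar_Lam, cbar_Lam, map_mul, swapA_wtbar]
  ring

/-- An element of `L_1` is recovered from its polynomial. -/
theorem Lam_of_cbar_eq {m : GrL 1} {u : PA} (h : cbar m = X₁ * X₂ * u) :
    m = Lam ((1 / 2 : ℂ) • u) := by
  obtain ⟨a, rfl⟩ := Lam_surjective m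
  have e : u = a - swapA a := by
    rw [cbar_Lam] at h
    exact (mul_left_cancel₀ (mul_ne_zero (X_ne_zero _) (X_ne_zero _)) h).symm
  have e2 : Lam (a - swapA a) = (2 : ℂ) • Lam a := by
    rw [map_sub, Lam_swapA, sub_neg_eq_add, two_smul]
  rw [e, Lam.map_smul, e2, smul_smul]
  norm_num

/-! ### Planes and the ideal of `P_3`, `P_5` -/

/-- Substitution of polynomials for `X₁, Y₁, X₂, Y₂`. -/
def pl (a b c d : PA) : PA →ₐ[ℂ] PA := aeval ![a, b, c, d]

section pl
variable (a b c d : PA)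
@[simp] theorem pl_X₁ : pl a b c d X₁ = a := by simp [pl]
@[simp] theorem pl_Y₁ : pl a b c d Y₁ = b := by simp [pl]
@[simp] theorem pl_X₂ : pl a b c d X₂ = c := by simp [pl]
@[simp] theorem pl_Y₂ : pl a b c d Y₂ = d := by simp [pl]
end pl

theorem algHom_PA_ext {R : Type*} [CommRing R] [Algebra ℂ R] {f g : PA →ₐ[ℂ] R}
    (h1 : f X₁ = g X₁) (h2 : f Y₁ = g Y₁) (h3 : f X₂ = g X₂) (h4 : f Y₂ = g Y₂) : f = g := by
  apply MvPolynomial.algHom_ext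
  intro i
  fin_cases i
  exacts [h1, h2, h3, h4]

/-- If `σ` is a section of `φ` modulo `I` then the kernel of `φ` is contained in `I`. -/
theorem mem_of_section {I : Ideal PA} {φ : PA →ₐ[ℂ] PA} (σ : PA →ₐ[ℂ] PA)
    (h1 : X₁ - σ (φ X₁) ∈ I) (h2 : Y₁ - σ (φ Y₁) ∈ I) (h3 : X₂ - σ (φ X₂) ∈ I)
    (h4 : Y₂ - σ (φ Y₂) ∈ I) {c : PA} (hc : φ c = 0) : c ∈ I := by
  have h : Ideal.Quotient.mkₐ ℂ I = (Ideal.Quotient.mkₐ ℂ I).comp (σ.comp φ) := by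
    apply algHom_PA_ext
    all_goals
      refine Ideal.Quotient.eq.2 ?_
      assumption
  have h' : Ideal.Quotient.mkₐ ℂ I c = Ideal.Quotient.mkₐ ℂ I (σ (φ c)) :=
    congrArg (fun F : PA →ₐ[ℂ] PA ⧸ I => F c) h
  rw [hc, map_zero, map_zero] at h'
  exact Ideal.Quotient.eq_zero_iff_mem.1 h'

/-- If `c = g u + m v` vanishes under `φ`, which kills `m` but not `g`, then `u` is killed. -/
theorem map_eq_zero_of_map_add {φ : PA →ₐ[ℂ] PA} {c g m u v : PA} (e : u * g + v * m = c)
    (hc : φ c = 0) (hm : φ m = 0) (hg : φ g ≠ 0) : φ u = 0 := by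
  rw [← e, map_add, map_mul, map_mul, hm, mul_zero, add_zero] at hc
  exact (mul_eq_zero.1 hc).resolve_right hg

theorem mem_span_pair_mul {c g m l u v : PA} (e : u * g + v * m = c)
    (hu : u ∈ Ideal.span {l, m}) : c ∈ Ideal.span {g * l, m} := by
  obtain ⟨p, q, h⟩ := Ideal.mem_span_pair.1 hu
  exact Ideal.mem_span_pair.2 ⟨p, q * g + v, by rw [← e, ← h]; ring⟩

/-- Adds one plane to a union inside the hypersurface `m = 0`: writing `c = u g + v m`, the value of
`u` on the new plane `l = m = 0` must vanish because `g` does not vanish there. -/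
theorem mem_span_pair_step {φ : PA →ₐ[ℂ] PA} {c g m l : PA} (h : c ∈ Ideal.span {g, m})
    (hk : ∀ u, φ u = 0 → u ∈ Ideal.span {l, m}) (hc : φ c = 0) (hm : φ m = 0) (hg : φ g ≠ 0) :
    c ∈ Ideal.span {g * l, m} := by
  obtain ⟨u, v, e⟩ := Ideal.mem_span_pair.1 h
  exact mem_span_pair_mul e (hk u (map_eq_zero_of_map_add e hc hm hg))

/-- The forms `L_k = ∑_{i + j = k} w_{ij}`, where `w` is the matrix of size three with
vanishing row and column sums and upper left corner `X₁, X₂; Y₁, Y₂`. -/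
def fL : Fin 3 → PA :=
  ![X₁ - Y₁ - X₂ - 2 * Y₂, X₁ + 2 * Y₁ + 2 * X₂ + Y₂, -2 * X₁ - Y₁ - X₂ + Y₂]

/-- The forms `M_k = ∑_{i - j = k} w_{ij}`. -/
def fM : Fin 3 → PA :=
  ![2 * X₁ + Y₁ + X₂ + 2 * Y₂, -X₁ + Y₁ - 2 * X₂ - Y₂, -X₁ - 2 * Y₁ + X₂ - Y₂]

/-- Three sequences of sum zero, each vanishing at one index. -/
def lin : Fin 3 → Fin 3 → ℂ := ![![0, 1, -1], ![1, 0, -1], ![1, -1, 0]]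

theorem lin_self (k : Fin 3) : lin k k = 0 := by fin_cases k <;> simp [lin]

theorem lin_ne_zero {k j : Fin 3} (h : j ≠ k) : lin k j ≠ 0 := by
  fin_cases k <;> fin_cases j <;> simp_all [lin]

theorem lin_sub (k j : Fin 3) : lin k (2 * k - j) = -lin k j := by
  fin_cases k <;> fin_cases j <;> simp [lin]

theorem lin_sum (k : Fin 3) : lin k 0 + lin k 1 + lin k 2 = 0 := by
  fin_cases k <;> simp [lin]

theorem C_lin_sum (k : Fin 3) :
    (C (lin k 0) + C (lin k 1) + C (lin k 2) : PA) = 0 := by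
  rw [← C_add, ← C_add, lin_sum, C_0]

/-- The nine planes `L_k = M_l = 0`. -/
def nine (k l : Fin 3) : PA →ₐ[ℂ] PA :=
  pl (C (lin k 0) * X₁ + C (lin l 0) * X₂) (C (lin k 1) * X₁ + C (lin l 1) * X₂)
    (C (lin k 1) * X₁ + C (lin l 2) * X₂) (C (lin k 2) * X₁ + C (lin l 0) * X₂)

theorem nine_fL (k l j : Fin 3) : nine k l (fL j) = C (lin k j) * (3 * X₁) := by
  have h1 := C_lin_sum k
  have h2 := C_lin_sum l
  fin_cases j <;>
    simp only [fL, nine, map_add, map_sub, map_mul, map_neg, map_ofNat, pl_X₁, pl_Y₁, pl_X₂,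
      pl_Y₂, Fin.zero_eta, Fin.mk_one, Fin.reduceFinMk, Matrix.cons_val]
  · linear_combination (-2 * X₁) * h1 - X₂ * h2
  · linear_combination X₁ * h1 + 2 * X₂ * h2
  · linear_combination (-2 * X₁) * h1 - X₂ * h2

theorem nine_fM (k l j : Fin 3) : nine k l (fM j) = C (lin l j) * (3 * X₂) := by
  have h1 := C_lin_sum k
  have h2 := C_lin_sum l
  fin_cases j <;>
    simp only [fM, nine, map_add, map_sub, map_mul, map_neg, map_ofNat, pl_X₁, pl_Y₁, pl_X₂,
      pl_Y₂, Fin.zero_eta, Fin.mk_one, Fin.reduceFinMk, Matrix.cons_val]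
  · linear_combination (2 * X₁) * h1 + X₂ * h2
  · linear_combination (-X₁) * h1 - 2 * X₂ * h2
  · linear_combination (-X₁) * h1 - 2 * X₂ * h2

theorem three_ne_zero_PA : (3 : PA) ≠ 0 := by
  rw [← map_ofNat (C : ℂ →+* PA) 3]
  exact (C_ne_zero).2 three_ne_zero

/-- A linear form of sum zero on three indices is a combination of its value at `k` and of the
form `lin k`. -/
theorem exists_of_sum_eq_zero (g : Fin 3 → PA) (hg : g 0 + g 1 + g 2 = 0) (k : Fin 3) :
    ∃ e : PA, ∃ c : Fin 3 → PA, ∀ j, g j = 3 * (C (lin k j) * e + c j * g k) := by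
  have h3 : (3 : PA) * C (1 / 3) = 1 := by
    rw [← map_ofNat (C : ℂ →+* PA) 3, ← C_mul]; norm_num
  suffices h : ∃ e : PA, ∃ c : Fin 3 → PA, ∀ j, g j = C (lin k j) * e + c j * g k by
    obtain ⟨e, c, h⟩ := h
    refine ⟨C (1 / 3) * e, fun j => C (1 / 3) * c j, fun j => ?_⟩
    linear_combination h j - (C (lin k j) * e + c j * g k) * h3
  have hc : g 2 = -g 0 - g 1 := by linear_combination hg
  fin_cases k
  · refine ⟨g 1, ![1, 0, -1], fun j => ?_⟩
    fin_cases j <;> simp [lin, hc]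
    ring
  · refine ⟨g 0, ![0, 1, -1], fun j => ?_⟩
    fin_cases j <;> simp [lin, hc]
    ring
  · refine ⟨g 0, ![0, -1, 1], fun j => ?_⟩
    fin_cases j <;> simp [lin, hc]

theorem X_eq_fL_fM : 3 * X₁ = fL 0 + fM 0 ∧ 3 * Y₁ = fL 1 + fM 1 ∧ 3 * X₂ = fL 1 + fM 2 ∧
    3 * Y₂ = fL 2 + fM 0 := by
  simp only [fL, fM, Matrix.cons_val]
  refine ⟨?_, ?_, ?_, ?_⟩ <;> ring

/-- The forms `L_j` modulo `L_k` are proportional to one form `e`, and the `M_j` modulo `M_l` to one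
form `f`. Sending `X₁, X₂` to `e, f` is therefore a section of the restriction modulo `(L_k, M_l)`.
-/
theorem mem_of_nine {k l : Fin 3} {c : PA} (hc : nine k l c = 0) :
    c ∈ Ideal.span {fL k, fM l} := by
  obtain ⟨e, p, he⟩ := exists_of_sum_eq_zero fL (by simp [fL]; ring) k
  obtain ⟨f, q, hf⟩ := exists_of_sum_eq_zero fM (by simp [fM]; ring) l
  obtain ⟨h1, h2, h3, h4⟩ := X_eq_fL_fM
  have key : ∀ (u : PA) (a b : Fin 3), 3 * u = fL a + fM b →
      nine k l u = C (lin k a) * X₁ + C (lin l b) * X₂ →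
      u - pl e 0 f 0 (nine k l u) ∈ Ideal.span {fL k, fM l} := by
    intro u a b hu hv
    refine Ideal.mem_span_pair.2 ⟨p a, q b, ?_⟩
    rw [hv]
    simp only [map_add, map_mul, pl_X₁, pl_X₂, algHom_C, algebraMap_eq]
    apply mul_left_cancel₀ three_ne_zero_PA
    linear_combination -hu - he a - hf b
  refine mem_of_section (pl e 0 f 0) (key _ 0 0 h1 ?_) (key _ 1 1 h2 ?_) (key _ 1 2 h3 ?_)
    (key _ 2 0 h4 ?_) hc <;> simp [nine]

/-- The products of the `L_k` and of the `M_k`. -/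
def prodL : PA := fL 0 * fL 1 * fL 2
def prodM : PA := fM 0 * fM 1 * fM 2

theorem nine_fL_ne_zero {k l j : Fin 3} (h : j ≠ k) : nine k l (fL j) ≠ 0 := by
  rw [nine_fL]
  exact mul_ne_zero (by simpa using lin_ne_zero h)
    (mul_ne_zero three_ne_zero_PA (X_ne_zero _))

theorem nine_fM_ne_zero {k l j : Fin 3} (h : j ≠ l) : nine k l (fM j) ≠ 0 := by
  rw [nine_fM]
  exact mul_ne_zero (by simpa using lin_ne_zero h)
    (mul_ne_zero three_ne_zero_PA (X_ne_zero _))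

theorem nine_fL_self (k l : Fin 3) : nine k l (fL k) = 0 := by
  rw [nine_fL, lin_self, C_0, zero_mul]

theorem nine_fM_self (k l : Fin 3) : nine k l (fM l) = 0 := by
  rw [nine_fM, lin_self, C_0, zero_mul]

theorem nine_prodL (k l : Fin 3) : nine k l prodL = 0 := by
  have h := nine_fL_self k l
  rw [prodL, map_mul, map_mul]
  fin_cases k <;> simp_all

theorem mem_span_prodL_fM {l : Fin 3} {c : PA} (hc : ∀ k, nine k l c = 0) :
    c ∈ Ideal.span {prodL, fM l} := by
  have h0 := mem_of_nine (hc 0)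
  have h1 := mem_span_pair_step h0 (fun u hu => mem_of_nine hu) (hc 1) (nine_fM_self _ _)
    (nine_fL_ne_zero (by decide))
  refine mem_span_pair_step h1 (fun u hu => mem_of_nine hu) (hc 2) (nine_fM_self _ _) ?_
  rw [map_mul]
  exact mul_ne_zero (nine_fL_ne_zero (by decide)) (nine_fL_ne_zero (by decide))

/-- The factors `M_l` are added one by one. In `c = u g + v prodL`, with `g` the product of the
factors already present, `u` vanishes on the three planes of the next index `l`, and
`mem_span_prodL_fM` applies to `u`. -/
theorem mem_span_prodL_prodM {c : PA} (hc : ∀ k l, nine k l c = 0) :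
    c ∈ Ideal.span {prodL, prodM} := by
  have step : ∀ (g : PA) (l : Fin 3), c ∈ Ideal.span {g, prodL} → (∀ k, nine k l g ≠ 0) →
      c ∈ Ideal.span {g * fM l, prodL} := by
    intro g l h hg
    obtain ⟨u, v, e⟩ := Ideal.mem_span_pair.1 h
    refine mem_span_pair_mul e ?_
    rw [Set.pair_comm]
    exact mem_span_prodL_fM fun k =>
      map_eq_zero_of_map_add e (hc k l) (nine_prodL k l) (hg k)
  have h0 := mem_span_prodL_fM (fun k => hc k 0)
  rw [Set.pair_comm] at h0 ⊢
  refine step _ 2 (step _ 1 h0 fun k => nine_fM_ne_zero (by decide)) fun k => ?_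
  rw [map_mul]
  exact mul_ne_zero (nine_fM_ne_zero (by decide)) (nine_fM_ne_zero (by decide))

/-! The planes where a row or a column of the matrix `w` vanishes. -/

def rowX : PA →ₐ[ℂ] PA := pl 0 X₁ 0 X₂
def rowY : PA →ₐ[ℂ] PA := pl X₁ 0 X₂ 0
def rowZ : PA →ₐ[ℂ] PA := pl X₁ (-X₁) X₂ (-X₂)
def colOne : PA →ₐ[ℂ] PA := pl 0 0 X₁ X₂
def colTwo : PA →ₐ[ℂ] PA := pl X₁ X₂ 0 0
def colThree : PA →ₐ[ℂ] PA := pl X₁ X₂ (-X₁) (-X₂)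

/-- The determinant `X₁Y₂ - X₂Y₁`. -/
def fQ : PA := X₁ * Y₂ - X₂ * Y₁

/-- The product of the diagonal entries of `w`. -/
def diag : PA := X₁ * Y₂ * (X₁ + X₂ + Y₁ + Y₂)

/-- On `X₁ = 0` the determinant becomes `-X₂ Y₁`, so `X₁ = fQ = 0` splits into a row plane and a
column plane. -/
theorem mem_span_X₁_fQ {c : PA} (h1 : rowX c = 0) (h2 : colOne c = 0) :
    c ∈ Ideal.span {X₁, fQ} := by
  have k1 : ∀ u, rowX u = 0 → u ∈ Ideal.span {X₂, X₁} := fun u hu => by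
    refine mem_of_section (pl Y₁ 0 Y₂ 0) ?_ ?_ ?_ ?_ hu <;> simp [rowX, Ideal.mem_span_pair]
    exacts [⟨0, 1, by ring⟩, ⟨1, 0, by ring⟩]
  have k2 : ∀ u, colOne u = 0 → u ∈ Ideal.span {Y₁, X₁} := fun u hu => by
    refine mem_of_section (pl X₂ 0 Y₂ 0) ?_ ?_ ?_ ?_ hu <;> simp [colOne, Ideal.mem_span_pair]
    exacts [⟨0, 1, by ring⟩, ⟨1, 0, by ring⟩]
  have h := mem_span_pair_step (k1 c h1) k2 h2 (by simp [colOne]) (by simp [colOne])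
  obtain ⟨u, v, e⟩ := Ideal.mem_span_pair.1 h
  exact Ideal.mem_span_pair.2 ⟨v + u * Y₂, -u, by rw [← e, fQ]; ring⟩

theorem mem_span_Y₂_fQ {c : PA} (h1 : rowY c = 0) (h2 : colTwo c = 0) :
    c ∈ Ideal.span {Y₂, fQ} := by
  have k1 : ∀ u, rowY u = 0 → u ∈ Ideal.span {Y₁, Y₂} := fun u hu => by
    refine mem_of_section (pl X₁ 0 X₂ 0) ?_ ?_ ?_ ?_ hu <;> simp [rowY, Ideal.mem_span_pair]
    exacts [⟨1, 0, by ring⟩, ⟨0, 1, by ring⟩]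
  have k2 : ∀ u, colTwo u = 0 → u ∈ Ideal.span {X₂, Y₂} := fun u hu => by
    refine mem_of_section (pl X₁ 0 Y₁ 0) ?_ ?_ ?_ ?_ hu <;> simp [colTwo, Ideal.mem_span_pair]
    exacts [⟨1, 0, by ring⟩, ⟨0, 1, by ring⟩]
  have h := mem_span_pair_step (k1 c h1) k2 h2 (by simp [colTwo]) (by simp [colTwo])
  obtain ⟨u, v, e⟩ := Ideal.mem_span_pair.1 h
  exact Ideal.mem_span_pair.2 ⟨v + u * X₁, -u, by rw [← e, fQ]; ring⟩

theorem mem_span_sum_fQ {c : PA} (h1 : rowZ c = 0) (h2 : colThree c = 0) :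
    c ∈ Ideal.span {X₁ + X₂ + Y₁ + Y₂, fQ} := by
  have k1 : ∀ u, rowZ u = 0 → u ∈ Ideal.span {X₁ + Y₁, X₁ + X₂ + Y₁ + Y₂} := fun u hu => by
    refine mem_of_section (pl X₁ 0 X₂ 0) ?_ ?_ ?_ ?_ hu <;> simp [rowZ, Ideal.mem_span_pair]
    exacts [⟨1, 0, by ring⟩, ⟨-1, 1, by ring⟩]
  have k2 : ∀ u, colThree u = 0 → u ∈ Ideal.span {X₁ + X₂, X₁ + X₂ + Y₁ + Y₂} := fun u hu => by
    refine mem_of_section (pl X₁ 0 Y₁ 0) ?_ ?_ ?_ ?_ hu <;>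
      simp [colThree, Ideal.mem_span_pair]
    exacts [⟨1, 0, by ring⟩, ⟨-1, 1, by ring⟩]
  have h := mem_span_pair_step (k1 c h1) k2 h2 (by simp [colThree]) (by
    have e : colThree (X₁ + Y₁) = X₁ + X₂ := by simp [colThree]
    rw [e]
    intro h0
    have := congrArg (MvPolynomial.eval (fun _ => (1 : ℂ))) h0
    norm_num at this)
  obtain ⟨u, v, e⟩ := Ideal.mem_span_pair.1 h
  exact Ideal.mem_span_pair.2 ⟨v + u * X₁, -u, by rw [← e, fQ]; ring⟩

/-- The six planes where a row or a column vanishes. -/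
def isLine : Fin 6 → (PA →ₐ[ℂ] PA) := ![rowX, rowY, rowZ, colOne, colTwo, colThree]

theorem mem_span_diag_fQ {c : PA} (hc : ∀ i, isLine i c = 0) : c ∈ Ideal.span {diag, fQ} := by
  have step : ∀ (g l : PA) (φ ψ : PA →ₐ[ℂ] PA), c ∈ Ideal.span {g, fQ} →
      (∀ u, φ u = 0 → ψ u = 0 → u ∈ Ideal.span {l, fQ}) → φ c = 0 → ψ c = 0 →
      φ fQ = 0 → ψ fQ = 0 → φ g ≠ 0 → ψ g ≠ 0 → c ∈ Ideal.span {g * l, fQ} := by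
    intro g l φ ψ h hk h1 h2 h3 h4 h5 h6
    obtain ⟨u, v, e⟩ := Ideal.mem_span_pair.1 h
    exact mem_span_pair_mul e (hk u (map_eq_zero_of_map_add e h1 h3 h5)
      (map_eq_zero_of_map_add e h2 h4 h6))
  have h0 := mem_span_X₁_fQ (hc 0) (hc 3)
  have h1 := step _ _ rowY colTwo h0 (fun u => mem_span_Y₂_fQ) (hc 1) (hc 4)
    (by simp [rowY, fQ]) (by simp [colTwo, fQ]) (by simp [rowY]) (by simp [colTwo])
  exact step _ _ rowZ colThree h1 (fun u => mem_span_sum_fQ) (hc 2) (hc 5)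
    (by simp [rowZ, fQ]; ring) (by simp [colThree, fQ]) (by simp [rowZ])
    (by simp [colThree])

/-! ### The polynomials `P_n` -/

/-- `(u + v)^n - u^n - v^n`. -/
def fF (n : ℕ) (u v : PA) : PA := (u + v) ^ n - u ^ n - v ^ n

/-- The weight of the `n`-th generator. -/
def fP (n : ℕ) : PA := fF n X₁ Y₁ + fF n X₂ Y₂ - fF n (X₁ + X₂) (Y₁ + Y₂)

theorem map_fF {φ : PA →ₐ[ℂ] PA} (n : ℕ) (u v : PA) : φ (fF n u v) = fF n (φ u) (φ v) := by
  simp [fF]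

theorem map_fP (φ : PA →ₐ[ℂ] PA) (n : ℕ) : φ (fP n) = fF n (φ X₁) (φ Y₁) + fF n (φ X₂) (φ Y₂)
    - fF n (φ X₁ + φ X₂) (φ Y₁ + φ Y₂) := by
  simp only [fP, map_add, map_sub, map_fF]

theorem fP_three : 3 * fP 3 = -(prodL + prodM) := by
  simp only [fP, fF, prodL, prodM, fL, fM, Matrix.cons_val]
  ring

theorem fP_three_eq : fP 3 = -9 * diag + (6 * X₁ + 3 * Y₁ + 3 * X₂ + 6 * Y₂) * fQ := by
  simp only [fP, fF, diag, fQ]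
  ring

/-- Modulo `P_3` the quintic factors as a multiple of `prodL * fQ`. This splits the locus `P_3 = P_5
= 0` into the nine planes `prodL = prodM = 0` and the six planes `diag = fQ = 0`. -/
theorem fP_five : 9 * fP 5 = -15 * prodL * fQ
    + (25 * (X₁ ^ 2 + X₁ * Y₁ + X₁ * X₂ + Y₁ ^ 2 + Y₁ * Y₂ + X₂ ^ 2 + X₂ * Y₂ + Y₂ ^ 2)
      - 10 * X₁ * Y₂ + 35 * Y₁ * X₂) * fP 3 := by
  simp only [fP, fF, prodL, fL, fQ, Matrix.cons_val]
  ring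

theorem isLine_prodL_ne_zero (i : Fin 6) : isLine i prodL ≠ 0 := by
  intro h0
  have h := congrArg (MvPolynomial.eval ![(2 : ℂ), 0, 1, 0]) h0
  fin_cases i <;> simp [isLine, prodL, fL, rowX, rowY, rowZ, colOne, colTwo, colThree,
    map_ofNat] at h <;> norm_num at h

/-- The ideal of `P_3` and `P_5`. -/
def fJ : Ideal PA := Ideal.span {fP 3, fP 5}

theorem fP_three_mem : fP 3 ∈ fJ := Ideal.subset_span (by simp)
theorem fP_five_mem : fP 5 ∈ fJ := Ideal.subset_span (by simp)

theorem mem_of_ofNat_mul_mem {I : Ideal PA} {u : PA} (c : ℂ) (hc : c ≠ 0) (h : C c * u ∈ I) :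
    u ∈ I := by
  have e : u = C c⁻¹ * (C c * u) := by
    rw [← mul_assoc, ← C_mul, inv_mul_cancel₀ hc, C_1, one_mul]
  rw [e]
  exact I.mul_mem_left _ h

/-- `fP_five` puts `fQ * prodL` in `fJ`; multiplying `fP_three_eq` by `prodL` then puts `diag *
prodL` there. -/
theorem mul_prodL_mem {u : PA} (hu : u ∈ Ideal.span {diag, fQ}) : u * prodL ∈ fJ := by
  have h1 : fQ * prodL ∈ fJ := by
    refine mem_of_ofNat_mul_mem 15 (by norm_num) ?_
    have e : C 15 * (fQ * prodL) =
        (25 * (X₁ ^ 2 + X₁ * Y₁ + X₁ * X₂ + Y₁ ^ 2 + Y₁ * Y₂ + X₂ ^ 2 + X₂ * Y₂ + Y₂ ^ 2)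
          - 10 * X₁ * Y₂ + 35 * Y₁ * X₂) * fP 3 - 9 * fP 5 := by
      rw [fP_five, map_ofNat]; ring
    rw [e]
    exact sub_mem (fJ.mul_mem_left _ fP_three_mem) (fJ.mul_mem_left _ fP_five_mem)
  have h2 : diag * prodL ∈ fJ := by
    refine mem_of_ofNat_mul_mem 9 (by norm_num) ?_
    have e : C 9 * (diag * prodL) =
        (6 * X₁ + 3 * Y₁ + 3 * X₂ + 6 * Y₂) * (fQ * prodL) - prodL * fP 3 := by
      rw [fP_three_eq, map_ofNat]; ring
    rw [e]
    exact sub_mem (fJ.mul_mem_left _ h1) (fJ.mul_mem_left _ fP_three_mem)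
  obtain ⟨p, q, rfl⟩ := Ideal.mem_span_pair.1 hu
  rw [add_mul, mul_assoc, mul_assoc]
  exact add_mem (fJ.mul_mem_left _ h2) (fJ.mul_mem_left _ h1)

theorem isLine_fP_three (i : Fin 6) : isLine i (fP 3) = 0 := by
  fin_cases i <;> simp [isLine, rowX, rowY, rowZ, colOne, colTwo, colThree, map_fP, fF] <;> ring

/-- A polynomial vanishing on the fifteen planes lies in the ideal of `P_3` and `P_5`. -/
theorem mem_fJ {c : PA} (h9 : ∀ k l, nine k l c = 0) (h6 : ∀ i, isLine i c = 0) : c ∈ fJ := by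
  obtain ⟨u, v, e⟩ := Ideal.mem_span_pair.1 (mem_span_prodL_prodM h9)
  have e' : c = (u - v) * prodL - v * (3 * fP 3) := by rw [fP_three, ← e]; ring
  rw [e']
  refine sub_mem (mul_prodL_mem (mem_span_diag_fQ fun i => ?_))
    (fJ.mul_mem_left _ (fJ.mul_mem_left _ fP_three_mem))
  have h := h6 i
  rw [e', map_sub, map_mul, map_mul, map_mul, isLine_fP_three, mul_zero, mul_zero,
    sub_zero] at h
  exact (mul_eq_zero.1 h).resolve_right (isLine_prodL_ne_zero i)

/-- When a row or column of `w` vanishes, the two remaining ones are opposite, and odd power sums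
cancel. -/
theorem isLine_fP {n : ℕ} (hn : Odd n) (i : Fin 6) : isLine i (fP n) = 0 := by
  have h0 : n ≠ 0 := hn.pos.ne'
  fin_cases i <;> simp [isLine, rowX, rowY, rowZ, colOne, colTwo, colThree, map_fP, fF,
    hn.neg_pow, h0]
  all_goals
    have e : -X₁ + -X₂ = -(X₁ + X₂) := by ring
    rw [e, hn.neg_pow]
    simp [h0]

/-- The entries of `w` satisfy `3 w_{ij} = L_{i+j} + M_{i-j}` with indices modulo 3, and for odd `n`
the signs in `P_n` are absorbed by the negative entries in the last row and column. -/
theorem fP_eq_sum {n : ℕ} (hn : Odd n) :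
    C (3 ^ n) * fP n = -∑ a : Fin 3, ∑ b : Fin 3, (fL a + fM b) ^ n := by
  have e : (C (3 ^ n) : PA) = 3 ^ n := by rw [C_pow, map_ofNat]
  have h (a b : Fin 3) (u : PA) (h : fL a + fM b = 3 * u) :
      (fL a + fM b) ^ n = 3 ^ n * u ^ n := by rw [h, mul_pow]
  have h' (a b : Fin 3) (u : PA) (h : fL a + fM b = -(3 * u)) :
      (fL a + fM b) ^ n = -(3 ^ n * u ^ n) := by rw [h, hn.neg_pow, mul_pow]
  simp only [Fin.sum_univ_three, e, fP, fF]
  rw [h 0 0 X₁ (by simp [fL, fM]; ring), h 1 1 Y₁ (by simp [fL, fM]; ring),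
    h 1 2 X₂ (by simp [fL, fM]; ring), h 2 0 Y₂ (by simp [fL, fM]; ring),
    h' 2 1 (X₁ + X₂) (by simp [fL, fM]; ring), h' 0 2 (Y₁ + Y₂) (by simp [fL, fM]; ring),
    h' 0 1 (X₂ + Y₂) (by simp [fL, fM]; ring), h' 2 2 (X₁ + Y₁) (by simp [fL, fM]; ring),
    h 1 0 (X₁ + X₂ + (Y₁ + Y₂)) (by simp [fL, fM]; ring)]
  ring

/-- On the plane `L_k = M_l = 0` the reflections `a ↦ 2k - a`, `b ↦ 2l - b` change the sign of `L_a
+ M_b`, so the sum of odd powers equals its own negative. -/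
theorem nine_fP {n : ℕ} (hn : Odd n) (k l : Fin 3) : nine k l (fP n) = 0 := by
  have hs : (∑ a : Fin 3, ∑ b : Fin 3, (nine k l (fL a + fM b)) ^ n : PA) = 0 := by
    have e : (∑ a : Fin 3, ∑ b : Fin 3, (nine k l (fL a + fM b)) ^ n : PA)
        = -∑ a : Fin 3, ∑ b : Fin 3, (nine k l (fL a + fM b)) ^ n := by
      rw [← Finset.sum_neg_distrib, ← Equiv.sum_comp (Equiv.subLeft (2 * k))]
      refine Finset.sum_congr rfl fun a _ => ?_
      rw [← Finset.sum_neg_distrib, ← Equiv.sum_comp (Equiv.subLeft (2 * l))]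
      refine Finset.sum_congr rfl fun b _ => ?_
      rw [map_add, map_add, nine_fL, nine_fL, nine_fM, nine_fM, Equiv.subLeft_apply,
        Equiv.subLeft_apply, lin_sub, lin_sub, ← hn.neg_pow, C_neg, C_neg]
      congr 1
      ring
    exact self_eq_neg.1 e
  have h := congrArg (nine k l) (fP_eq_sum hn)
  simp only [map_neg, map_sum, map_mul, map_pow] at h
  rw [hs, neg_zero] at h
  refine (mul_eq_zero.1 h).resolve_left ?_
  simp

theorem fP_mem_fJ {n : ℕ} (hn : Odd n) : fP n ∈ fJ := mem_fJ (nine_fP hn) (isLine_fP hn)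

/-! ### The polynomial of `⟨s_a, s_b⟩` -/

/-- The polynomial `((X + Y)^n - X^n - Y^n) / (X Y)`. -/
def fp (n : ℕ) : PB :=
  ∑ i ∈ Finset.range (n - 1), (n.choose (i + 1) : PB) * (X 0 ^ i * X 1 ^ (n - 2 - i))

theorem ev_fp {n : ℕ} (hn : 2 ≤ n) (u v : PA) : ev u v (fp n) * (u * v) = fF n u v := by
  obtain ⟨k, rfl⟩ := Nat.exists_eq_add_of_le' hn
  rw [fF, add_pow, Finset.sum_range_succ, Finset.sum_range_succ']
  simp only [fp, map_sum, map_mul, map_pow, map_natCast, aeval_X, Matrix.cons_val_zero,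
    Matrix.cons_val_one, Finset.sum_mul, Nat.choose_self, Nat.choose_zero_right, pow_zero,
    Nat.sub_self, Nat.sub_zero, Nat.cast_one]
  rw [show k + 2 - 1 = k + 1 from rfl]
  have e : ∀ i ∈ Finset.range (k + 1),
      ((k + 2).choose (i + 1) : PA) * (u ^ i * v ^ (k + 2 - 2 - i)) * (u * v) =
        u ^ (i + 1) * v ^ (k + 2 - (i + 1)) * ((k + 2).choose (i + 1) : PA) := by
    intro i hi
    have hi' : i ≤ k := Nat.lt_succ_iff.1 (Finset.mem_range.1 hi)
    rw [show k + 2 - (i + 1) = (k + 2 - 2 - i) + 1 by omega]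
    ring
  rw [Finset.sum_congr rfl e]
  ring

/-- The sum of `u^i v^j`, `i + j = n - 1`. -/
def gs (n : ℕ) (u v : PA) : PA := ∑ i ∈ Finset.range n, u ^ i * v ^ (n - 1 - i)

theorem gs_mul (n : ℕ) (u v : PA) : gs n u v * (u - v) = u ^ n - v ^ n :=
  (Commute.all u v).geom_sum₂_mul n

theorem gs_self (n : ℕ) (u : PA) : gs n u u = n * u ^ (n - 1) := by
  have e : ∀ i ∈ Finset.range n, u ^ i * u ^ (n - 1 - i) = u ^ (n - 1) := fun i hi => by
    rw [← pow_add]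
    congr 1
    have := Finset.mem_range.1 hi
    omega
  rw [gs, Finset.sum_congr rfl e, Finset.sum_const, Finset.card_range, nsmul_eq_mul]

theorem map_gs (φ : PA →ₐ[ℂ] PA) (n : ℕ) (u v : PA) : φ (gs n u v) = gs n (φ u) (φ v) := by
  simp [gs]

/-- The quotient of `X₂(F(X₂, Y₂) - F(X₁ + X₂, Y₂)) - X₁(F(X₁, Y₁) - F(X₁ + X₂, Y₁))` by
`X₁X₂`. -/
def fN (n : ℕ) : PA :=
  (gs n (X₁ + X₂ + Y₁) (X₁ + Y₁) - gs n (X₁ + X₂) X₁)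
    - (gs n (X₁ + X₂ + Y₂) (X₂ + Y₂) - gs n (X₁ + X₂) X₂)

theorem X_mul_fN (n : ℕ) : X₁ * X₂ * fN n = X₂ * (fF n X₂ Y₂ - fF n (X₁ + X₂) Y₂)
    - X₁ * (fF n X₁ Y₁ - fF n (X₁ + X₂) Y₁) := by
  have h1 := gs_mul n (X₁ + X₂ + Y₁) (X₁ + Y₁)
  have h2 := gs_mul n (X₁ + X₂) X₁
  have h3 := gs_mul n (X₁ + X₂ + Y₂) (X₂ + Y₂)
  have h4 := gs_mul n (X₁ + X₂) X₂
  simp only [fN, fF]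
  linear_combination X₁ * h1 - X₁ * h2 - X₂ * h3 + X₂ * h4

theorem wt_nu_fp {n : ℕ} (hn : 2 ≤ n) : wt (nu (fp n)) = fP n := by
  rw [wt_nu, fP, ← ev_fp hn, ← ev_fp hn, ← ev_fp hn]
  ring

/-- The elements `s_n`. -/
def sEl (n : ℕ) : ↥(lcs 0).toSubmodule := ⟨nu (fp n), nu_mem _⟩

theorem wtbar_sEl {n : ℕ} (hn : 2 ≤ n) : wtbar (cls 0 (sEl n)) = fP n := wt_nu_fp hn

/-- The factor `Y₁ Y₂` clears the denominators of `r13_nu`, and `X₁ + X₂` turns `p(X₁ + X₂, Y_i)`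
into `(u + v)^n - u^n - v^n` at `u = X₁ + X₂`, `v = Y_i`. The remaining terms, quadratic in the
values of `p`, are absorbed when `P_a` and `P_b` are expanded. -/
theorem r13_ihara_nu_fp {a b : ℕ} (ha : 2 ≤ a) (hb : 2 ≤ b) :
    (X₁ + X₂) * Y₁ * Y₂ * r13 (ihara (nu (fp a)) (nu (fp b))) =
      X₁ * X₂ * (fP a * fN b - fP b * fN a) := by
  have ea := X_mul_fN a
  have eb := X_mul_fN b
  have ra := r13_nu (fp a)
  have rb := r13_nu (fp b)
  rw [r13_ihara (nu_mem _) (nu_mem _), wt_nu_fp ha, wt_nu_fp hb, r12_nu, r12_nu, r23_nu, r23_nu,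
    rSum_nu, rSum_nu]
  have ha1 := ev_fp ha X₁ Y₁
  have ha2 := ev_fp ha X₂ Y₂
  have ha3 := ev_fp ha (X₁ + X₂) (Y₁ + Y₂)
  have ha4 := ev_fp ha (X₁ + X₂) Y₁
  have ha5 := ev_fp ha (X₁ + X₂) Y₂
  have hb1 := ev_fp hb X₁ Y₁
  have hb2 := ev_fp hb X₂ Y₂
  have hb3 := ev_fp hb (X₁ + X₂) (Y₁ + Y₂)
  have hb4 := ev_fp hb (X₁ + X₂) Y₁
  have hb5 := ev_fp hb (X₁ + X₂) Y₂
  rw [← ha1, ← ha2, ← ha4, ← ha5] at ea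
  rw [← hb1, ← hb2, ← hb4, ← hb5] at eb
  have pa : fP a = ev X₁ Y₁ (fp a) * (X₁ * Y₁) + ev X₂ Y₂ (fp a) * (X₂ * Y₂)
      - ev (X₁ + X₂) (Y₁ + Y₂) (fp a) * ((X₁ + X₂) * (Y₁ + Y₂)) := by
    rw [fP, ha1, ha2, ha3]
  have pb : fP b = ev X₁ Y₁ (fp b) * (X₁ * Y₁) + ev X₂ Y₂ (fp b) * (X₂ * Y₂)
      - ev (X₁ + X₂) (Y₁ + Y₂) (fp b) * ((X₁ + X₂) * (Y₁ + Y₂)) := by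
    rw [fP, hb1, hb2, hb3]
  clear ha1 ha2 ha3 ha4 ha5 hb1 hb2 hb3 hb4 hb5
  have e1 : (X₁ + X₂) * Y₁ * Y₂ * (fP a * r13 (nu (fp b)) - fP b * r13 (nu (fp a))) =
    (X₁ + X₂) * (fP a * (Y₁ * Y₂ * r13 (nu (fp b))) - fP b * (Y₁ * Y₂ * r13 (nu (fp a)))) := by
    ring
  have e2 : X₁ * X₂ * (fP a * fN b - fP b * fN a) =
    fP a * (X₁ * X₂ * fN b) - fP b * (X₁ * X₂ * fN a) := by ring
  rw [e2, ea, eb, add_sub_assoc, add_assoc, mul_add, e1, ra, rb, pa, pb]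
  ring

/-- The polynomial `C` with `r13 ⟨s_a, s_b⟩ = X₁X₂C`. -/
theorem exists_cbar_brk {a b : ℕ} (ha : 2 ≤ a) (hb : 2 ≤ b) :
    ∃ c : PA, cbar (brk (sEl a) (sEl b)) = X₁ * X₂ * c ∧
      (X₁ + X₂) * Y₁ * Y₂ * c = fP a * fN b - fP b * fN a := by
  obtain ⟨u, hu⟩ := Lam_surjective (brk (sEl a) (sEl b))
  have h1 : cbar (brk (sEl a) (sEl b)) = X₁ * X₂ * (u - swapA u) := by rw [← hu, cbar_Lam]
  refine ⟨_, h1, ?_⟩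
  have h2 : cbar (brk (sEl a) (sEl b)) = r13 (ihara (nu (fp a)) (nu (fp b))) := rfl
  have h3 := r13_ihara_nu_fp ha hb
  rw [← h2, h1] at h3
  apply mul_left_cancel₀ (mul_ne_zero (X_ne_zero 0) (X_ne_zero 2) : X₁ * X₂ ≠ 0)
  rw [← h3]
  ring

/-! ### Derivatives on planes -/

theorem pderiv_fF (i : Fin 4) (n : ℕ) (u v : PA) : pderiv i (fF n u v) =
    n * ((u + v) ^ (n - 1) * (pderiv i u + pderiv i v) - u ^ (n - 1) * pderiv i u
      - v ^ (n - 1) * pderiv i v) := by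
  simp only [fF, map_sub, Derivation.leibniz_pow, map_add, nsmul_eq_mul, smul_eq_mul]
  ring

theorem pderiv_fP (i : Fin 4) (n : ℕ) : pderiv i (fP n) =
    n * ((X₁ + Y₁) ^ (n - 1) * (pderiv i X₁ + pderiv i Y₁) - X₁ ^ (n - 1) * pderiv i X₁
        - Y₁ ^ (n - 1) * pderiv i Y₁)
      + n * ((X₂ + Y₂) ^ (n - 1) * (pderiv i X₂ + pderiv i Y₂) - X₂ ^ (n - 1) * pderiv i X₂
        - Y₂ ^ (n - 1) * pderiv i Y₂)
      - n * ((X₁ + X₂ + (Y₁ + Y₂)) ^ (n - 1) *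
          (pderiv i X₁ + pderiv i X₂ + (pderiv i Y₁ + pderiv i Y₂))
        - (X₁ + X₂) ^ (n - 1) * (pderiv i X₁ + pderiv i X₂)
        - (Y₁ + Y₂) ^ (n - 1) * (pderiv i Y₁ + pderiv i Y₂)) := by
  simp only [fP, map_sub, map_add, pderiv_fF]

/-- The coefficients of the normal derivative of `P_n` along the planes `X = 0`, `Y = 0` and their
transposes. -/
def al1 (n : ℕ) : PA := n * (X₁ ^ (n - 1) - (X₁ + X₂) ^ (n - 1))
def al2 (n : ℕ) : PA := n * (X₂ ^ (n - 1) - (X₁ + X₂) ^ (n - 1))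

/-- The determinant of `al1`, `al2`. -/
def fK (a b : ℕ) : PA := al1 a * al2 b - al2 a * al1 b

theorem one_lt_of_odd {n : ℕ} (hn : 3 ≤ n) : n - 1 ≠ 0 := by omega

section
variable {n : ℕ} (hn : 3 ≤ n)
include hn

/-- The four planes are parametrized so that `P_n` has the same pair of normal derivatives on each.
This coincidence lets the leading term in `Y`, which only sees the plane `rowY`, control the other
three. -/
theorem rowX_pderiv : rowX (pderiv 0 (fP n)) = al1 n ∧ rowX (pderiv 2 (fP n)) = al2 n := by
  have h := one_lt_of_odd hn
  constructor <;>
  · simp [pderiv_fP, rowX, al1, al2, h, pderiv_X_of_ne]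
    ring

theorem rowY_pderiv : rowY (pderiv 1 (fP n)) = al1 n ∧ rowY (pderiv 3 (fP n)) = al2 n := by
  have h := one_lt_of_odd hn
  constructor <;>
  · simp [pderiv_fP, rowY, al1, al2, h, pderiv_X_of_ne]
    ring

theorem colOne_pderiv :
    colOne (pderiv 0 (fP n)) = al1 n ∧ colOne (pderiv 1 (fP n)) = al2 n := by
  have h := one_lt_of_odd hn
  constructor <;>
  · simp [pderiv_fP, colOne, al1, al2, h, pderiv_X_of_ne]
    ring

theorem colTwo_pderiv :
    colTwo (pderiv 2 (fP n)) = al1 n ∧ colTwo (pderiv 3 (fP n)) = al2 n := by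
  have h := one_lt_of_odd hn
  constructor <;>
  · simp [pderiv_fP, colTwo, al1, al2, h, pderiv_X_of_ne]
    ring

end

theorem rowX_fN (n : ℕ) : rowX (fN n) = al1 n - al2 n := by
  simp [fN, rowX, map_gs, gs_self, al1, al2]
  ring

theorem rowY_fN (n : ℕ) : rowY (fN n) = 0 := by
  simp [fN, rowY, map_gs]

theorem colOne_fN (n : ℕ) : colOne (fN n) = al1 n := by
  simp [fN, colOne, map_gs, gs_self, al1, al2]
  ring

theorem colTwo_fN (n : ℕ) : colTwo (fN n) = -al1 n := by
  simp [fN, colTwo, map_gs, gs_self, al1, al2]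
  ring

/-- On `Y₁ = Y₂ = 0` both `P_n` and `N_n` vanish while the denominator `(X₁ + X₂) Y₁ Y₂` has a
double zero, so first derivatives of `N_n` are required as well. -/
theorem rowY_pderiv_fN {n : ℕ} (hn : 3 ≤ n) :
    X₂ * rowY (pderiv 1 (fN n)) = -al1 n ∧ X₁ * rowY (pderiv 3 (fN n)) = al2 n := by
  have h := one_lt_of_odd hn
  have e : ∀ i : Fin 4, rowY (pderiv i (X₁ * X₂ * fN n)) =
      rowY (pderiv i (X₂ * (fF n X₂ Y₂ - fF n (X₁ + X₂) Y₂)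
        - X₁ * (fF n X₁ Y₁ - fF n (X₁ + X₂) Y₁))) := fun i => by rw [X_mul_fN]
  constructor
  · have e1 := e 1
    simp only [Derivation.leibniz, smul_eq_mul, map_add, map_mul, map_sub, pderiv_fF, rowY_fN] at e1
    simp [rowY, h, pderiv_X_of_ne] at e1
    apply mul_left_cancel₀ (X_ne_zero 0 : X₁ ≠ 0)
    rw [al1, rowY]
    linear_combination e1
  · have e1 := e 3
    simp only [Derivation.leibniz, smul_eq_mul, map_add, map_mul, map_sub, pderiv_fF, rowY_fN] at e1
    simp [rowY, h, pderiv_X_of_ne] at e1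
    apply mul_left_cancel₀ (X_ne_zero 2 : X₂ ≠ 0)
    rw [al2, rowY]
    linear_combination e1

/-! ### Values of `C` on the planes -/

section
variable {a b : ℕ} {c : PA} (hc : (X₁ + X₂) * Y₁ * Y₂ * c = fP a * fN b - fP b * fN a)
include hc

/-- L'Hôpital's rule on a plane where the denominator and both `P_a`, `P_b` vanish: after
differentiation only the terms with a differentiated `P` or denominator survive. -/
theorem map_pderiv_eq (φ : PA →ₐ[ℂ] PA) (ha : φ (fP a) = 0) (hb : φ (fP b) = 0)
    (hD : φ ((X₁ + X₂) * Y₁ * Y₂) = 0) (i : Fin 4) :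
    φ (pderiv i ((X₁ + X₂) * Y₁ * Y₂)) * φ c =
      φ (pderiv i (fP a)) * φ (fN b) - φ (pderiv i (fP b)) * φ (fN a) := by
  have h : φ (pderiv i ((X₁ + X₂) * Y₁ * Y₂ * c)) = φ (pderiv i (fP a * fN b - fP b * fN a)) := by
    rw [hc]
  generalize (X₁ + X₂) * Y₁ * Y₂ = d at h hD ⊢
  simp only [map_sub, Derivation.leibniz, smul_eq_mul, map_add, map_mul, ha, hb, hD] at h
  linear_combination h

theorem map_eq_zero_of_ne (φ : PA →ₐ[ℂ] PA) (ha : φ (fP a) = 0) (hb : φ (fP b) = 0)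
    (hD : φ ((X₁ + X₂) * Y₁ * Y₂) ≠ 0) : φ c = 0 := by
  have h := congrArg φ hc
  rw [map_mul φ _ c, map_sub, map_mul φ (fP a), map_mul φ (fP b), ha, hb, zero_mul, zero_mul,
    sub_zero] at h
  exact (mul_eq_zero.1 h).resolve_left hD

theorem map_eq_zero_of_pderiv_ne (φ : PA →ₐ[ℂ] PA) (ha : φ (fP a) = 0) (hb : φ (fP b) = 0)
    (ha' : φ (fN a) = 0) (hb' : φ (fN b) = 0)
    (hD : φ ((X₁ + X₂) * Y₁ * Y₂) = 0) (i : Fin 4)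
    (hD' : φ (pderiv i ((X₁ + X₂) * Y₁ * Y₂)) ≠ 0) : φ c = 0 := by
  have h := map_pderiv_eq hc φ ha hb hD i
  rw [ha', hb', mul_zero, mul_zero, sub_zero] at h
  exact (mul_eq_zero.1 h).resolve_left hD'

end

/-- The vanishing of `N` on a plane where `P` vanishes and which lies on `X₁ + X₂ = 0`, `Y₁ = 0`
or `Y₂ = 0`. -/
theorem map_fN_eq_zero {φ : PA →ₐ[ℂ] PA} {n : ℕ} (hn : n ≠ 0) (hP : φ (fP n) = 0) (h1 : φ X₁ ≠ 0)
    (h2 : φ X₂ ≠ 0) (h : φ (X₁ + X₂) = 0 ∨ φ Y₁ = 0 ∨ φ Y₂ = 0) : φ (fN n) = 0 := by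
  have e := congrArg φ (X_mul_fN n)
  have hz : ∀ u : PA, fF n u 0 = 0 := fun u => by simp [fF, hn]
  have hz' : ∀ u : PA, fF n 0 u = 0 := fun u => by simp [fF, hn]
  rw [map_mul, map_mul] at e
  refine (mul_eq_zero.1 (?_ : φ X₁ * φ X₂ * φ (fN n) = 0)).resolve_left (mul_ne_zero h1 h2)
  rw [e]
  rw [map_fP] at hP
  simp only [map_sub, map_mul, map_fF]
  rw [map_add] at h ⊢
  rcases h with h | h | h
  · rw [h] at hP ⊢
    rw [hz'] at hP
    rw [hz', hz']
    linear_combination φ X₂ * hP - fF n (φ X₁) (φ Y₁) * h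
  · rw [h] at hP ⊢
    rw [hz, zero_add, zero_add] at hP
    rw [hz, hz]
    linear_combination φ X₂ * hP
  · rw [h] at hP ⊢
    rw [hz, add_zero, add_zero] at hP
    rw [hz, hz]
    linear_combination -φ X₁ * hP

theorem ne_zero_of_eval (v : Fin 4 → ℂ) {u : PA} (h : MvPolynomial.eval v u ≠ 0) : u ≠ 0 := by
  rintro rfl
  exact h (map_zero _)

section
variable {a b : ℕ} {c : PA} (hc : (X₁ + X₂) * Y₁ * Y₂ * c = fP a * fN b - fP b * fN a)
  (ha : Odd a) (hb : Odd b) (ha3 : 3 ≤ a) (hb3 : 3 ≤ b)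
include hc ha hb

/-- Off the zeros of `(X₁ + X₂) Y₁ Y₂` this is immediate from the vanishing of `P_a` and `P_b`. On
the three planes inside that zero set `N_a` and `N_b` vanish too, and one derivative suffices. -/
theorem nine_c (k l : Fin 3) : nine k l c = 0 := by
  have pa := nine_fP ha k l
  have pb := nine_fP hb k l
  have ha0 := ha.pos.ne'
  have hb0 := hb.pos.ne'
  have deg : ∀ i : Fin 4, nine k l X₁ ≠ 0 → nine k l X₂ ≠ 0 →
      (nine k l (X₁ + X₂) = 0 ∨ nine k l Y₁ = 0 ∨ nine k l Y₂ = 0) →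
      nine k l (pderiv i ((X₁ + X₂) * Y₁ * Y₂)) ≠ 0 → nine k l c = 0 := by
    intro i h1 h2 h3 h4
    refine map_eq_zero_of_pderiv_ne hc _ pa pb (map_fN_eq_zero ha0 pa h1 h2 h3)
      (map_fN_eq_zero hb0 pb h1 h2 h3) ?_ i h4
    rw [map_mul, map_mul]
    rcases h3 with h | h | h <;> rw [h] <;> ring
  -- The planes `(2, 1)`, `(1, 1)`, `(2, 0)` are those contained in `X₁ + X₂ = 0`, `Y₁ = 0`, `Y₂ =
  -- 0` respectively.
  by_cases h21 : k = 2 ∧ l = 1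
  · obtain ⟨rfl, rfl⟩ := h21
    refine deg 0 (ne_zero_of_eval ![5, 0, 3, 0] ?_) (ne_zero_of_eval ![5, 0, 3, 0] ?_) (Or.inl ?_)
      (ne_zero_of_eval ![5, 0, 3, 0] ?_) <;>
    simp [nine, lin, pderiv_X_of_ne, Derivation.leibniz] <;> ring_nf <;> norm_num
  by_cases h11 : k = 1 ∧ l = 1
  · obtain ⟨rfl, rfl⟩ := h11
    refine deg 1 (ne_zero_of_eval ![5, 0, 3, 0] ?_) (ne_zero_of_eval ![5, 0, 3, 0] ?_)
      (Or.inr (Or.inl ?_)) (ne_zero_of_eval ![5, 0, 3, 0] ?_) <;>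
    simp [nine, lin, pderiv_X_of_ne, Derivation.leibniz] <;> ring_nf <;> norm_num
  by_cases h20 : k = 2 ∧ l = 0
  · obtain ⟨rfl, rfl⟩ := h20
    refine deg 3 (ne_zero_of_eval ![5, 0, 3, 0] ?_) (ne_zero_of_eval ![5, 0, 3, 0] ?_)
      (Or.inr (Or.inr ?_)) (ne_zero_of_eval ![5, 0, 3, 0] ?_) <;>
    simp [nine, lin, pderiv_X_of_ne, Derivation.leibniz] <;> ring_nf <;> norm_num
  refine map_eq_zero_of_ne hc _ pa pb (ne_zero_of_eval ![5, 0, 3, 0] ?_)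
  fin_cases k <;> fin_cases l <;> simp [nine, lin] at h21 h11 h20 ⊢ <;> norm_num

theorem rowZ_c : rowZ c = 0 := by
  refine map_eq_zero_of_ne hc _ (isLine_fP ha 2) (isLine_fP hb 2)
    (ne_zero_of_eval ![5, 0, 3, 0] ?_)
  simp [rowZ]
  norm_num

theorem colThree_c : colThree c = 0 := by
  have pa := isLine_fP ha 5
  have pb := isLine_fP hb 5
  have h1 : colThree X₁ ≠ 0 := by simp [colThree]
  have h2 : colThree X₂ ≠ 0 := by simp [colThree]
  have h3 : colThree (X₁ + X₂) = 0 := by simp [colThree]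
  refine map_eq_zero_of_pderiv_ne hc _ pa pb
    (map_fN_eq_zero ha.pos.ne' pa h1 h2 (Or.inl h3))
    (map_fN_eq_zero hb.pos.ne' pb h1 h2 (Or.inl h3)) ?_ 0 ?_
  · rw [map_mul, map_mul, h3]; ring
  · simp [colThree, pderiv_X_of_ne, Derivation.leibniz]

include ha3 hb3

theorem rowX_c : X₁ * X₂ * rowX c = -fK a b := by
  have h := map_pderiv_eq hc rowX (isLine_fP ha 0) (isLine_fP hb 0) (by simp [rowX]) 0
  rw [(rowX_pderiv ha3).1, (rowX_pderiv hb3).1, rowX_fN, rowX_fN] at h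
  have e : rowX (pderiv 0 ((X₁ + X₂) * Y₁ * Y₂)) = X₁ * X₂ := by
    simp [rowX, pderiv_X_of_ne, Derivation.leibniz]; try ring
  rw [e] at h
  rw [h, fK]
  ring

theorem colOne_c : X₁ * X₂ * colOne c = -fK a b := by
  have h := map_pderiv_eq hc colOne (isLine_fP ha 3) (isLine_fP hb 3) (by simp [colOne]) 1
  rw [(colOne_pderiv ha3).2, (colOne_pderiv hb3).2, colOne_fN, colOne_fN] at h
  have e : colOne (pderiv 1 ((X₁ + X₂) * Y₁ * Y₂)) = X₁ * X₂ := by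
    simp [colOne, pderiv_X_of_ne, Derivation.leibniz]; try ring
  rw [e] at h
  rw [h, fK]
  ring

theorem colTwo_c : X₁ * X₂ * colTwo c = fK a b := by
  have h := map_pderiv_eq hc colTwo (isLine_fP ha 4) (isLine_fP hb 4) (by simp [colTwo]) 3
  rw [(colTwo_pderiv ha3).2, (colTwo_pderiv hb3).2, colTwo_fN, colTwo_fN] at h
  have e : colTwo (pderiv 3 ((X₁ + X₂) * Y₁ * Y₂)) = X₁ * X₂ := by
    simp [colTwo, pderiv_X_of_ne, Derivation.leibniz]; try ring
  rw [e] at h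
  rw [h, fK]
  ring

theorem rowY_c : X₁ * X₂ * rowY c = fK a b := by
  -- The mixed derivative reduces the left side to `(X₁ + X₂) * rowY c`, since `Y₁ Y₂` vanishes to
  -- second order on this plane.
  have h := congrArg (fun u => rowY (pderiv 1 (pderiv 3 u))) hc
  have pa : rowY (fP a) = 0 := isLine_fP ha 1
  have pb : rowY (fP b) = 0 := isLine_fP hb 1
  obtain ⟨a1, a3⟩ := rowY_pderiv ha3
  obtain ⟨b1, b3⟩ := rowY_pderiv hb3
  obtain ⟨a1', a3'⟩ := rowY_pderiv_fN ha3
  obtain ⟨b1', b3'⟩ := rowY_pderiv_fN hb3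
  simp only [Derivation.leibniz, map_sub, map_add, smul_eq_mul, map_mul, pa, pb, a1, a3, b1, b3,
    rowY_fN] at h
  simp [pderiv_X_of_ne] at h
  have e1 : rowY X₁ = X₁ := by simp [rowY]
  have e2 : rowY X₂ = X₂ := by simp [rowY]
  have e3 : rowY Y₁ = 0 := by simp [rowY]
  have e4 : rowY Y₂ = 0 := by simp [rowY]
  simp only [e1, e2, e3, e4] at h
  apply mul_left_cancel₀ (show X₁ + X₂ ≠ 0 from ne_zero_of_eval (fun _ => 1) (by simp))
  rw [fK]
  linear_combination X₁ * X₂ * h + X₂ * al1 a * b3'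
    + X₁ * al2 a * b1' - X₂ * al1 b * a3' - X₁ * al2 b * a1'

end

/-! ### Leading terms in `Y` -/

/-- The substitution `Y_i ↦ t Y_i`. -/
def tau : PA →ₐ[ℂ] Polynomial PA :=
  aeval ![Polynomial.C X₁, Polynomial.X * Polynomial.C Y₁, Polynomial.C X₂,
    Polynomial.X * Polynomial.C Y₂]

@[simp] theorem tau_X₁ : tau X₁ = Polynomial.C X₁ := by simp [tau]
@[simp] theorem tau_Y₁ : tau Y₁ = Polynomial.X * Polynomial.C Y₁ := by simp [tau]
@[simp] theorem tau_X₂ : tau X₂ = Polynomial.C X₂ := by simp [tau]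
@[simp] theorem tau_Y₂ : tau Y₂ = Polynomial.X * Polynomial.C Y₂ := by simp [tau]

theorem tau_C (z : ℂ) : tau (C z) = Polynomial.C (C z) := by
  rw [algHom_C]; rfl

theorem tau_coeff (c : PA) : (tau c).coeff 0 = rowY c ∧
    (tau c).coeff 1 = rowY (pderiv 1 c) * Y₁ + rowY (pderiv 3 c) * Y₂ := by
  induction c using MvPolynomial.induction_on with
  | C z => rw [tau_C]; simp [Polynomial.coeff_C, algebraMap_eq]
  | add p q hp hq =>
    simp only [map_add, Polynomial.coeff_add, hp.1, hq.1, hp.2, hq.2]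
    exact ⟨trivial, by ring⟩
  | mul_X p i hp =>
    rw [map_mul, Polynomial.mul_coeff_zero, Polynomial.mul_coeff_one, hp.1, hp.2, map_mul]
    simp only [Derivation.leibniz, map_add, smul_eq_mul, map_mul]
    fin_cases i <;> simp [rowY, pderiv_X_of_ne, Polynomial.coeff_C] <;> ring

/-- The linear form `al1 n * Y₁ + al2 n * Y₂`. -/
def ell (n : ℕ) : PA := al1 n * Y₁ + al2 n * Y₂

theorem tau_fP_coeff {n : ℕ} (ho : Odd n) (hn : 3 ≤ n) :
    (tau (fP n)).coeff 0 = 0 ∧ (tau (fP n)).coeff 1 = ell n := by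
  rw [(tau_coeff _).1, (tau_coeff _).2, (rowY_pderiv hn).1, (rowY_pderiv hn).2]
  exact ⟨isLine_fP ho 1, rfl⟩

/-- Every term of a weight carries `Y₁`, `Y₂` or `Y₁ + Y₂`, so each application of `L_0` raises the
order in `Y` by at least one. -/
theorem X_dvd_tau_wtbar (σ : GrL 0) : Polynomial.X ∣ tau (wtbar σ) := by
  obtain ⟨f, rfl⟩ := Submodule.mkQ_surjective _ σ
  rw [Polynomial.X_dvd_iff, (tau_coeff _).1]
  change rowY (wtbar (cls 0 f)) = 0
  rw [wtbar_cls, wt_apply]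
  simp [rowY]

/-- The multiples of `t^k`. -/
def divX (k : ℕ) : Submodule ℂ (Polynomial PA) :=
  (Ideal.span {(Polynomial.X : Polynomial PA) ^ k}).restrictScalars ℂ

theorem mem_divX {k : ℕ} {u : Polynomial PA} : u ∈ divX k ↔ Polynomial.X ^ k ∣ u :=
  Ideal.mem_span_singleton

theorem X_pow_dvd_tau_of_mem_powAct (S : Submodule ℂ (GrL 0)) (k : ℕ) {m : GrL 1}
    (hm : m ∈ powAct S k) : Polynomial.X ^ k ∣ tau (cbar m) := by
  induction k generalizing m with
  | zero => simp
  | succ k ih =>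
    have h : powAct S (k + 1) ≤ (divX (k + 1)).comap (tau.toLinearMap ∘ₗ cbar) := by
      refine Submodule.map₂_le.2 fun s _ m hm => mem_divX.2 ?_
      change _ ∣ tau (cbar (act s m))
      rw [cbar_act, map_mul, pow_succ']
      exact mul_dvd_mul (X_dvd_tau_wtbar s) (ih hm)
    exact mem_divX.1 (h hm)

/-- Bracket monomials are homogeneous in `y`. -/
theorem IsMonomial.tau_rho {a : FreeL} {d : ℕ} (h : IsMonomial a d) :
    ∃ N : Matrix (Fin 3) (Fin 3) (Polynomial PA),
      (rho a).map tau * Matrix.diagonal (fun i : Fin 3 => (Polynomial.X : Polynomial PA) ^ (i : ℕ))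
      =
      (Polynomial.X : Polynomial PA) ^ d •
        (Matrix.diagonal (fun i : Fin 3 => (Polynomial.X : Polynomial PA) ^ (i : ℕ)) * N) := by
  induction h with
  | x =>
    refine ⟨!![Polynomial.C (X₁ + X₂), 0, 0; 0, Polynomial.C X₂, 0; 0, 0, 0], ?_⟩
    rw [rho_x]
    ext1 i j
    fin_cases i <;> fin_cases j <;> simp [Matrix.mul_apply, Fin.sum_univ_three]
  | y =>
    refine ⟨!![Polynomial.C (Y₁ + Y₂), 1, 0; 0, Polynomial.C Y₂, 1; 0, 0, 0], ?_⟩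
    rw [rho_y]
    ext1 i j
    fin_cases i <;> fin_cases j <;> simp [Matrix.mul_apply, Fin.sum_univ_three] <;> ring
  | @lie a b d e _ _ ha hb =>
    obtain ⟨M, hM⟩ := ha
    obtain ⟨N, hN⟩ := hb
    refine ⟨M * N - N * M, ?_⟩
    have em : ∀ A B : Matrix (Fin 3) (Fin 3) PA, (A * B).map tau = A.map tau * B.map tau :=
      fun A B => Matrix.map_mul
    rw [LieHom.map_lie, Ring.lie_def, Matrix.map_sub _ (map_sub tau), em, em, Matrix.sub_mul,
      Matrix.mul_assoc, hN, Matrix.mul_assoc, hM, Matrix.mul_smul, Matrix.mul_smul,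
      ← Matrix.mul_assoc, ← Matrix.mul_assoc, hM, hN, Matrix.smul_mul, Matrix.smul_mul, smul_smul,
      smul_smul, Matrix.mul_sub, smul_sub, Matrix.mul_assoc, Matrix.mul_assoc, ← pow_add,
      ← pow_add, Nat.add_comm e d]

/-- The corner entry of the matrix loses two powers of `t` in the conjugation by `diag(1, t, t²)`:
the entries 1 above the diagonal of `rho y` count in `y`-degree but not in `Y`-degree. Hence the
shift by 2 between depth and order in `Y`. -/
theorem IsMonomial.X_pow_dvd {k j : ℕ} (hj : k + 2 ≤ j) {f : FreeL} (hf : IsMonomial f j) :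
    Polynomial.X ^ k ∣ tau (r13 f) := by
  change _ ∣ tau (rho f 0 2)
  obtain ⟨N, hN⟩ := IsMonomial.tau_rho hf
  have h := congrFun (congrFun hN 0) 2
  simp only [Matrix.mul_diagonal, Matrix.smul_apply, Matrix.diagonal_mul, Matrix.map_apply,
    smul_eq_mul] at h
  obtain ⟨i, rfl⟩ := Nat.exists_eq_add_of_le hj
  refine ⟨Polynomial.X ^ i * N 0 2, ?_⟩
  apply mul_left_cancel₀ (pow_ne_zero 2 (Polynomial.X_ne_zero (R := PA)))
  rw [mul_comm]
  refine h.trans ?_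
  simp
  ring

theorem X_pow_dvd_tau_of_mem_yPart {k j : ℕ} (hj : k + 2 ≤ j) {f : FreeL} (hf : f ∈ yPart j) :
    Polynomial.X ^ k ∣ tau (r13 f) := by
  have h : yPart j ≤ (divX k).comap (tau.toLinearMap ∘ₗ r13) := by
    refine Submodule.span_le.2 fun a ha => mem_divX.2 (IsMonomial.X_pow_dvd hj ha)
  exact mem_divX.1 (h hf)

theorem X_pow_dvd_tau_of_mem_depthL1 {k i : ℕ} (hi : k + 2 ≤ i) {m : GrL 1} (hm : m ∈ depthL1 i) :
    Polynomial.X ^ k ∣ tau (cbar m) := by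
  obtain ⟨f, hf, rfl⟩ := hm
  have h : depth i ≤ (divX k).comap (tau.toLinearMap ∘ₗ r13) :=
    iSup₂_le fun j hj a ha => mem_divX.2 (X_pow_dvd_tau_of_mem_yPart (hi.trans hj) ha.1)
  exact mem_divX.1 (h hf)

/-! ### Powers of the ideal of `P_3`, `P_5` and the filtration by `S^k(Σ) · L_1` -/

@[simp] theorem r12_x_lie (a b : FreeL) : r12 ⁅x, ⁅a, b⁆⁆ = X₁ * r12 ⁅a, b⁆ :=
  (r_x_lie (lie_mem_zero a b)).1
@[simp] theorem r12_y_lie (a b : FreeL) : r12 ⁅y, ⁅a, b⁆⁆ = Y₁ * r12 ⁅a, b⁆ :=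
  (r_y_lie (lie_mem_zero a b)).1
@[simp] theorem r23_x_lie (a b : FreeL) : r23 ⁅x, ⁅a, b⁆⁆ = X₂ * r23 ⁅a, b⁆ :=
  (r_x_lie (lie_mem_zero a b)).2.1
@[simp] theorem r23_y_lie (a b : FreeL) : r23 ⁅y, ⁅a, b⁆⁆ = Y₂ * r23 ⁅a, b⁆ :=
  (r_y_lie (lie_mem_zero a b)).2.1
@[simp] theorem rSum_x_lie_lie (a b : FreeL) : rSum ⁅x, ⁅a, b⁆⁆ = (X₁ + X₂) * rSum ⁅a, b⁆ :=
  rSum_x_lie (lie_mem_zero a b)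
@[simp] theorem rSum_y_lie_lie (a b : FreeL) : rSum ⁅y, ⁅a, b⁆⁆ = (Y₁ + Y₂) * rSum ⁅a, b⁆ :=
  rSum_y_lie (lie_mem_zero a b)

theorem wt_sigma3 : 3 * wt sigma3 = fP 3 := by
  rw [wt_apply, sigma3]
  simp [r_xy.1, r_xy.2.1, rSum_xy, fP, fF]
  ring

theorem wt_sigma5 : 5 * wt sigma5 = 2 * fP 5 := by
  rw [wt_apply, sigma5]
  simp [r_xy.1, r_xy.2.1, rSum_xy, fP, fF, MvPolynomial.smul_eq_C_mul, map_ofNat]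
  ring

theorem exists_wtbar_three : ∃ σ ∈ Sig, wtbar σ = fP 3 := by
  refine ⟨(3 : ℂ) • cls 0 ⟨sigma3, sigma3_mem_lcs⟩,
    Sig.smul_mem _ ⟨_, isGrt_sigma3, rfl⟩, ?_⟩
  rw [map_smul, wtbar_cls, ← wt_sigma3, smul_eq_C_mul, map_ofNat]

theorem exists_wtbar_five : ∃ σ ∈ Sig, wtbar σ = fP 5 := by
  refine ⟨(5 / 2 : ℂ) • cls 0 ⟨sigma5, sigma5_mem_lcs⟩,
    Sig.smul_mem _ ⟨_, isGrt_sigma5, rfl⟩, ?_⟩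
  have h2 : (C (1 / 2) : PA) * 2 = 1 := by
    rw [← map_ofNat (C : ℂ →+* PA) 2, ← C_mul]; norm_num
  have h5 : (C (5 / 2) : PA) = C (1 / 2) * 5 := by
    rw [← map_ofNat (C : ℂ →+* PA) 5, ← C_mul]; norm_num
  rw [map_smul, wtbar_cls, smul_eq_C_mul, h5]
  linear_combination C (1 / 2) * wt_sigma5 + fP 5 * h2

/-- By `act_Lam`, multiplication by `P_3` or `P_5` inside `Lam` is the action of an element of
`Sig`; the cofactors are absorbed in the argument of `Lam`. -/
theorem Lam_mem_powAct (k : ℕ) {a : PA} (ha : a ∈ fJ ^ k) : Lam a ∈ powAct Sig k := by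
  induction k generalizing a with
  | zero => exact Submodule.mem_top
  | succ k ih =>
    rw [pow_succ'] at ha
    refine Submodule.mul_induction_on ha (fun r hr s hs => ?_) (fun p q hp hq => ?_)
    · obtain ⟨p, q, rfl⟩ := Ideal.mem_span_pair.1 hr
      obtain ⟨σ, hσ, e3⟩ := exists_wtbar_three
      obtain ⟨σ', hσ', e5⟩ := exists_wtbar_five
      have e : (p * fP 3 + q * fP 5) * s = wtbar σ * (p * s) + wtbar σ' * (q * s) := by
        rw [e3, e5]; ring
      rw [e, map_add, ← act_Lam, ← act_Lam]
      exact add_mem (Submodule.apply_mem_map₂ _ hσ (ih (Ideal.mul_mem_left _ _ hs)))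
        (Submodule.apply_mem_map₂ _ hσ' (ih (Ideal.mul_mem_left _ _ hs)))
    · rw [map_add]
      exact add_mem hp hq

/-! ### Binary forms over `ℂ[X₁, Y₁, X₂, Y₂]` -/

/-- Polynomials in two further variables. -/
abbrev PT : Type := MvPolynomial (Fin 2) PA

/-- Evaluation at `P_3`, `P_5`. -/
def evP : PT →+* PA := eval₂Hom (RingHom.id PA) ![fP 3, fP 5]

/-- Evaluation at `ell 3`, `ell 5`, the coefficients being restricted to a plane. -/
def th (φ : PA →ₐ[ℂ] PA) : PT →+* PA := eval₂Hom (φ : PA →+* PA) ![ell 3, ell 5]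

theorem evP_mem {k : ℕ} {u : PT} (hu : u.IsHomogeneous k) (h : ∀ d, coeff d u ∈ fJ) :
    evP u ∈ fJ ^ (k + 1) := by
  rw [evP, coe_eval₂Hom, eval₂_eq']
  refine Ideal.sum_mem _ fun d hd => ?_
  rw [pow_succ']
  refine Ideal.mul_mem_mul (h d) ?_
  have hk : d 0 + d 1 = k := by
    have := hu (mem_support_iff.1 hd)
    rw [← this, Finsupp.weight_apply, Finsupp.sum_fintype _ _ (by simp)]
    simp
  rw [Fin.prod_univ_two, ← hk, pow_add]
  exact Ideal.mul_mem_mul (Ideal.pow_mem_pow fP_three_mem _) (Ideal.pow_mem_pow fP_five_mem _)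

/-- The substitution inverting `ell 3`, `ell 5` up to the determinant. -/
def kap : PA →ₐ[ℂ] PT :=
  aeval ![C X₁, C (al2 5) * X 0 - C (al2 3) * X 1, C X₂, C (al1 3) * X 1 - C (al1 5) * X 0]

theorem kap_X₁ : kap X₁ = C X₁ := by simp [kap]
theorem kap_Y₁ : kap Y₁ = C (al2 5) * X 0 - C (al2 3) * X 1 := by simp [kap]
theorem kap_X₂ : kap X₂ = C X₂ := by simp [kap]
theorem kap_Y₂ : kap Y₂ = C (al1 3) * X 1 - C (al1 5) * X 0 := by simp [kap]

theorem kap_al (n : ℕ) : kap (al1 n) = C (al1 n) ∧ kap (al2 n) = C (al2 n) := by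
  simp [al1, al2, kap_X₁, kap_X₂]

theorem kap_ell : kap (ell 3) = C (fK 3 5) * X 0 ∧ kap (ell 5) = C (fK 3 5) * X 1 := by
  simp only [ell, fK, map_add, map_mul, kap_al, kap_Y₁, kap_Y₂, map_sub]
  constructor <;> ring

theorem fK_ne_zero : fK 3 5 ≠ 0 := by
  apply ne_zero_of_eval ![1, 0, 2, 0]
  simp [fK, al1, al2]
  norm_num

/-- Under `kap` the forms `ell 3`, `ell 5` become `fK 3 5` times the two variables, so the
restricted coefficients of `u` can be read off from `th φ u`. As `fK 3 5 ≠ 0`, this is the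
independence of `ell 3` and `ell 5` over the functions on the plane. -/
theorem coeff_kap_th {φ : PA →ₐ[ℂ] PA} (hφ : ∀ c, kap (φ c) = C (φ c)) (u : PT) (d : Fin 2 →₀ ℕ) :
    coeff d (kap (th φ u)) = φ (coeff d u) * fK 3 5 ^ (d 0 + d 1) := by
  induction u using MvPolynomial.induction_on' with
  | monomial s a =>
    have e : kap (th φ (monomial s a)) = monomial s (φ a * fK 3 5 ^ (s 0 + s 1)) := by
      rw [th, coe_eval₂Hom, eval₂_monomial, Finsupp.prod_fintype _ _ (fun _ => pow_zero _),
        Fin.prod_univ_two, map_mul, map_mul, map_pow, map_pow]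
      simp only [Matrix.cons_val_zero, Matrix.cons_val_one, kap_ell]
      rw [monomial_eq (s := s), Finsupp.prod_fintype _ _ (fun _ => pow_zero _), Fin.prod_univ_two,
        C_mul, C_pow]
      change kap (φ a) * _ = _
      rw [hφ]
      ring
    rw [e, coeff_monomial, coeff_monomial]
    split_ifs with h
    · rw [h]
    · rw [map_zero, zero_mul]
  | add p q hp hq => simp only [map_add, coeff_add, hp, hq, add_mul]

theorem map_coeff_eq_zero {φ : PA →ₐ[ℂ] PA} (hφ : ∀ c, kap (φ c) = C (φ c)) {u : PT}
    (hu : th φ u = 0) (d : Fin 2 →₀ ℕ) : φ (coeff d u) = 0 := by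
  have h := coeff_kap_th hφ u d
  rw [hu, map_zero, coeff_zero] at h
  exact (mul_eq_zero.1 h.symm).resolve_right (pow_ne_zero _ fK_ne_zero)

/-! ### The elements of `L_1` obtained from `⟨s_a, s_b⟩` -/

/-- The planes on which the polynomial of `⟨s_a, s_b⟩` vanishes. -/
inductive IsZeroPlane : (PA →ₐ[ℂ] PA) → Prop
  | nine (k l : Fin 3) : IsZeroPlane (nine k l)
  | rowZ : IsZeroPlane rowZ
  | colThree : IsZeroPlane colThree

/-- The remaining planes, with the sign of the value of the polynomial of `⟨s_a, s_b⟩`. -/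
inductive IsSignedPlane : (PA →ₐ[ℂ] PA) → ℂ → Prop
  | rowX : IsSignedPlane rowX (-1)
  | rowY : IsSignedPlane rowY 1
  | colOne : IsSignedPlane colOne (-1)
  | colTwo : IsSignedPlane colTwo 1

theorem IsSignedPlane.kap {φ : PA →ₐ[ℂ] PA} {ε : ℂ} (h : IsSignedPlane φ ε) (c : PA) :
    kap (φ c) = C (φ c) := by
  have e : GrtDepth.kap.comp φ = ((Algebra.ofId PA PT).restrictScalars ℂ).comp φ := by
    cases h <;> apply algHom_PA_ext <;>
      simp [GrtDepth.rowX, GrtDepth.rowY, GrtDepth.colOne, GrtDepth.colTwo, kap_X₁, kap_X₂,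
        Algebra.ofId_apply, algebraMap_eq]
  exact congrArg (fun F : PA →ₐ[ℂ] PT => F c) e

theorem IsSignedPlane.pderiv {φ : PA →ₐ[ℂ] PA} {ε : ℂ} (h : IsSignedPlane φ ε) :
    ∃ i j : Fin 4, ∀ n, 3 ≤ n → φ (pderiv i (fP n)) = al1 n ∧ φ (pderiv j (fP n)) = al2 n := by
  cases h
  exacts [⟨_, _, fun n hn => rowX_pderiv hn⟩, ⟨_, _, fun n hn => rowY_pderiv hn⟩,
    ⟨_, _, fun n hn => colOne_pderiv hn⟩, ⟨_, _, fun n hn => colTwo_pderiv hn⟩]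

theorem IsSignedPlane.fP {φ : PA →ₐ[ℂ] PA} {ε : ℂ} (h : IsSignedPlane φ ε) {n : ℕ} (hn : Odd n) :
    φ (fP n) = 0 := by
  cases h
  exacts [isLine_fP hn 0, isLine_fP hn 1, isLine_fP hn 3, isLine_fP hn 4]

/-- Differentiating `p P_3 + q P_5 = P_n` on a plane where `P_3` and `P_5` vanish leaves only
derivatives of the `P`'s, and these are `al1` and `al2` on all signed planes. -/
theorem IsSignedPlane.ell {φ : PA →ₐ[ℂ] PA} {ε : ℂ} (h : IsSignedPlane φ ε) {n : ℕ} (hn : 3 ≤ n)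
    {p q : PA} (e : p * GrtDepth.fP 3 + q * GrtDepth.fP 5 = GrtDepth.fP n) :
    φ p * ell 3 + φ q * ell 5 = ell n := by
  obtain ⟨i, j, hij⟩ := h.pderiv
  have h3 : φ (GrtDepth.fP 3) = 0 := h.fP (by decide)
  have h5 : φ (GrtDepth.fP 5) = 0 := h.fP (by decide)
  have ei : ∀ i, φ p * φ (MvPolynomial.pderiv i (GrtDepth.fP 3)) +
      φ q * φ (MvPolynomial.pderiv i (GrtDepth.fP 5)) =
        φ (MvPolynomial.pderiv i (GrtDepth.fP n)) := fun i => by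
    rw [← e]
    simp only [map_add, Derivation.leibniz, smul_eq_mul, map_mul, h3, h5]
    ring
  have e1 := ei i
  have e2 := ei j
  rw [(hij 3 le_rfl).1, (hij 5 (by norm_num)).1, (hij n hn).1] at e1
  rw [(hij 3 le_rfl).2, (hij 5 (by norm_num)).2, (hij n hn).2] at e2
  simp only [GrtDepth.ell]
  linear_combination Y₁ * e1 + Y₂ * e2

/-- `m` is given by a binary form of degree `k` in `P_3`, `P_5` whose values on the planes are
determined by the leading term in `Y` of the polynomial of `m`. -/
def IsGood (k : ℕ) (m : GrL 1) : Prop :=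
  ∃ u : PT, u.IsHomogeneous k ∧ cbar m = X₁ * X₂ * evP u ∧ Polynomial.X ^ k ∣ tau (cbar m) ∧
    (∀ φ, IsZeroPlane φ → MvPolynomial.map (φ : PA →+* PA) u = 0) ∧
    ∀ φ ε, IsSignedPlane φ ε → X₁ * X₂ * th φ u = C ε * (tau (cbar m)).coeff k

theorem IsGood.add {k : ℕ} {m m' : GrL 1} (h : IsGood k m) (h' : IsGood k m') :
    IsGood k (m + m') := by
  obtain ⟨u, h1, h2, h3, h4, h5⟩ := h
  obtain ⟨v, k1, k2, k3, k4, k5⟩ := h'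
  refine ⟨u + v, h1.add k1, ?_, ?_, fun φ hφ => ?_, fun φ ε hφ => ?_⟩
  · rw [map_add, map_add, h2, k2]; ring
  · rw [map_add, map_add]; exact dvd_add h3 k3
  · rw [map_add, h4 φ hφ, k4 φ hφ, add_zero]
  · rw [map_add, map_add, map_add, Polynomial.coeff_add, mul_add, h5 φ ε hφ, k5 φ ε hφ, mul_add]

theorem IsGood.smul {k : ℕ} (z : ℂ) {m : GrL 1} (h : IsGood k m) : IsGood k (z • m) := by
  obtain ⟨u, h1, h2, h3, h4, h5⟩ := h
  have e : cbar (z • m) = C z * cbar m := by rw [map_smul, smul_eq_C_mul]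
  refine ⟨C (C z) * u, h1.C_mul _, ?_, ?_, fun φ hφ => ?_, fun φ ε hφ => ?_⟩
  · rw [e, map_mul, h2, show evP (C (C z)) = C z by simp [evP]]; ring
  · rw [e, map_mul]; exact h3.mul_left _
  · rw [map_mul, h4 φ hφ, mul_zero]
  · rw [e, map_mul, map_mul, tau_C, Polynomial.coeff_C_mul,
      show th φ (C (C z)) = C z by simp [th, algHom_C, algebraMap_eq]]
    linear_combination C z * h5 φ ε hφ

theorem IsGood.zero (k : ℕ) : IsGood k 0 := by
  refine ⟨0, isHomogeneous_zero _ _ _, ?_, ?_, fun φ hφ => ?_, fun φ ε hφ => ?_⟩ <;> simp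

/-- The subspace of the `m` with `IsGood k m`. -/
def good (k : ℕ) : Submodule ℂ (GrL 1) where
  carrier := {m | IsGood k m}
  zero_mem' := IsGood.zero k
  add_mem' := IsGood.add
  smul_mem' z _ h := h.smul z

/-- The form is the constant `c` of `exists_cbar_brk`; its values on the signed planes agree up to
sign with its value on `rowY`, which is its leading coefficient in `Y`. -/
theorem isGood_brk {a b : ℕ} (ha : Odd a) (hb : Odd b) (ha3 : 3 ≤ a) (hb3 : 3 ≤ b) :
    IsGood 0 (brk (sEl a) (sEl b)) := by
  obtain ⟨c, h1, hc⟩ := exists_cbar_brk (by omega : 2 ≤ a) (by omega : 2 ≤ b)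
  refine ⟨C c, isHomogeneous_C _ _, ?_, by simp, fun φ hφ => ?_, fun φ ε hφ => ?_⟩
  · rw [h1]; simp [evP]
  · rw [map_C]
    have : φ c = 0 := by
      cases hφ
      exacts [nine_c hc ha hb _ _, rowZ_c hc ha hb, colThree_c hc ha hb]
    rw [RingHom.coe_coe, this, C_0]
  · have e : (tau (cbar (brk (sEl a) (sEl b)))).coeff 0 = fK a b := by
      rw [(tau_coeff _).1, h1, map_mul, map_mul, ← rowY_c hc ha hb ha3 hb3]
      simp [rowY]
    rw [e, show th φ (C c) = φ c by simp [th]]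
    cases hφ
    · rw [rowX_c hc ha hb ha3 hb3]; simp
    · rw [rowY_c hc ha hb ha3 hb3]; simp
    · rw [colOne_c hc ha hb ha3 hb3]; simp
    · rw [colTwo_c hc ha hb ha3 hb3]; simp

/-- With `P_n = p P_3 + q P_5`, the form is multiplied by the linear form with coefficients `p, q`.
Evaluated on a signed plane that linear form gives `ell n`, by which the leading term of the
polynomial is multiplied as well. -/
theorem IsGood.act {n : ℕ} (ho : Odd n) (hn : 3 ≤ n) {k : ℕ} {m : GrL 1} (h : IsGood k m) :
    IsGood (k + 1) (act (cls 0 (sEl n)) m) := by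
  obtain ⟨u, h1, h2, h3, h4, h5⟩ := h
  obtain ⟨p, q, e⟩ := Ideal.mem_span_pair.1 (fP_mem_fJ ho)
  have hm : cbar (GrtDepth.act (cls 0 (sEl n)) m) = fP n * cbar m := by
    rw [cbar_act, wtbar_sEl (by omega)]
  obtain ⟨A, hA⟩ := Polynomial.X_dvd_iff.2 (tau_fP_coeff ho hn).1
  obtain ⟨B, hB⟩ := h3
  have hA1 : A.coeff 0 = ell n := by
    rw [← (tau_fP_coeff ho hn).2, hA, Polynomial.coeff_X_mul]
  have hB1 : B.coeff 0 = (tau (cbar m)).coeff k := by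
    rw [hB, ← Nat.zero_add k, Polynomial.coeff_X_pow_mul', Nat.zero_add]
    simp
  have hAB : tau (fP n * cbar m) = Polynomial.X ^ (k + 1) * (A * B) := by
    rw [map_mul, hA, hB]; ring
  refine ⟨(C p * X 0 + C q * X 1) * u, ?_, ?_, ?_, fun φ hφ => ?_, fun φ ε hφ => ?_⟩
  · rw [Nat.add_comm]
    exact ((isHomogeneous_C_mul_X p 0).add (isHomogeneous_C_mul_X q 1)).mul h1
  · rw [hm, h2, ← e, map_mul]
    simp [evP]
    ring
  · rw [hm, hAB]
    exact dvd_mul_right _ _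
  · rw [map_mul, h4 φ hφ, mul_zero]
  · have hk : (Polynomial.X ^ (k + 1) * (A * B)).coeff (k + 1) =
        ell n * (tau (cbar m)).coeff k := by
      rw [← hA1, ← hB1, ← Polynomial.mul_coeff_zero]
      conv_lhs => rw [← Nat.zero_add (k + 1), Polynomial.coeff_X_pow_mul', Nat.zero_add]
      simp
    rw [hm, hAB, hk, map_mul]
    have et : th φ (C p * X 0 + C q * X 1) = ell n := by
      rw [← hφ.ell hn e]
      simp [th]
    rw [et]
    linear_combination ell n * h5 φ ε hφ

/-- If the leading term vanishes then the element lies in the next step of the filtration. -/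
theorem IsGood.mem_powAct {k : ℕ} {m : GrL 1} (h : IsGood k m)
    (h0 : Polynomial.X ^ (k + 1) ∣ tau (cbar m)) : m ∈ powAct Sig (k + 1) := by
  obtain ⟨u, h1, h2, h3, h4, h5⟩ := h
  have hk : (tau (cbar m)).coeff k = 0 :=
    Polynomial.X_pow_dvd_iff.1 h0 k (Nat.lt_succ_self k)
  have hz : ∀ φ, IsZeroPlane φ → ∀ d, φ (coeff d u) = 0 := fun φ hφ d => by
    have := congrArg (coeff d) (h4 φ hφ)
    rwa [coeff_map, coeff_zero] at this
  have hs : ∀ φ ε, IsSignedPlane φ ε → ∀ d, φ (coeff d u) = 0 := fun φ ε hφ d => by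
    refine map_coeff_eq_zero hφ.kap ?_ d
    have := h5 φ ε hφ
    rw [hk, mul_zero] at this
    exact (mul_eq_zero.1 this).resolve_left (mul_ne_zero (X_ne_zero _) (X_ne_zero _))
  -- Each coefficient now vanishes on all fifteen planes.
  have hJ : ∀ d, coeff d u ∈ fJ := fun d => by
    refine mem_fJ (fun k l => hz _ (.nine k l) d) fun i => ?_
    fin_cases i
    exacts [hs _ _ .rowX d, hs _ _ .rowY d, hz _ .rowZ d, hs _ _ .colOne d, hs _ _ .colTwo d,
      hz _ .colThree d]
  rw [Lam_of_cbar_eq h2]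
  refine Lam_mem_powAct _ ?_
  rw [smul_eq_C_mul]
  exact Ideal.mul_mem_left _ _ (evP_mem h1 hJ)

/-! ### The image of `Λ²(Σ)` -/

/-- The classes of the `s_n`, `n` odd. -/
def sSpan : Submodule ℂ (GrL 0) := Submodule.span ℂ {σ | ∃ n, Odd n ∧ 3 ≤ n ∧ σ = cls 0 (sEl n)}

theorem act_mem_good {k : ℕ} {σ : GrL 0} (hσ : σ ∈ sSpan) {m : GrL 1} (hm : m ∈ good k) :
    act σ m ∈ good (k + 1) := by
  have h : sSpan ≤ (good (k + 1)).comap (act.flip m) := by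
    refine Submodule.span_le.2 ?_
    rintro _ ⟨n, ho, hn, rfl⟩
    exact IsGood.act ho hn hm
  exact h hσ

theorem brk_add_left (f f' g : ↥(lcs 0).toSubmodule) : brk (f + f') g = brk f g + brk f' g := by
  rw [brk, brk, brk, ← map_add]
  congr 1
  apply Subtype.ext
  simp

theorem brk_smul_left (z : ℂ) (f g : ↥(lcs 0).toSubmodule) : brk (z • f) g = z • brk f g := by
  rw [brk, brk, ← map_smul]
  congr 1
  apply Subtype.ext
  simp

theorem brk_swap (f g : ↥(lcs 0).toSubmodule) : brk g f = -brk f g := by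
  rw [brk, brk, ← map_neg]
  congr 1
  apply Subtype.ext
  change ihara g.1 f.1 = -ihara f.1 g.1
  rw [ihara_apply, ihara_apply, ← lie_skew]
  abel

theorem brk_of_mem_one (f g : ↥(lcs 0).toSubmodule) (hg : g.1 ∈ lcs 1) :
    brk f g = act (cls 0 f) (cls 1 ⟨g.1, hg⟩) := rfl

/-- Any lifts can be compared with combinations of the `s_n`, for which `isGood_brk` applies by
bilinearity. -/
theorem brk_mem_good {f g : ↥(lcs 0).toSubmodule} (hf : cls 0 f ∈ Sig) (hg : cls 0 g ∈ Sig)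
    (hS : Sig ≤ sSpan) : ∃ m ∈ good 0, brk f g - m ∈ powAct Sig 1 := by
  let T : Submodule ℂ ↥(lcs 0).toSubmodule :=
    Submodule.span ℂ {f | ∃ n, Odd n ∧ 3 ≤ n ∧ f = sEl n}
  have hT : ∀ f : ↥(lcs 0).toSubmodule, cls 0 f ∈ Sig → ∃ f₀ ∈ T, f.1 - f₀.1 ∈ lcs 1 := by
    intro f hf
    have h1 : cls 0 f ∈ T.map (cls 0) := by
      have e : sSpan ≤ T.map (cls 0) := by
        refine Submodule.span_le.2 ?_
        rintro _ ⟨n, ho, hn, rfl⟩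
        exact ⟨sEl n, Submodule.subset_span ⟨n, ho, hn, rfl⟩, rfl⟩
      exact e (hS hf)
    obtain ⟨f₀, h0, e⟩ := h1
    refine ⟨f₀, h0, ?_⟩
    have h2 : cls 0 (f - f₀) = 0 := by rw [map_sub, e, sub_self]
    have h3 := (Submodule.Quotient.mk_eq_zero (M := ↥(lcs 0).toSubmodule) _).1 h2
    exact h3
  have hTT : ∀ f ∈ T, ∀ g ∈ T, brk f g ∈ good 0 := by
    intro f hf g hg
    induction hf using Submodule.span_induction with
    | mem f h =>
      obtain ⟨a, ha, ha3, rfl⟩ := h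
      induction hg using Submodule.span_induction with
      | mem g h =>
        obtain ⟨b, hb, hb3, rfl⟩ := h
        exact isGood_brk ha hb ha3 hb3
      | zero =>
        have := brk_smul_left 0 0 (sEl a)
        rw [zero_smul, zero_smul] at this
        rw [brk_swap, this, neg_zero]
        exact zero_mem _
      | add g g' _ _ h h' =>
        rw [brk_swap, brk_add_left, neg_add, ← brk_swap, ← brk_swap]
        exact add_mem h h'
      | smul z g _ h =>
        rw [brk_swap, brk_smul_left, ← smul_neg, ← brk_swap]
        exact Submodule.smul_mem _ _ h
    | zero =>
      have := brk_smul_left 0 0 g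
      rw [zero_smul, zero_smul] at this
      rw [this]
      exact zero_mem _
    | add f f' _ _ h h' => rw [brk_add_left]; exact add_mem h h'
    | smul z f _ h => rw [brk_smul_left]; exact Submodule.smul_mem _ _ h
  obtain ⟨f₀, hf0, ef⟩ := hT f hf
  obtain ⟨g₀, hg0, eg⟩ := hT g hg
  refine ⟨brk f₀ g₀, hTT f₀ hf0 g₀ hg0, ?_⟩
  have cf : cls 0 f₀ = cls 0 f := by
    rw [← sub_eq_zero, ← map_sub]
    refine (Submodule.Quotient.mk_eq_zero _).2 ?_
    change f₀.1 - f.1 ∈ lcs 1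
    rw [← neg_sub]
    exact neg_mem ef
  -- Both second arguments on the right lie in `lcs 1`, so each term is the action of an element of
  -- `Sig` on `L_1`.
  have e : brk f g - brk f₀ g₀ = brk f₀ (g - g₀) - brk g (f - f₀) := by
    have h1 : brk f g = brk (f - f₀) g + brk f₀ g := by
      rw [← brk_add_left, sub_add_cancel]
    have h2 : brk f₀ g = brk f₀ (g - g₀) + brk f₀ g₀ := by
      rw [brk_swap, brk_swap (g - g₀), brk_swap g₀, ← neg_add, ← brk_add_left, sub_add_cancel]
    rw [h1, h2, brk_swap g (f - f₀)]
    abel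
  have act_mem : ∀ {σ : GrL 0} (m : GrL 1), σ ∈ Sig → act σ m ∈ powAct Sig 1 :=
    fun m hσ => Submodule.apply_mem_map₂ _ hσ Submodule.mem_top
  rw [e, brk_of_mem_one _ _ eg, brk_of_mem_one _ _ ef, cf]
  exact sub_mem (act_mem _ hf) (act_mem _ hg)

/-- Elements of `Mmin Sig k` have representatives as in `IsGood`. -/
theorem exists_good_of_mem_Mmin (hS : Sig ≤ sSpan) (k : ℕ) {c : GrX Sig k} (hc : c ∈ Mmin Sig k) :
    ∃ m : ↥(powAct Sig k), m.1 ∈ good k ∧ c = Submodule.Quotient.mk m := by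
  have key : Mmin Sig k ≤ ((good k).comap (powAct Sig k).subtype).map (Submodule.mkQ _) := by
    clear hc c
    induction k with
    | zero =>
      refine Submodule.span_le.2 ?_
      rintro _ ⟨f, g, hf, hg, rfl⟩
      obtain ⟨m, hm, h⟩ := brk_mem_good hf hg hS
      refine ⟨⟨m, Submodule.mem_top⟩, hm, ?_⟩
      refine (Submodule.Quotient.eq _).2 ?_
      change m - brk f g ∈ powAct Sig 1
      rw [← neg_sub]
      exact neg_mem h
    | succ k ih =>
      refine iSup_le fun s => ?_
      rw [Submodule.map_le_iff_le_comap]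
      intro c hc
      obtain ⟨m, hm, rfl⟩ := ih hc
      exact ⟨mulX Sig k s m, act_mem_good (hS s.2) hm, rfl⟩
  obtain ⟨m, hm, e⟩ := key hc
  exact ⟨m, hm, e.symm⟩

/-- A good representative and one of depth greater than `k + 2` differ by an element of `S^{k+1}(Σ)
· L_1`. The polynomials of the latter two are divisible by `t^{k+1}`, hence so is that of the good
one, and `IsGood.mem_powAct` concludes. -/
theorem eq_zero_of_mem_depth (hS : Sig ≤ sSpan) {k i : ℕ} (hi : k + 2 < i) {c : GrX Sig k}
    (hc : c ∈ Mmin Sig k) (hd : c ∈ depthGrX Sig k i) : c = 0 := by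
  obtain ⟨m, hm, rfl⟩ := exists_good_of_mem_Mmin hS k hc
  obtain ⟨m', hm', e⟩ := hd
  have e' : m'.1 - m.1 ∈ powAct Sig (k + 1) := by
    have h := (Submodule.Quotient.eq (M := ↥(powAct Sig k)) _).1 e
    exact h
  refine (Submodule.Quotient.mk_eq_zero _).2 ?_
  change m.1 ∈ powAct Sig (k + 1)
  refine IsGood.mem_powAct hm ?_
  have h1 := X_pow_dvd_tau_of_mem_depthL1 (k := k + 1) (by omega) (show m'.1 ∈ depthL1 i from hm')
  have h2 := X_pow_dvd_tau_of_mem_powAct _ _ e'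
  have h3 := dvd_sub h1 h2
  rwa [← map_sub, ← map_sub, sub_sub_cancel] at h3

/-! ### Elements of `Mmin` have depth at least `k + 2` -/

theorem lie_mem_yPart {i j : ℕ} {a b : FreeL} (ha : a ∈ yPart i) (hb : b ∈ yPart j) :
    ⁅a, b⁆ ∈ yPart (i + j) := by
  induction ha using Submodule.span_induction with
  | mem a ha =>
    induction hb using Submodule.span_induction with
    | mem b hb => exact Submodule.subset_span (IsMonomial.lie ha hb)
    | zero => rw [lie_zero]; exact zero_mem _
    | add b b' _ _ h h' => rw [lie_add]; exact add_mem h h'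
    | smul z b _ h => rw [lie_smul]; exact Submodule.smul_mem _ _ h
  | zero => rw [zero_lie]; exact zero_mem _
  | add a a' _ _ h h' => rw [add_lie]; exact add_mem h h'
  | smul z a _ h => rw [smul_lie]; exact Submodule.smul_mem _ _ h

theorem D_mem_yPart {i j : ℕ} {f a : FreeL} (hf : f ∈ yPart i) (ha : a ∈ yPart j) :
    D f a ∈ yPart (i + j) := by
  have h : yPart j ≤ (yPart (i + j)).comap (D f : FreeL →ₗ[ℂ] FreeL) := by
    clear ha
    refine Submodule.span_le.2 fun a ha => ?_
    change D f a ∈ yPart (i + j)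
    induction ha with
    | x => rw [D_x]; exact zero_mem _
    | y =>
      rw [D_y, Nat.add_comm]
      exact lie_mem_yPart (Submodule.subset_span IsMonomial.y) hf
    | @lie a b d e ha hb iha ihb =>
      rw [LieDerivation.apply_lie_eq_sub]
      refine sub_mem ?_ ?_
      · have := lie_mem_yPart (Submodule.subset_span ha) ihb
        rwa [show d + (i + e) = i + (d + e) by omega] at this
      · have := lie_mem_yPart (Submodule.subset_span hb) iha
        rwa [show e + (i + d) = i + (d + e) by omega] at this
  exact h ha

theorem ihara_mem_yPart {i j : ℕ} {f g : FreeL} (hf : f ∈ yPart i) (hg : g ∈ yPart j) :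
    ihara f g ∈ yPart (i + j) := by
  rw [ihara_apply]
  refine sub_mem (add_mem (lie_mem_yPart hf hg) (D_mem_yPart hf hg)) ?_
  rw [Nat.add_comm]
  exact D_mem_yPart hg hf

theorem depth_anti {i j : ℕ} (h : i ≤ j) : depth j ≤ depth i :=
  iSup₂_le fun l hl => le_iSup₂_of_le l (h.trans hl) le_rfl

theorem ihara_mem_depth {i j : ℕ} {f g : FreeL} (hf : f ∈ depth i) (hg : g ∈ depth j) :
    ihara f g ∈ depth (i + j) := by
  have h1 : ∀ a, i ≤ a → ∀ f ∈ yPart a ⊓ (lcs 0).toSubmodule, ∀ g ∈ depth j,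
      ihara f g ∈ depth (i + j) := by
    intro a ha f hf g hg
    have h : depth j ≤ (depth (i + j)).comap (ihara f) := by
      refine iSup₂_le fun b hb g hg => ?_
      refine (le_iSup₂_of_le (a + b) (by omega) le_rfl :
        yPart (a + b) ⊓ (lcs 0).toSubmodule ≤ depth (i + j)) ⟨ihara_mem_yPart hf.1 hg.1, ?_⟩
      have := ihara_mem (i := 0) (j := 0) hf.2 hg.2
      exact this
    exact h hg
  have h : depth i ≤ (depth (i + j)).comap (ihara.flip g) :=
    iSup₂_le fun a ha f hf => h1 a ha f hf g hg
  exact h hf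

theorem mem_depth_one {f : FreeL} (hf : f ∈ lcs 0) : f ∈ depth 1 := by
  have hx : IsMonomial x 0 := .x
  have hy : IsMonomial y 1 := .y
  have stab : ∀ u d, IsMonomial u d →
      depth 1 ≤ (depth 1).comap (LieModule.toEnd ℂ FreeL FreeL u) := by
    intro u d hu
    refine iSup₂_le fun b hb g hg => ?_
    exact (le_iSup₂_of_le (d + b) (by omega) le_rfl :
        yPart (d + b) ⊓ (lcs 0).toSubmodule ≤ depth 1)
      ⟨lie_mem_yPart (Submodule.subset_span hu) hg.1, lie_mem_zero u g⟩
  refine lcs_zero_induction (depth 1) ?_ (fun a _ ha => stab x 0 hx ha)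
    (fun a _ ha => stab y 1 hy ha)
    hf
  exact (le_iSup₂_of_le 1 le_rfl le_rfl : yPart 1 ⊓ (lcs 0).toSubmodule ≤ depth 1)
    ⟨Submodule.subset_span (hx.lie hy), lie_mem_zero x y⟩

theorem depthL1_anti {i j : ℕ} (h : i ≤ j) : depthL1 j ≤ depthL1 i :=
  Submodule.map_mono (Submodule.comap_mono (depth_anti h))

theorem depthGrX_anti (S : Submodule ℂ (GrL 0)) (k : ℕ) {i j : ℕ} (h : i ≤ j) :
    depthGrX S k j ≤ depthGrX S k i :=
  Submodule.map_mono (Submodule.comap_mono (depthL1_anti h))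

theorem act_mem_depthL1 {i : ℕ} (σ : GrL 0) {m : GrL 1} (hm : m ∈ depthL1 i) :
    act σ m ∈ depthL1 (1 + i) := by
  obtain ⟨f, rfl⟩ := Submodule.mkQ_surjective _ σ
  obtain ⟨m, hm, rfl⟩ := hm
  exact ⟨⟨ihara f.1 m.1, ihara_mem f.2 m.2⟩, ihara_mem_depth (mem_depth_one f.2) hm, rfl⟩

theorem Mmin_le_depthGrX (S : Submodule ℂ (GrL 0)) (k : ℕ) : Mmin S k ≤ depthGrX S k (k + 2) := by
  induction k with
  | zero =>
    refine Submodule.span_le.2 ?_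
    rintro _ ⟨f, g, _, _, rfl⟩
    exact ⟨⟨brk f g, Submodule.mem_top⟩, ⟨⟨ihara f.1 g.1, ihara_mem_one f.2 g.2⟩,
      ihara_mem_depth (i := 1) (j := 1) (mem_depth_one f.2) (mem_depth_one g.2), rfl⟩, rfl⟩
  | succ k ih =>
    refine iSup_le fun s => ?_
    rw [Submodule.map_le_iff_le_comap]
    intro c hc
    obtain ⟨m, hm, rfl⟩ := ih hc
    have h := act_mem_depthL1 s.1 (show m.1 ∈ depthL1 (k + 2) from hm)
    rw [show 1 + (k + 2) = k + 1 + 2 by omega] at h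
    exact ⟨mulX S k s m, h, rfl⟩

theorem isPure_of_le_sSpan (hS : Sig ≤ sSpan) (k : ℕ) : IsPure (depthMmin Sig k) (k + 2) := by
  refine fun i => ⟨fun hi => ?_, fun hi => ?_⟩
  · rw [eq_top_iff]
    rintro ⟨c, hc⟩ _
    exact depthGrX_anti Sig k hi (Mmin_le_depthGrX Sig k hc)
  · rw [eq_bot_iff]
    rintro ⟨c, hc⟩ hd
    exact Subtype.ext (eq_zero_of_mem_depth hS hi hc hd)

/-! ### Substitution of matrices -/

theorem matrix_lie_smul {n : Type*} [Fintype n] [DecidableEq n] (r : PA) (A B : Matrix n n PA) :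
    ⁅A, r • B⁆ = r • ⁅A, B⁆ := by
  rw [Ring.lie_def, Ring.lie_def, Matrix.mul_smul, Matrix.smul_mul, smul_sub]

/-- If `⁅A, B⁆` is an eigenvector of `ad A` and `ad B` then `ψ(A, B)` is given by the class of `ψ`
modulo `lcs 1`. -/
theorem subst_eq_smul {n : Type*} [Fintype n] [DecidableEq n] {A B : Matrix n n PA} {s t : PA}
    (hA : ⁅A, ⁅A, B⁆⁆ = s • ⁅A, B⁆) (hB : ⁅B, ⁅A, B⁆⁆ = t • ⁅A, B⁆) {ψ : FreeL} {p : PB}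
    (h : ψ - nu p ∈ lcs 1) : subst A B ψ = ev s t p • ⁅A, B⁆ := by
  have h0 : ∀ u ∈ lcs 0, ∃ r : PA, subst A B u = r • ⁅A, B⁆ := by
    intro u hu
    let P : Submodule ℂ FreeL :=
      { carrier := {u | ∃ r : PA, subst A B u = r • ⁅A, B⁆}
        zero_mem' := ⟨0, by rw [map_zero, zero_smul]⟩
        add_mem' := by
          rintro u v ⟨r, h⟩ ⟨r', h'⟩
          exact ⟨r + r', by rw [map_add, h, h', add_smul]⟩
        smul_mem' := by
          rintro z u ⟨r, h⟩
          exact ⟨z • r, by rw [map_smul, h, smul_assoc]⟩ }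
    refine lcs_zero_induction P ⟨1, ?_⟩ ?_ ?_ hu
    · rw [LieHom.map_lie, subst_x, subst_y, one_smul]
    · rintro u _ ⟨r, h⟩
      exact ⟨r * s, by rw [LieHom.map_lie, subst_x, h, matrix_lie_smul, hA, smul_smul]⟩
    · rintro u _ ⟨r, h⟩
      exact ⟨r * t, by rw [LieHom.map_lie, subst_y, h, matrix_lie_smul, hB, smul_smul]⟩
  have h1 : ∀ u ∈ lcs 1, subst A B u = 0 := fun u hu => by
    refine lcs_succ_induction (LinearMap.ker (subst A B : FreeL →ₗ[ℂ] Matrix n n PA))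
      (fun u hu v hv => ?_) hu
    change subst A B ⁅u, v⁆ = 0
    obtain ⟨r, h⟩ := h0 u hu
    obtain ⟨r', h'⟩ := h0 v hv
    rw [LieHom.map_lie, h, h', matrix_lie_smul, ← lie_skew, matrix_lie_smul, lie_self, smul_zero,
      neg_zero, smul_zero]
  have e : subst A B ψ = subst A B (nu p) := by
    rw [← sub_eq_zero, ← map_sub]
    exact h1 _ h
  rw [e]
  have key := map_nu_of_scalar (subst A B : FreeL →ₗ[ℂ] Matrix n n PA) s t (fun u hu => ?_)
    (fun u hu => ?_) p
  · refine key.trans ?_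
    change _ • subst A B ⁅x, y⁆ = _
    rw [LieHom.map_lie, subst_x, subst_y]
  · obtain ⟨r, h⟩ := h0 u hu
    change subst A B ⁅x, u⁆ = s • subst A B u
    rw [LieHom.map_lie, subst_x, h, matrix_lie_smul, hA, smul_comm]
  · obtain ⟨r, h⟩ := h0 u hu
    change subst A B ⁅y, u⁆ = t • subst A B u
    rw [LieHom.map_lie, subst_y, h, matrix_lie_smul, hB, smul_comm]

/-- Triangular two by two matrices. -/
def tri (u a : PA) : Matrix (Fin 2) (Fin 2) PA := !![u, a; 0, 0]

theorem tri_lie (u a v b : PA) : ⁅tri u a, tri v b⁆ = tri 0 (u * b - v * a) := by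
  rw [Ring.lie_def]
  ext1 i j
  fin_cases i <;> fin_cases j <;> simp [tri, Matrix.mul_apply]
  ring

theorem smul_tri (r u a : PA) : r • tri u a = tri (r * u) (r * a) := by
  ext1 i j
  fin_cases i <;> fin_cases j <;> simp [tri]

theorem subst_tri (u a v b : PA) {ψ : FreeL} {p : PB} (h : ψ - nu p ∈ lcs 1) :
    subst (tri u a) (tri v b) ψ = tri 0 (ev u v p * (u * b - v * a)) := by
  rw [subst_eq_smul (s := u) (t := v) ?_ ?_ h, tri_lie, smul_tri, mul_zero]
  all_goals
    rw [tri_lie, tri_lie, smul_tri]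
    congr 1 <;> ring

theorem ev_pl (p : PB) (u v : PA) : pl u v 0 0 (ev X₁ Y₁ p) = ev u v p := by
  have h : (pl u v 0 0).comp (ev X₁ Y₁) = ev u v := by
    apply MvPolynomial.algHom_ext
    intro i
    fin_cases i <;> simp
  exact congrArg (fun F : PB →ₐ[ℂ] PA => F p) h

/-! ### Antisymmetry and the hexagon on the polynomial of an element of `grt_1` -/

section
variable {ψ : FreeL} (hψ : IsGrt ψ) {p : PB} (hp : ψ - nu p ∈ lcs 1)
include hψ hp

theorem IsGrt.ev_symm (u v : PA) : ev v u p = ev u v p := by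
  have h := congrArg (subst (tri X₁ 0) (tri Y₁ 1)) hψ.antisymm
  rw [map_neg, subst_comp, subst_comp, subst_x, subst_y, subst_tri _ _ _ _ hp,
    subst_tri _ _ _ _ hp] at h
  have h2 := congrFun (congrFun h 0) 1
  simp only [tri, Matrix.neg_apply, Matrix.cons_val, Matrix.of_apply] at h2
  have h3 : ev Y₁ X₁ p = ev X₁ Y₁ p := by
    apply mul_left_cancel₀ (X_ne_zero 0 : X₁ ≠ 0)
    linear_combination -h2
  have h4 := congrArg (pl u v 0 0) h3
  rw [ev_pl] at h4
  rw [← h4, ← ev_pl p v u]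
  have e : (pl v u 0 0).comp (ev X₁ Y₁) = (pl u v 0 0).comp (ev Y₁ X₁) := by
    apply MvPolynomial.algHom_ext
    intro i
    fin_cases i <;> simp
  exact congrArg (fun F : PB →ₐ[ℂ] PA => F p) e

theorem IsGrt.ev_special (u v w : PA) (hw : u + v + w = 0) : v * ev u v p = w * ev u w p := by
  have h := congrArg (subst (tri X₁ 0) (tri Y₁ 1)) hψ.special
  have hz : subst (tri X₁ 0) (tri Y₁ 1) (-x - y) = tri (-X₁ - Y₁) (-1) := by
    rw [map_sub, map_neg, subst_x, subst_y]
    ext1 i j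
    fin_cases i <;> fin_cases j <;> simp [tri]
  rw [map_zero, map_add, LieHom.map_lie, LieHom.map_lie, subst_comp, subst_comp, hz, subst_x,
    subst_y, subst_tri _ _ _ _ hp, subst_tri _ _ _ _ hp, tri_lie, tri_lie] at h
  have h2 := congrFun (congrFun h 0) 1
  simp only [tri, Matrix.add_apply, Matrix.zero_apply, Matrix.cons_val, Matrix.of_apply] at h2
  have h3 : Y₁ * ev X₁ Y₁ p = (-X₁ - Y₁) * ev X₁ (-X₁ - Y₁) p := by
    apply mul_left_cancel₀ (X_ne_zero 0 : X₁ ≠ 0)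
    linear_combination h2
  have h4 := congrArg (pl u v 0 0) h3
  have e : (pl u v 0 0).comp (ev X₁ (-X₁ - Y₁)) = ev u w := by
    apply MvPolynomial.algHom_ext
    intro i
    fin_cases i
    · simp
    · simp
      linear_combination -hw
  have e' : pl u v 0 0 (ev X₁ (-X₁ - Y₁) p) = ev u w p :=
    congrArg (fun F : PB →ₐ[ℂ] PA => F p) e
  rw [map_mul, map_mul, ev_pl, e'] at h4
  simp only [pl_X₁, pl_Y₁, map_sub, map_neg] at h4
  rw [h4]
  congr 1
  linear_combination -hw

end

/-! ### A representation of the Lie algebra of infinitesimal braids -/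

/-- The vectors and covectors of the representation. -/
def gv (T : Fin 4 → PA) (i j : Fin 4) : Fin 4 → PA := T i • Pi.single j 1 - T j • Pi.single i 1
def gf (i j : Fin 4) : Fin 4 → PA := Pi.single i 1 - Pi.single j 1

/-- The image of `t_{ij}` in the representation with parameters `T`. -/
def gm (T : Fin 4 → PA) (i j : Fin 4) : Matrix (Fin 4) (Fin 4) PA :=
  Matrix.vecMulVec (gv T i j) (gf i j)

theorem gm_mul (T : Fin 4 → PA) (i j k l : Fin 4) :
    gm T i j * gm T k l = (gf i j ⬝ᵥ gv T k l) • Matrix.vecMulVec (gv T i j) (gf k l) := by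
  rw [gm, gm, Matrix.vecMulVec_mul_vecMulVec]
  ext1 r s
  simp [Matrix.vecMulVec_apply]
  ring

theorem gm_symm (T : Fin 4 → PA) (i j : Fin 4) : gm T i j = gm T j i := by
  ext1 r s
  simp [gm, gv, gf, Matrix.vecMulVec_apply]
  ring

theorem gf_dot (T : Fin 4 → PA) (i j k l : Fin 4) : gf i j ⬝ᵥ gv T k l =
    T k * (Pi.single (M := fun _ => PA) i 1 l - Pi.single (M := fun _ => PA) j 1 l)
      - T l * (Pi.single (M := fun _ => PA) i 1 k - Pi.single (M := fun _ => PA) j 1 k) := by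
  simp [gf, gv, sub_dotProduct, dotProduct_sub, dotProduct_smul]

theorem gm_comm (T : Fin 4 → PA) {i j k l : Fin 4} (h₂ : i ≠ k) (h₃ : i ≠ l) (h₄ : j ≠ k)
    (h₅ : j ≠ l) : ⁅gm T i j, gm T k l⁆ = 0 := by
  rw [Ring.lie_def, gm_mul, gm_mul, gf_dot, gf_dot]
  simp [Pi.single_apply, h₂, h₃, h₄, h₅, h₂.symm, h₃.symm, h₄.symm, h₅.symm]

theorem gm_triple (T : Fin 4 → PA) {i j k : Fin 4} (h₁ : i ≠ j) (h₂ : i ≠ k) (h₃ : j ≠ k) :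
    ⁅gm T i j, gm T i k + gm T j k⁆ = 0 := by
  rw [Ring.lie_def, Matrix.mul_add, Matrix.add_mul, gm_mul, gm_mul, gm_mul, gm_mul, gf_dot, gf_dot,
    gf_dot, gf_dot]
  simp only [Pi.single_apply, h₁, h₂, h₃, h₁.symm, h₂.symm, h₃.symm, if_true, if_false]
  ext1 r s
  simp [gv, gf, Matrix.vecMulVec_apply]
  ring

/-- The representation on the free Lie algebra. -/
def gRep (T : Fin 4 → PA) :
    FreeLieAlgebra ℂ (Fin 4 × Fin 4) →ₗ⁅ℂ⁆ Matrix (Fin 4) (Fin 4) PA :=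
  FreeLieAlgebra.lift ℂ (fun i => gm T i.1 i.2)

theorem gRep_tGen (T : Fin 4 → PA) (i j : Fin 4) : gRep T (tGen i j) = gm T i j :=
  FreeLieAlgebra.lift_of_apply _ _

theorem gRep_of_mem (T : Fin 4 → PA) {u : FreeLieAlgebra ℂ (Fin 4 × Fin 4)} (hu : u ∈ braidIdeal) :
    gRep T u = 0 := by
  have h : braidIdeal ≤ (gRep T).ker := by
    refine LieSubmodule.lieSpan_le.2 ?_
    rintro u (⟨i⟩ | ⟨i, j⟩ | ⟨i, j, k, l, h1, h2, h3, h4, h5, h6⟩ | ⟨i, j, k, h1, h2, h3⟩)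
    all_goals refine LieHom.mem_ker.2 ?_
    · rw [gRep_tGen]
      ext1 r s
      simp [gm, gv, gf, Matrix.vecMulVec_apply]
    · rw [map_sub, gRep_tGen, gRep_tGen, gm_symm, sub_self]
    · rw [LieHom.map_lie, gRep_tGen, gRep_tGen, gm_comm T h2 h3 h4 h5]
    · rw [LieHom.map_lie, map_add, gRep_tGen, gRep_tGen, gRep_tGen, gm_triple T h1 h2 h3]
  exact LieHom.mem_ker.1 (h hu)

/-- The projection to the Lie algebra of infinitesimal braids. -/
def braidMk : FreeLieAlgebra ℂ (Fin 4 × Fin 4) →ₗ⁅ℂ⁆ Braid4 where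
  toLinearMap := (LieSubmodule.Quotient.mk' braidIdeal : _ →ₗ[ℂ] Braid4)
  map_lie' {a b} := LieSubmodule.Quotient.mk_bracket _ a b

theorem braidMk_tGen (i j : Fin 4) : braidMk (tGen i j) = t i j := rfl

theorem IsGrt.pentagon_gm {ψ : FreeL} (hψ : IsGrt ψ) (T : Fin 4 → PA) :
    subst (gm T 0 1) (gm T 1 2 + gm T 1 3) ψ + subst (gm T 0 2 + gm T 1 2) (gm T 2 3) ψ =
      subst (gm T 1 2) (gm T 2 3) ψ + subst (gm T 0 1 + gm T 0 2) (gm T 1 3 + gm T 2 3) ψ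
        + subst (gm T 0 1) (gm T 1 2) ψ := by
  have h := hψ.pentagon
  simp only [← braidMk_tGen, ← map_add, ← subst_comp] at h
  rw [← sub_eq_zero, ← map_sub] at h
  have h2 := gRep_of_mem T ((LieSubmodule.Quotient.mk_eq_zero _).1 h)
  rw [map_sub, sub_eq_zero] at h2
  simpa only [map_add, subst_comp, gRep_tGen] using h2

/-! ### The consequence of the pentagon -/

/-- A property of all values of substitutions is checked on the arguments. -/
theorem subst_induction {K : Type*} [LieRing K] [LieAlgebra ℂ K] (S : LieSubalgebra ℂ K) {a b : K}
    (ha : a ∈ S) (hb : b ∈ S) (u : FreeL) : subst a b u ∈ S := by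
  refine eq_top_of_gen (S.comap (subst a b)) ?_ ?_ u
  · change subst a b x ∈ S; rwa [subst_x]
  · change subst a b y ∈ S; rwa [subst_y]

/-- Matrices whose last column vanishes above the diagonal. -/
theorem subst_last_col {A B : Matrix (Fin 4) (Fin 4) PA} (hA : ∀ r, r ≠ 3 → A r 3 = 0)
    (hB : ∀ r, r ≠ 3 → B r 3 = 0) (u : FreeL) : ∀ r, r ≠ 3 → subst A B u r 3 = 0 := by
  let S : LieSubalgebra ℂ (Matrix (Fin 4) (Fin 4) PA) :=
    { carrier := {M | ∀ r, r ≠ 3 → M r 3 = 0}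
      zero_mem' := fun r _ => rfl
      add_mem' := fun {M N} hM hN r hr => by rw [Matrix.add_apply, hM r hr, hN r hr, add_zero]
      smul_mem' := fun z M hM r hr => by rw [Matrix.smul_apply, hM r hr, smul_zero]
      lie_mem' := fun {M N} hM hN r hr => by
        rw [Ring.lie_def, Matrix.sub_apply, Matrix.mul_apply, Matrix.mul_apply, Fin.sum_univ_four,
          Fin.sum_univ_four, hM r hr, hN r hr, hM 0 (by decide), hM 1 (by decide),
          hM 2 (by decide), hN 0 (by decide), hN 1 (by decide), hN 2 (by decide)]
        ring }
  exact subst_induction S hA hB u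

theorem subst_corner {A B : Matrix (Fin 4) (Fin 4) PA} (hA : ∀ r, r ≠ 3 → A r 3 = 0)
    (hB : ∀ r, r ≠ 3 → B r 3 = 0) {u : FreeL} (hu : u ∈ lcs 0) : subst A B u 3 3 = 0 := by
  have key : ∀ u v, subst A B ⁅u, v⁆ 3 3 = 0 := fun u v => by
    have h1 := subst_last_col hA hB u
    have h2 := subst_last_col hA hB v
    rw [LieHom.map_lie, Ring.lie_def, Matrix.sub_apply, Matrix.mul_apply, Matrix.mul_apply,
      Fin.sum_univ_four, Fin.sum_univ_four, h1 0 (by decide), h1 1 (by decide), h1 2 (by decide),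
      h2 0 (by decide), h2 1 (by decide), h2 2 (by decide)]
    ring
  let P : Submodule ℂ FreeL :=
    LinearMap.ker ((Matrix.entryLinearMap ℂ PA (3 : Fin 4) (3 : Fin 4)) ∘ₗ
    (subst A B : FreeL →ₗ[ℂ] Matrix (Fin 4) (Fin 4) PA))
  have key' : ∀ u v, ⁅u, v⁆ ∈ P := key
  exact lcs_zero_induction P (key' _ _) (fun a _ _ => key' _ _) (fun a _ _ => key' _ _) hu

/-- The last coordinate contributes nothing to the first three rows of a product, because the last
column vanishes there; changes in the last row are therefore invisible in them. -/
theorem subst_rows_eq {A B A' B' : Matrix (Fin 4) (Fin 4) PA} (hA : ∀ r, r ≠ 3 → A r 3 = 0)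
    (hB : ∀ r, r ≠ 3 → B r 3 = 0) (hA' : ∀ r, r ≠ 3 → ∀ s, A' r s = A r s)
    (hB' : ∀ r, r ≠ 3 → ∀ s, B' r s = B r s) (u : FreeL) :
    ∀ r, r ≠ 3 → ∀ s, subst A' B' u r s = subst A B u r s := by
  have h1 := subst_last_col hA hB
  have h2 := subst_last_col (A := A') (B := B') (fun r hr => by rw [hA' r hr, hA r hr])
    (fun r hr => by rw [hB' r hr, hB r hr])
  let S : LieSubalgebra ℂ FreeL :=
    { carrier := {u | ∀ r, r ≠ 3 → ∀ s, subst A' B' u r s = subst A B u r s}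
      zero_mem' := fun r _ s => by rw [map_zero, map_zero]
      add_mem' := fun {u v} hu hv r hr s => by
        rw [map_add, map_add, Matrix.add_apply, Matrix.add_apply, hu r hr, hv r hr]
      smul_mem' := fun z u hu r hr s => by
        rw [map_smul, map_smul, Matrix.smul_apply, Matrix.smul_apply, hu r hr]
      lie_mem' := fun {u v} hu hv r hr s => by
        have e1 : (0 : Fin 4) ≠ 3 := by decide
        have e2 : (1 : Fin 4) ≠ 3 := by decide
        have e3 : (2 : Fin 4) ≠ 3 := by decide
        rw [LieHom.map_lie, LieHom.map_lie, Ring.lie_def, Ring.lie_def, Matrix.sub_apply,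
          Matrix.sub_apply, Matrix.mul_apply, Matrix.mul_apply, Matrix.mul_apply, Matrix.mul_apply,
          Fin.sum_univ_four, Fin.sum_univ_four, Fin.sum_univ_four, Fin.sum_univ_four,
          h1 u r hr, h1 v r hr, h2 u r hr, h2 v r hr]
        rw [hu r hr, hu r hr, hu r hr, hv r hr, hv r hr, hv r hr, hu 0 e1, hu 1 e2, hu 2 e3,
          hv 0 e1, hv 1 e2, hv 2 e3]
        ring }
  exact eq_top_of_gen S (fun r hr s => by rw [subst_x, subst_x, hA' r hr])
    (fun r hr s => by rw [subst_y, subst_y, hB' r hr]) u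

/-- The parameters `-a, -b, -c, 0`. -/
def par (a b c : PA) : Fin 4 → PA := ![-a, -b, -c, 0]

section
variable (a b c : PA)

theorem gm_par01 : gm (par a b c) 0 1 = !![b, -b, 0, 0; -a, a, 0, 0; 0, 0, 0, 0; 0, 0, 0, 0] := by
  ext1 r s
  fin_cases r <;> fin_cases s <;> simp [gm, gv, gf, par, Matrix.vecMulVec_apply]

theorem gm_par02 : gm (par a b c) 0 2 = !![c, 0, -c, 0; 0, 0, 0, 0; -a, 0, a, 0; 0, 0, 0, 0] := by
  ext1 r s
  fin_cases r <;> fin_cases s <;> simp [gm, gv, gf, par, Matrix.vecMulVec_apply]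

theorem gm_par12 : gm (par a b c) 1 2 = !![0, 0, 0, 0; 0, c, -c, 0; 0, -b, b, 0; 0, 0, 0, 0] := by
  ext1 r s
  fin_cases r <;> fin_cases s <;> simp [gm, gv, gf, par, Matrix.vecMulVec_apply]

theorem gm_par13 : gm (par a b c) 1 3 = !![0, 0, 0, 0; 0, 0, 0, 0; 0, 0, 0, 0; 0, -b, 0, b] := by
  ext1 r s
  fin_cases r <;> fin_cases s <;> simp [gm, gv, gf, par, Matrix.vecMulVec_apply]

theorem gm_par23 : gm (par a b c) 2 3 = !![0, 0, 0, 0; 0, 0, 0, 0; 0, 0, 0, 0; 0, 0, -c, c] := by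
  ext1 r s
  fin_cases r <;> fin_cases s <;> simp [gm, gv, gf, par, Matrix.vecMulVec_apply]

/-- Matrices supported on the last row. -/
def lastRow (u v w : PA) : Matrix (Fin 4) (Fin 4) PA :=
  !![0, 0, 0, 0; 0, 0, 0, 0; 0, 0, 0, 0; u, v, w, 0]

theorem smul_lastRow (r u v w : PA) : r • lastRow u v w = lastRow (r * u) (r * v) (r * w) := by
  ext1 i j
  fin_cases i <;> fin_cases j <;> simp [lastRow]

theorem lie_pent1 : ⁅gm (par a b c) 1 2, gm (par a b c) 2 3⁆ = lastRow 0 (-(b * c)) (b * c) := by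
  rw [gm_par12, gm_par23, Ring.lie_def]
  ext1 i j
  fin_cases i <;> fin_cases j <;>
    simp [lastRow, Matrix.mul_apply, Fin.sum_univ_four, mul_comm]

theorem lie_pent2 : ⁅gm (par a b c) 0 2 + gm (par a b c) 1 2, gm (par a b c) 2 3⁆ =
    lastRow (-(a * c)) (-(b * c)) ((a + b) * c) := by
  rw [gm_par02, gm_par12, gm_par23, Ring.lie_def]
  ext1 i j
  fin_cases i <;> fin_cases j <;>
    simp [lastRow, Matrix.mul_apply, Fin.sum_univ_four] <;> ring

theorem lie_pent3 : ⁅gm (par a b c) 0 1 + gm (par a b c) 0 2,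
    gm (par a b c) 1 3 + gm (par a b c) 2 3⁆ =
      lastRow (-(a * (b + c))) (a * b) (a * c) := by
  rw [gm_par01, gm_par02, gm_par13, gm_par23, Ring.lie_def]
  ext1 i j
  fin_cases i <;> fin_cases j <;>
    simp [lastRow, Matrix.mul_apply, Fin.sum_univ_four] <;> ring

variable {ψ : FreeL} {p : PB} (hp : ψ - nu p ∈ lcs 1)
include hp

theorem subst_pent1 : subst (gm (par a b c) 1 2) (gm (par a b c) 2 3) ψ =
    ev (-(b + c)) c p • lastRow 0 (-(b * c)) (b * c) := by
  rw [subst_eq_smul (s := -(b + c)) (t := c) ?_ ?_ hp, lie_pent1]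
  · rw [lie_pent1, smul_lastRow, gm_par12, Ring.lie_def]
    ext1 i j
    fin_cases i <;> fin_cases j <;>
      simp [lastRow, Matrix.mul_apply, Fin.sum_univ_four] <;> ring
  · rw [lie_pent1, smul_lastRow, gm_par23, Ring.lie_def]
    ext1 i j
    fin_cases i <;> fin_cases j <;>
      simp [lastRow, Matrix.mul_apply, Fin.sum_univ_four]

theorem subst_pent2 :
    subst (gm (par a b c) 0 2 + gm (par a b c) 1 2) (gm (par a b c) 2 3) ψ =
    ev (-(a + b + c)) c p • lastRow (-(a * c)) (-(b * c)) ((a + b) * c) := by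
  rw [subst_eq_smul (s := -(a + b + c)) (t := c) ?_ ?_ hp, lie_pent2]
  · rw [lie_pent2, smul_lastRow, gm_par02, gm_par12, Ring.lie_def]
    ext1 i j
    fin_cases i <;> fin_cases j <;>
      simp [lastRow, Matrix.mul_apply, Fin.sum_univ_four] <;> ring
  · rw [lie_pent2, smul_lastRow, gm_par23, Ring.lie_def]
    ext1 i j
    fin_cases i <;> fin_cases j <;>
      simp [lastRow, Matrix.mul_apply, Fin.sum_univ_four]

theorem subst_pent3 :
    subst (gm (par a b c) 0 1 + gm (par a b c) 0 2) (gm (par a b c) 1 3 + gm (par a b c) 2 3) ψ =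
    ev (-(a + b + c)) (b + c) p • lastRow (-(a * (b + c))) (a * b) (a * c) := by
  rw [subst_eq_smul (s := -(a + b + c)) (t := b + c) ?_ ?_ hp, lie_pent3]
  · rw [lie_pent3, smul_lastRow, gm_par01, gm_par02, Ring.lie_def]
    ext1 i j
    fin_cases i <;> fin_cases j <;>
      simp [lastRow, Matrix.mul_apply, Fin.sum_univ_four] <;> ring
  · rw [lie_pent3, smul_lastRow, gm_par13, gm_par23, Ring.lie_def]
    ext1 i j
    fin_cases i <;> fin_cases j <;>
      simp [lastRow, Matrix.mul_apply, Fin.sum_univ_four]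

/-- The lower right entry of `ψ(t₀₁, t₁₂)`. -/
theorem IsGrt.entry (hψ : IsGrt ψ) (h0 : ψ ∈ lcs 0) (hc : c ≠ 0) :
    subst (gm (par a b c) 0 1) (gm (par a b c) 1 2) ψ 2 2 =
      b * c * ev (-(b + c)) c p + a * c * ev (-(a + b + c)) (b + c) p
        - (a + b) * c * ev (-(a + b + c)) c p := by
  have hA : ∀ r, r ≠ 3 → gm (par a b c) 0 1 r 3 = 0 := fun r _ => by
    rw [gm_par01]; fin_cases r <;> rfl
  have hB : ∀ r, r ≠ 3 → gm (par a b c) 1 2 r 3 = 0 := fun r _ => by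
    rw [gm_par12]; fin_cases r <;> rfl
  -- Since the last parameter is zero, the image of `t 1 3` lives on the last row. Hence `ψ(t₀₁, t₁₂
  -- + t₁₃)` and `ψ(t₀₁, t₁₂)` agree on the first three rows.
  have hD : ∀ r, r ≠ 3 → ∀ s, (gm (par a b c) 1 2 + gm (par a b c) 1 3) r s =
      gm (par a b c) 1 2 r s := fun r hr s => by
    rw [Matrix.add_apply, gm_par13]
    fin_cases r
    · fin_cases s <;> simp
    · fin_cases s <;> simp
    · fin_cases s <;> simp
    · exact absurd rfl hr
  have hB' : ∀ r, r ≠ 3 → (gm (par a b c) 1 2 + gm (par a b c) 1 3) r 3 = 0 := fun r hr => by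
    rw [hD r hr, hB r hr]
  have hrow := subst_rows_eq hA hB (fun r _ s => rfl) hD ψ
  have hcol := subst_last_col hA hB' ψ
  have hcor := subst_corner hA hB' h0
  -- Commutation with `t 2 3` identifies the entries `(3, 2)` and `(2, 2)` of `ψ(t₀₁, t₁₂ + t₁₃)`.
  -- The first is given by the pentagon, the second is the entry sought.
  have hcomm : ⁅gm (par a b c) 2 3,
      subst (gm (par a b c) 0 1) (gm (par a b c) 1 2 + gm (par a b c) 1 3) ψ⁆ = 0 := by
    refine lie_subst_eq_zero (gm_comm _ (by decide) (by decide) (by decide) (by decide)) ?_ ψ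
    rw [gm_symm _ 1 2, gm_symm _ 1 3]
    exact gm_triple _ (by decide) (by decide) (by decide)
  have hpent := congrFun (congrFun (hψ.pentagon_gm (par a b c)) 3) 2
  rw [subst_pent1 a b c hp, subst_pent2 a b c hp, subst_pent3 a b c hp] at hpent
  have hM : subst (gm (par a b c) 0 1) (gm (par a b c) 1 2) ψ 3 2 = 0 := by
    let S : LieSubalgebra ℂ (Matrix (Fin 4) (Fin 4) PA) :=
      { carrier := {M | ∀ s, M 3 s = 0}
        zero_mem' := fun s => rfl
        add_mem' := fun {M N} hM hN s => by rw [Matrix.add_apply, hM s, hN s, add_zero]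
        smul_mem' := fun z M hM s => by rw [Matrix.smul_apply, hM s, smul_zero]
        lie_mem' := fun {M N} hM hN s => by
          have hM' : ∀ s, M 3 s = 0 := hM
          have hN' : ∀ s, N 3 s = 0 := hN
          change ⁅M, N⁆ 3 s = 0
          rw [Ring.lie_def, Matrix.sub_apply, Matrix.mul_apply, Matrix.mul_apply]
          simp [hM', hN'] }
    refine subst_induction S (fun s => ?_) (fun s => ?_) ψ 2
    · rw [gm_par01]; fin_cases s <;> rfl
    · rw [gm_par12]; fin_cases s <;> rfl
  have h2 := hrow 2 (by decide) 2
  generalize subst (gm (par a b c) 0 1) (gm (par a b c) 1 2 + gm (par a b c) 1 3) ψ = N at *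
  have h3 : N 3 2 = N 2 2 := by
    have h := congrFun (congrFun hcomm 3) 2
    rw [gm_par23, Ring.lie_def, Matrix.sub_apply, Matrix.mul_apply, Matrix.mul_apply,
      Fin.sum_univ_four, Fin.sum_univ_four, hcor] at h
    simp at h
    apply mul_left_cancel₀ hc
    linear_combination h
  rw [← h2, ← h3]
  simp only [Matrix.add_apply, Matrix.smul_apply, lastRow, hM, smul_eq_mul, Matrix.of_apply,
    Matrix.cons_val] at hpent
  linear_combination hpent

end

/-! ### The cocycle equation -/

/-- Simultaneous permutation of rows and columns. -/
def permMat (σ : Equiv.Perm (Fin 4)) :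
    Matrix (Fin 4) (Fin 4) PA →ₗ⁅ℂ⁆ Matrix (Fin 4) (Fin 4) PA where
  toFun M := M.submatrix σ σ
  map_add' _ _ := rfl
  map_smul' _ _ := rfl
  map_lie' {M N} := by
    simp only [Ring.lie_def, Matrix.submatrix_sub, Matrix.submatrix_mul_equiv]
    rfl

theorem permMat_apply (σ : Equiv.Perm (Fin 4)) (M : Matrix (Fin 4) (Fin 4) PA) (r s : Fin 4) :
    permMat σ M r s = M (σ r) (σ s) := rfl

theorem permMat_gm (σ : Equiv.Perm (Fin 4)) {T T' : Fin 4 → PA} (hT : ∀ i, T (σ i) = T' i)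
    (i j : Fin 4) : permMat σ (gm T (σ i) (σ j)) = gm T' i j := by
  ext1 r s
  rw [permMat_apply]
  simp [gm, gv, gf, Matrix.vecMulVec_apply, Pi.single_apply, hT]

theorem subst_gm_perm (σ : Equiv.Perm (Fin 4)) {T T' : Fin 4 → PA} (hT : ∀ i, T (σ i) = T' i)
    {i j k : Fin 4} (hi : σ 0 = i) (hj : σ 1 = j) (hk : σ 2 = k) (u : FreeL) :
    subst (gm T i j) (gm T j k) u k k = subst (gm T' 0 1) (gm T' 1 2) u 2 2 := by
  have h := subst_comp (permMat σ) (gm T (σ 0) (σ 1)) (gm T (σ 1) (σ 2)) u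
  rw [permMat_gm σ hT, permMat_gm σ hT] at h
  rw [← h, permMat_apply, hi, hj, hk]

theorem trace_subst {A B : Matrix (Fin 4) (Fin 4) PA} {u : FreeL} (hu : u ∈ lcs 0) :
    (subst A B u).trace = 0 := by
  let P : Submodule ℂ FreeL := LinearMap.ker ((Matrix.traceLinearMap (Fin 4) ℂ PA) ∘ₗ
    (subst A B : FreeL →ₗ[ℂ] Matrix (Fin 4) (Fin 4) PA))
  have key : ∀ u v : FreeL, ⁅u, v⁆ ∈ P := fun u v => by
    change (subst A B ⁅u, v⁆).trace = 0
    rw [LieHom.map_lie, Ring.lie_def, Matrix.trace_sub, Matrix.trace_mul_comm, sub_self]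
  exact lcs_zero_induction P (key _ _) (fun a _ _ => key _ _) (fun a _ _ => key _ _) hu

/-- The coboundary of the cochain `X Y p(X, Y)`. -/
def coc : PB →ₗ[ℂ] PA :=
  LinearMap.mulLeft ℂ (Y₁ * X₂) ∘ₗ (ev Y₁ X₂).toLinearMap
    - LinearMap.mulLeft ℂ ((X₁ + Y₁) * X₂) ∘ₗ (ev (X₁ + Y₁) X₂).toLinearMap
    + LinearMap.mulLeft ℂ (X₁ * (Y₁ + X₂)) ∘ₗ (ev X₁ (Y₁ + X₂)).toLinearMap
    - LinearMap.mulLeft ℂ (X₁ * Y₁) ∘ₗ (ev X₁ Y₁).toLinearMap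

theorem coc_apply (p : PB) : coc p = Y₁ * X₂ * ev Y₁ X₂ p - (X₁ + Y₁) * X₂ * ev (X₁ + Y₁) X₂ p
    + X₁ * (Y₁ + X₂) * ev X₁ (Y₁ + X₂) p - X₁ * Y₁ * ev X₁ Y₁ p := rfl

/-- The hypothesis `tr` is the vanishing trace of `ψ(t₀₁, t₁₂)`. By `sp`, each value such as `f (-(b
+ c)) c` becomes `-b f b c / (b + c)`, and the fractions then combine into the cocycle expression;
`hD` allows the denominators to be cleared. -/
theorem cocycle_of_trace {R : Type*} [CommRing R] [IsDomain R] {a b c : R} (f : R → R → R)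
    (sy : ∀ u v, f v u = f u v) (sp : ∀ u v w, u + v + w = 0 → v * f u v = w * f w u)
    (hD : (a + b + c) * (a + b) * (b + c) ≠ 0)
    (tr : -(b * a * f (-(b + a)) a + c * a * f (-(c + b + a)) (b + a)
          - (c + b) * a * f (-(c + b + a)) a)
      + (c * b * f (-(c + b)) b + a * b * f (-(a + c + b)) (c + b)
          - (a + c) * b * f (-(a + c + b)) b
        - (a * b * f (-(a + b)) b + c * b * f (-(c + a + b)) (a + b)
          - (c + a) * b * f (-(c + a + b)) b))
      + (b * c * f (-(b + c)) c + a * c * f (-(a + b + c)) (b + c)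
          - (a + b) * c * f (-(a + b + c)) c) = 0) :
    b * c * f b c - (a + b) * c * f (a + b) c + a * (b + c) * f a (b + c) - a * b * f a b = 0 := by
  rw [show c + b + a = a + b + c by ring, show c + a + b = a + b + c by ring,
    show a + c + b = a + b + c by ring, add_comm c b, add_comm b a] at tr
  have e1 := sp c b (-(b + c)) (by ring)
  have e2 := sp (b + c) a (-(a + b + c)) (by ring)
  have e3 := sp c (a + b) (-(a + b + c)) (by ring)
  have e4 := sp a b (-(a + b)) (by ring)
  have e5 := sp (a + b) c (-(a + b + c)) (by ring)
  have e6 := sp a (b + c) (-(a + b + c)) (by ring)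
  have e7 := sp b a (-(a + b)) (by ring)
  have e8 := sp b c (-(b + c)) (by ring)
  rw [sy b c] at e1
  rw [sy a (b + c)] at e2
  rw [sy (a + b) c] at e3
  rw [sy a b] at e7
  refine (mul_eq_zero.1 (?_ : (a + b + c) * (a + b) * (b + c) * _ = 0)).resolve_left hD
  linear_combination (-((a + b + c) * (a + b) * (b + c))) * tr
    + b * c * (a + b + c) * (a + b) * e1
    + a * (b + c) * (a + b) * (b + c) * e2
    - (a + b) * c * (a + b) * (b + c) * e3
    - a * b * (a + b + c) * (b + c) * e4
    - c * (a + b) * (a + b) * (b + c) * e5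
    + (b + c) * a * (a + b) * (b + c) * e6
    - a * b * (a + b + c) * (b + c) * e7
    + c * b * (a + b + c) * (a + b) * e8

theorem IsGrt.subst_swap {ψ : FreeL} (hψ : IsGrt ψ) (A B : Matrix (Fin 4) (Fin 4) PA) :
    subst B A ψ = -subst A B ψ := by
  have h := congrArg (subst A B) hψ.antisymm
  rwa [map_neg, subst_comp, subst_comp, subst_x, subst_y] at h

theorem subst_par_three {ψ : FreeL} (h0 : ψ ∈ lcs 0) (a b c : PA) :
    subst (gm (par a b c) 0 1) (gm (par a b c) 1 2) ψ 3 3 = 0 :=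
  subst_corner (fun r _ => by rw [gm_par01]; fin_cases r <;> simp)
    (fun r _ => by rw [gm_par12]; fin_cases r <;> simp) h0

theorem IsGrt.subst_gm_zero {ψ : FreeL} (hψ : IsGrt ψ) (T : Fin 4 → PA) :
    subst (gm T 0 1) (gm T 1 2) ψ 0 0 = -subst (gm T 2 1) (gm T 1 0) ψ 0 0 := by
  rw [hψ.subst_swap (gm T 1 2) (gm T 0 1), gm_symm T 2 1, gm_symm T 1 0, Matrix.neg_apply]

/-- In the three-term hexagon `-t₀₁ - t₁₂` may be replaced by `t₀₂`, their difference being the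
central element of the three strands. The middle diagonal entry is thus expressed by last-generator
entries after relabelling. -/
theorem IsGrt.subst_gm_one {ψ : FreeL} (hψ : IsGrt ψ) (h0 : ψ ∈ lcs 0) (T : Fin 4 → PA) :
    subst (gm T 0 1) (gm T 1 2) ψ 1 1 =
      subst (gm T 0 2) (gm T 2 1) ψ 1 1 - subst (gm T 2 0) (gm T 0 1) ψ 1 1 := by
  have c01 : ⁅gm T 0 1 + gm T 1 2 + gm T 0 2, gm T 0 1⁆ = 0 := by
    have h := gm_triple T (i := 0) (j := 1) (k := 2) (by decide) (by decide) (by decide)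
    rw [← lie_skew, add_assoc, lie_add, lie_self, zero_add, add_comm, h, neg_zero]
  have c12 : ⁅gm T 0 1 + gm T 1 2 + gm T 0 2, gm T 1 2⁆ = 0 := by
    have h := gm_triple T (i := 1) (j := 2) (k := 0) (by decide) (by decide) (by decide)
    rw [gm_symm T 1 0, gm_symm T 2 0] at h
    rw [← lie_skew, add_right_comm, lie_add, lie_self, add_zero, h, neg_zero]
  have c02 : ⁅gm T 0 1 + gm T 1 2 + gm T 0 2, gm T 0 2⁆ = 0 := by
    have h := gm_triple T (i := 0) (j := 2) (k := 1) (by decide) (by decide) (by decide)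
    rw [gm_symm T 2 1] at h
    rw [← lie_skew, lie_add, lie_self, add_zero, h, neg_zero]
  have h := congrArg (subst (gm T 0 1) (gm T 1 2)) hψ.cyclic
  have hz : subst (gm T 0 1) (gm T 1 2) (-x - y) =
      gm T 0 2 - (gm T 0 1 + gm T 1 2 + gm T 0 2) := by
    rw [map_sub, map_neg, subst_x, subst_y]; abel
  rw [map_zero, map_add, map_add, subst_comp, subst_comp, subst_comp, hz, subst_x, subst_y,
    subst_sub_central c02 c01 h0, hψ.subst_swap _ (gm T 1 2), subst_sub_central c02 c12 h0] at h
  rw [gm_symm T 2 1, gm_symm T 2 0]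
  have h' := congrFun (congrFun h 1) 1
  simp only [Matrix.add_apply, Matrix.neg_apply, Matrix.zero_apply] at h'
  linear_combination h'

/-- `IsGrt.entry` gives one diagonal entry of `ψ(t₀₁, t₁₂)`; permuting strands, with antisymmetry
and the hexagon, gives the others. The trace of a value on `[L, L]` is zero. -/
theorem IsGrt.coc_eq_zero {ψ : FreeL} (hψ : IsGrt ψ) (h0 : ψ ∈ lcs 0) {p : PB}
    (hp : ψ - nu p ∈ lcs 1) : coc p = 0 := by
  let T := par X₁ Y₁ X₂
  have E1 := hψ.entry X₁ Y₁ X₂ hp h0 (X_ne_zero _)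
  have E2 := hψ.entry X₂ Y₁ X₁ hp h0 (X_ne_zero _)
  have E3 := hψ.entry X₂ X₁ Y₁ hp h0 (X_ne_zero _)
  have E4 := hψ.entry X₁ X₂ Y₁ hp h0 (X_ne_zero _)
  have F2 := subst_gm_perm (T := T) (T' := par X₂ Y₁ X₁) (Equiv.swap 0 2)
    (fun i => by fin_cases i <;> simp [par, T, Equiv.swap_apply_def]) (i := 2) (j := 1)
      (k := 0) rfl rfl rfl ψ
  have F3 := subst_gm_perm (T := T) (T' := par X₂ X₁ Y₁) (Equiv.swap 1 2 * Equiv.swap 0 1)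
    (fun i => by fin_cases i <;> simp [par, T, Equiv.swap_apply_def]) (i := 2) (j := 0)
      (k := 1) rfl rfl rfl ψ
  have F4 := subst_gm_perm (T := T) (T' := par X₁ X₂ Y₁) (Equiv.swap 1 2)
    (fun i => by fin_cases i <;> simp [par, T, Equiv.swap_apply_def]) (i := 0) (j := 2)
      (k := 1) rfl rfl rfl ψ
  rw [E2] at F2
  rw [E3] at F3
  rw [E4] at F4
  have tr := trace_subst (A := gm T 0 1) (B := gm T 1 2) h0
  rw [Matrix.trace, Fin.sum_univ_four] at tr
  simp only [Matrix.diag_apply] at tr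
  rw [subst_par_three h0, hψ.subst_gm_zero, hψ.subst_gm_one h0, E1, F2, F3, F4] at tr
  have sp : ∀ u v w : PA, u + v + w = 0 → v * ev u v p = w * ev w u p := fun u v w hw => by
    rw [hψ.ev_special hp u v w hw, hψ.ev_symm hp u w]
  rw [coc_apply]
  exact cocycle_of_trace (fun u v => ev u v p) (hψ.ev_symm hp) sp
    (ne_zero_of_eval (fun _ => 1) (by simp; norm_num)) (by rw [← tr]; ring)

/-! ### Solutions of the cocycle equation -/

theorem pderiv_ev (i : Fin 4) (u v : PA) (r : PB) : pderiv i (ev u v r) =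
    ev u v (pderiv 0 r) * pderiv i u + ev u v (pderiv 1 r) * pderiv i v := by
  induction r using MvPolynomial.induction_on with
  | C z => simp
  | add p q hp hq => simp only [map_add, hp, hq]; ring
  | mul_X p j hp =>
    rw [map_mul, Derivation.leibniz, Derivation.leibniz, Derivation.leibniz, hp]
    fin_cases j <;> simp [pderiv_X_of_ne] <;> ring

theorem pl_ev (a b c d u v : PA) (r : PB) :
    pl a b c d (ev u v r) = ev (pl a b c d u) (pl a b c d v) r := by
  have h : (pl a b c d).comp (ev u v) = ev (pl a b c d u) (pl a b c d v) := by
    apply MvPolynomial.algHom_ext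
    intro i
    fin_cases i <;> simp
  exact congrArg (fun F : PB →ₐ[ℂ] PA => F r) h

theorem ev_injective {r : PB} (h : ev Y₁ X₂ r = 0) : r = 0 := by
  have e : ((aeval ![0, X 0, X 1, 0] : PA →ₐ[ℂ] PB)).comp (ev Y₁ X₂) = AlgHom.id ℂ PB := by
    apply MvPolynomial.algHom_ext
    intro i
    fin_cases i <;> simp
  have e' := congrArg (fun F : PB →ₐ[ℂ] PB => F r) e
  simp only [AlgHom.comp_apply, h, map_zero, AlgHom.id_apply] at e'
  exact e'.symm

theorem coeff_add_X_mul_pderiv (r : PB) (d : Fin 2 →₀ ℕ) :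
    coeff d (r + X 0 * pderiv 0 r) = (d 0 + 1) * coeff d r := by
  induction r using MvPolynomial.induction_on' with
  | monomial s a =>
    rw [X_mul_pderiv_monomial, coeff_add, coeff_smul, coeff_monomial]
    split_ifs with h
    · rw [h, nsmul_eq_mul]; ring
    · simp
  | add p q hp hq =>
    rw [map_add, mul_add, add_add_add_comm, coeff_add, hp, hq, coeff_add]; ring

/-- The derivative of the cocycle equation in its first variable at zero is `(1 + X ∂_X) r = 0` once
`r(0, ·) = 0`, and this operator multiplies the monomials of `X`-degree `i` by `i + 1`. -/
theorem eq_zero_of_coc_eq_zero {r : PB} (h : coc r = 0) (h0 : ∀ u : PA, ev 0 u r = 0) : r = 0 := by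
  have h1 := congrArg (fun c => pl 0 Y₁ X₂ 0 (pderiv 0 c)) h
  rw [coc_apply] at h1
  simp only [map_sub, map_add, Derivation.leibniz, pderiv_ev, smul_eq_mul, map_mul, pl_ev,
    pl_X₁, pl_Y₁, pl_X₂, map_zero, zero_add, h0] at h1
  simp [pderiv_X_of_ne, -aeval_eq_bind₁] at h1
  have h2 : ev Y₁ X₂ (r + X 0 * pderiv 0 r) = 0 := by
    apply mul_left_cancel₀ (X_ne_zero 2 : X₂ ≠ 0)
    rw [map_add, map_mul, aeval_X]
    simp only [Matrix.cons_val_zero]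
    linear_combination -h1
  have h3 := ev_injective h2
  ext d
  have h4 := coeff_add_X_mul_pderiv r d
  rw [h3, coeff_zero] at h4
  rw [coeff_zero]
  exact (mul_eq_zero.1 h4.symm).resolve_left (Nat.cast_add_one_ne_zero _)

theorem coc_fp {n : ℕ} (hn : 2 ≤ n) : coc (fp n) = 0 := by
  have h1 := ev_fp hn Y₁ X₂
  have h2 := ev_fp hn (X₁ + Y₁) X₂
  have h3 := ev_fp hn X₁ (Y₁ + X₂)
  have h4 := ev_fp hn X₁ Y₁
  rw [fF] at h1 h2 h3 h4
  rw [coc_apply]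
  rw [← add_assoc] at h3
  linear_combination h1 - h2 + h3 - h4

/-- The restriction of a polynomial to `X = 0`. -/
def res : PB →ₐ[ℂ] Polynomial ℂ := aeval ![0, Polynomial.X]

theorem ev_zero_eq (p : PB) (u : PA) : ev 0 u p = Polynomial.aeval u (res p) := by
  have h : (Polynomial.aeval u).comp res = ev 0 u := by
    apply MvPolynomial.algHom_ext
    intro i
    fin_cases i <;> simp [res]
  exact (congrArg (fun F : PB →ₐ[ℂ] PA => F p) h).symm

theorem res_fp (m : ℕ) : res (fp (m + 2)) = Polynomial.C ((m : ℂ) + 2) * Polynomial.X ^ m := by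
  rw [fp, map_sum, Finset.sum_eq_single_of_mem 0 (by simp)]
  · simp [res, map_ofNat]
  · intro i _ hi
    simp [res, hi]

/-- A solution of the cocycle equation is determined by its restriction to `X = 0`, and the `fp (m +
2)` realize every monomial there. Their restriction is `(m + 2) X^m`, hence the coefficients. -/
theorem IsGrt.exists_sum {ψ : FreeL} (hψ : IsGrt ψ) (h0 : ψ ∈ lcs 0) {p : PB}
    (hp : ψ - nu p ∈ lcs 1) : ∃ g : Polynomial ℂ, (∀ m, Even m → g.coeff m = 0) ∧
      p = ∑ m ∈ g.support, (g.coeff m / (m + 2)) • fp (m + 2) := by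
  refine ⟨res p, fun m hm => ?_, ?_⟩
  · have h := hψ.ev_special hp 0 X₁ (-X₁) (by ring)
    rw [ev_zero_eq, ev_zero_eq] at h
    have h' : Polynomial.aeval X₁ (res p +
        (res p).comp (Polynomial.C (-1) * Polynomial.X)) = 0 := by
      rw [map_add, Polynomial.aeval_comp, map_mul, Polynomial.aeval_X, Polynomial.aeval_C, map_neg,
        map_one, neg_one_mul]
      apply mul_left_cancel₀ (X_ne_zero 0 : X₁ ≠ 0)
      linear_combination h
    have hi : ∀ q : Polynomial ℂ, Polynomial.aeval X₁ q = 0 → q = 0 := fun q hq => by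
      have e : (aeval (fun _ => Polynomial.X) : PA →ₐ[ℂ] Polynomial ℂ).comp (Polynomial.aeval X₁) =
          AlgHom.id ℂ _ := by
        apply Polynomial.algHom_ext
        simp
      have e' := congrArg (fun F : Polynomial ℂ →ₐ[ℂ] Polynomial ℂ => F q) e
      simp only [AlgHom.comp_apply, hq, map_zero, AlgHom.id_apply] at e'
      exact e'.symm
    have h2 := congrArg (fun q => Polynomial.coeff q m) (hi _ h')
    simp only [Polynomial.coeff_add, Polynomial.comp_C_mul_X_coeff, hm.neg_one_pow,
      Polynomial.coeff_zero] at h2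
    linear_combination (1 / 2) * h2
  · rw [← sub_eq_zero]
    apply eq_zero_of_coc_eq_zero
    · rw [map_sub, hψ.coc_eq_zero h0 hp, map_sum, zero_sub, neg_eq_zero]
      exact Finset.sum_eq_zero fun m _ => by rw [map_smul, coc_fp (by omega), smul_zero]
    · intro u
      rw [ev_zero_eq, map_sub, map_sum]
      have e : ∀ m ∈ (res p).support, res (((res p).coeff m / (m + 2)) • fp (m + 2)) =
          Polynomial.C ((res p).coeff m) * Polynomial.X ^ m := fun m _ => by
        have hm : (m : ℂ) + 2 ≠ 0 := by
          have : ((m + 2 : ℕ) : ℂ) ≠ 0 := Nat.cast_ne_zero.2 (by omega)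
          push_cast at this
          exact this
        rw [map_smul, res_fp, Polynomial.smul_eq_C_mul, ← mul_assoc, ← Polynomial.C_mul,
          div_mul_cancel₀ _ hm]
      rw [Finset.sum_congr rfl e, ← Polynomial.as_sum_support_C_mul_X_pow, sub_self, map_zero]

/-- The image of `grt_1` in `L_0` is spanned by classes of the `s_n`, `n` odd. -/
theorem Sig_le_sSpan : Sig ≤ sSpan := by
  rintro _ ⟨⟨ψ, h0⟩, hψ, rfl⟩
  replace hψ : IsGrt ψ := hψ
  obtain ⟨p, hp⟩ := exists_sub_nu_mem h0
  obtain ⟨g, hg, e⟩ := hψ.exists_sum h0 hp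
  have h1 : cls 0 ⟨ψ, h0⟩ = cls 0 ⟨nu p, nu_mem p⟩ := by
    rw [← sub_eq_zero, ← map_sub]
    exact (Submodule.Quotient.mk_eq_zero _).2 hp
  have h2 : (⟨nu p, nu_mem p⟩ : ↥(lcs 0).toSubmodule) =
      ∑ m ∈ g.support, (g.coeff m / (m + 2)) • sEl (m + 2) := by
    apply Subtype.ext
    change nu p = (lcs 0).toSubmodule.subtype (∑ m ∈ g.support, (g.coeff m / (m + 2)) • sEl (m + 2))
    conv_lhs => rw [e]
    simp only [map_sum, map_smul]
    rfl
  rw [h1, h2, map_sum]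
  refine Submodule.sum_mem _ fun m hm => ?_
  rw [map_smul]
  refine Submodule.smul_mem _ _ (Submodule.subset_span ⟨m + 2, ?_, ?_, rfl⟩)
  · by_contra hodd
    rw [Nat.not_odd_iff_even] at hodd
    exact (Polynomial.mem_support_iff.1 hm) (hg m (by
      rw [Nat.even_add] at hodd
      exact hodd.2 (by decide)))
  · by_contra h3
    have hm0 : m = 0 := by omega
    exact (Polynomial.mem_support_iff.1 hm) (hg m (by rw [hm0]; exact Even.zero))

end GrtDepth

end

theorem mainTheorem12 (k : ℕ) :
    GrtDepth.IsPure (GrtDepth.depthMmin GrtDepth.Sig k) (k + 2) := by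
  exact GrtDepth.isPure_of_le_sSpan GrtDepth.Sig_le_sSpan k
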